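/- **Setting.** All objects depend on a security parameter $\eta\in\mathbb N$; $f:\mathbb N\to\mathbb R$ is negligible if $\eta^k f(\eta)\to0$ for every $k$. Let $R_\eta\subseteq\mathcal X_\eta\times\mathcal W_\eta$ be relations between bit strings of polynomially bounded lengths and let $G$ be an instance generator, which always outputs a pair $(x,w)\in R_\eta$. "Quantum polynomial-time" means given by quantum circuits of polynomial size (non-uniform) with an arbitrary initial state of polynomially many private qubits (quantum advice). $R$ with $G$ is *hard* if for every quantum polynomial-time $\mathcal B$ the probability $\Pr[(x,w')\in R:(x,w)\leftarrow G,\ w'\leftarrow\mathcal B(x)]$ is negligible. Let $\Sigma=(\mathcal P,\mathcal V)$ be a $\Sigma$-protocol for $R$: on instance $x$ the prover sends $a$, the verifier sends a uniformly random challenge $c$ from a finite non-empty set $\mathcal C_\eta$, the prover sends $z$, and the verifier accepts iff $V(x,a,c,z)$ holds (messages are bit strings of polynomially bounded lengths; no correctness is required). The verifier can sample its challenge efficiently: polynomial-size circuits compute a function of polynomially many random bits whose law has negligible $\ell^1$-distance to the uniform distribution on $\mathcal C_\eta$. $\Sigma$ is a *(computational) proof of knowledge* if there are a polynomial-size black-box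 quantum algorithm $\mathcal K$, a polynomial $p$ that is positive on $\mathbb N$, and a constant $d\ge0$ such that for every two-stage quantum polynomial-time adversary $\mathcal A$ there is a negligible $\kappa$ with $$\Pr[(x,w)\in R: w\leftarrow\mathcal K^{\mathcal A}(x)]\ \ge\ \frac1{p(\eta)}\Pr[\langle\mathcal A,\mathcal V(x)\rangle=\mathrm{accept}]^d-\kappa(\eta)$$ for all $\eta$ and all $x\in\mathcal X_\eta$. Here $\mathcal K$ gets one copy of $\mathcal A$'s initial state, shares the message registers with $\mathcal A$, and acts on $\mathcal A$'s private qubits only through (controlled) calls of the unitaries of $\mathcal A$'s two stages and their inverses. **Signature scheme.** For messages $m$ of polynomially bounded length and a hash function $H$ from bit strings $x\|m\|a$ to $\mathcal C_\eta$, $\mathsf{Sig}[\Sigma]$ is: key generation picks $(x,w)\leftarrow G$, with $sk=(x,w)$ and $pk=x$; to sign $m$, run the prover of $\Sigma$ on $(x,w)$ with challenge $c=H(x\|m\|a)$ and let $\sigma=(a,z)$, repeating up to a given number of times until $V(x,a,H(x\|m\|a),z)$ holds; $\sigma=(a,z)$ is a valid signature of $m$ iff $V(x,a,H(x\|m\|a),z)$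 holds. **Theorem.** Suppose that $R$ with $G$ is hard, that $|\mathcal C_\eta|$ grows faster than every polynomial in $\eta$, and that $\Sigma$ is a proof of knowledge. Then $\mathsf{Sig}[\Sigma]$ is existentially unforgeable under no-message attacks (EUF-NMA) in the quantum random-oracle model: for every quantum polynomial-time oracle algorithm $\mathcal A$, with superposition access to a uniformly random $H$, $$\Pr\big[V(x,a,H(x\|m\|a),z)\;:\;(x,w)\leftarrow G,\ (m,(a,z))\leftarrow\mathcal A^{H}(x)\big]$$ is negligible. -/

import Mathlib

open scoped Matrix
open Filter

/-! ### Asymptotics in the security parameter -/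

/-- Bit strings of length `n`. -/
abbrev Bits (n : ℕ) : Type := Fin n → Bool

/-- `f` is bounded by a polynomial in the security parameter. -/
def PolyBounded (f : ℕ → ℕ) : Prop :=
  ∃ p : Polynomial ℕ, ∀ η, f η ≤ p.eval η

/-- `f` is negligible: it decays faster than every inverse polynomial. -/
def Negligible (f : ℕ → ℝ) : Prop :=
  Asymptotics.SuperpolynomialDecay atTop (fun η : ℕ => (η : ℝ)) f

/-- `f` grows faster than every polynomial. -/
def Superpolynomial (f : ℕ → ℕ) : Prop :=
  ∀ k : ℕ, ∀ᶠ η : ℕ in atTop, η ^ k ≤ f η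

noncomputable section

/-- The average of `f` over a uniformly random element of a finite type. -/
def uniformAvg {α : Type*} [Fintype α] (f : α → ℝ) : ℝ :=
  (∑ a, f a) / (Fintype.card α : ℝ)

/-! ### Qubits, circuits, measurements

A system of qubits is indexed by a finite type `ι`; its computational basis is `ι → Bool`.
Registers are disjoint summands of `ι`. -/

/-- Amplitude vectors of the qubits indexed by `ι`. -/
abbrev QState (ι : Type) : Type := (ι → Bool) → ℂ

/-- Linear operators on the qubits indexed by `ι`, as matrices in the computational basis. -/
abbrev QOp (ι : Type) : Type := Matrix (ι → Bool) (ι → Bool) ℂ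

/-- The computational basis vector `|b⟩`. -/
def ket {ι : Type} [DecidableEq ι] [Fintype ι] (b : ι → Bool) : QState ι :=
  fun b' => if b' = b then 1 else 0

/-- `ψ` is a unit vector. -/
def IsUnitState {ι : Type} [DecidableEq ι] [Fintype ι] (ψ : QState ι) : Prop :=
  ∑ b, ‖ψ b‖ ^ 2 = 1

open Classical in
/-- The probability that measuring, in the computational basis, the qubits at the positions `e`
of the system in state `ψ` gives an outcome `y` with `P y`. -/
def measureProb {ι κ : Type} [DecidableEq ι] [Fintype ι] (e : κ → ι) (ψ : QState ι)
    (P : (κ → Bool) → Prop) : ℝ :=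
  ∑ b : ι → Bool, if P (b ∘ e) then ‖ψ b‖ ^ 2 else 0

open Classical in
/-- The operator `M` on the qubits `κ`, acting on the larger system `ι` at the positions `e`
(an injective map) and as the identity on all other qubits. -/
def QOp.lift {κ ι : Type} (e : κ → ι) (M : QOp κ) : QOp ι :=
  fun b b' => if ∀ i, i ∉ Set.range e → b i = b' i then M (b ∘ e) (b' ∘ e) else 0

/-- The operator `M` controlled on the qubit `t`, for an `M` that does not act on `t`. -/
def QOp.controlled {ι : Type} [DecidableEq ι] [Fintype ι] (t : ι) (M : QOp ι) : QOp ι :=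
  fun b b' => if b' t = true then M b b' else (1 : QOp ι) b b'

/-- An elementary gate: an arbitrary one-qubit unitary, controlled on finitely many other qubits
(possibly none; this includes NOT, Hadamard, phase, CNOT and Toffoli gates). -/
structure QGate (ι : Type) where
  target : ι
  controls : Finset ι
  target_notMem : target ∉ controls
  u : Matrix.unitaryGroup Bool ℂ

/-- The cost of a gate is the number of qubits it touches. -/
def QGate.cost {ι : Type} (g : QGate ι) : ℕ := 1 + g.controls.card

open Classical in
/-- The unitary of a gate. -/
def QGate.toOp {ι : Type} (g : QGate ι) : QOp ι :=
  fun b b' =>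
    if ∀ i ∈ g.controls, b' i = true then
      if ∀ i, i ≠ g.target → b i = b' i then
        (g.u : Matrix Bool Bool ℂ) (b g.target) (b' g.target)
      else 0
    else if b = b' then 1 else 0

/-- A quantum circuit: a list of gates, the head being applied first. -/
abbrev QCircuit (ι : Type) : Type := List (QGate ι)

/-- The size of a circuit. -/
def QCircuit.cost {ι : Type} (c : QCircuit ι) : ℕ := (c.map QGate.cost).sum

/-- The unitary of a circuit. -/
def QCircuit.toOp {ι : Type} [DecidableEq ι] [Fintype ι] : QCircuit ι → QOp ι
  | [] => 1
  | g :: c => QCircuit.toOp c * g.toOp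

/-! ### Quantum algorithms

The description of an algorithm at a given security parameter includes an arbitrary initial state
of its private work register (quantum advice). Intermediate measurements are deferred. -/

/-- A quantum algorithm with classical input of `nin` bits and classical output of `nout` bits.
Its registers are: input, output, work. -/
structure QAlg (nin nout : ℕ) where
  work : ℕ
  init : QState (Fin work)
  init_unit : IsUnitState init
  circ : QCircuit (Fin nin ⊕ Fin nout ⊕ Fin work)

namespace QAlg

variable {nin nout : ℕ}

/-- Number of work qubits plus circuit size. -/
def size (B : QAlg nin nout) : ℕ := B.work + B.circ.cost

/-- The initial state `|x⟩|0⟩|φ₀⟩`. -/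
def start (B : QAlg nin nout) (x : Bits nin) : QState (Fin nin ⊕ Fin nout ⊕ Fin B.work) :=
  fun b =>
    if (∀ i, b (.inl i) = x i) ∧ (∀ i, b (.inr (.inl i)) = false) then
      B.init (fun i => b (.inr (.inr i)))
    else 0

/-- `Pr[P y : y ← B(x)]`. -/
def prob (B : QAlg nin nout) (x : Bits nin) (P : Bits nout → Prop) : ℝ :=
  measureProb (fun i => .inr (.inl i)) (B.circ.toOp *ᵥ B.start x) P

end QAlg

/-- The registers of a quantum oracle algorithm: input, oracle query, oracle answer, output,
work. -/
abbrev OracleReg (nin nq ny nout work : ℕ) : Type :=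
  Fin nin ⊕ Fin nq ⊕ Fin ny ⊕ Fin nout ⊕ Fin work

/-- The permutation `|q⟩|y⟩ ↦ |q⟩|y ⊕ H(q)⟩` of the basis states. -/
def queryMap {nin nq ny nout work : ℕ} (H : Bits nq → Bits ny)
    (b : OracleReg nin nq ny nout work → Bool) : OracleReg nin nq ny nout work → Bool
  | .inr (.inr (.inl j)) =>
      xor (b (.inr (.inr (.inl j)))) (H (fun k => b (.inr (.inl k))) j)
  | i => b i

/-- The oracle unitary `O^H`. -/
def queryOp {nin nq ny nout work : ℕ} (H : Bits nq → Bits ny) :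
    QOp (OracleReg nin nq ny nout work) :=
  fun b b' => if b = queryMap H b' then 1 else 0

/-- A quantum oracle algorithm with superposition access to a function from `nq` bits to `ny`
bits: it applies the circuit `first`, then for each circuit in `rounds` makes one oracle query
and applies that circuit, and finally measures its output register. -/
structure QOracleAlg (nin nq ny nout : ℕ) where
  work : ℕ
  init : QState (Fin work)
  init_unit : IsUnitState init
  first : QCircuit (OracleReg nin nq ny nout work)
  rounds : List (QCircuit (OracleReg nin nq ny nout work))

namespace QOracleAlg

variable {nin nq ny nout : ℕ}

/-- The number of oracle queries. -/
def queries (A : QOracleAlg nin nq ny nout) : ℕ := A.rounds.length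

/-- Number of work qubits plus number of queries plus total circuit size. -/
def size (A : QOracleAlg nin nq ny nout) : ℕ :=
  A.work + A.queries + A.first.cost + (A.rounds.map QCircuit.cost).sum

/-- The initial state `|x⟩|0⟩|0⟩|0⟩|φ₀⟩`. -/
def start (A : QOracleAlg nin nq ny nout) (x : Bits nin) :
    QState (OracleReg nin nq ny nout A.work) :=
  fun b =>
    if (∀ i, b (.inl i) = x i) ∧ (∀ i, b (.inr (.inl i)) = false) ∧
        (∀ i, b (.inr (.inr (.inl i))) = false) ∧
        (∀ i, b (.inr (.inr (.inr (.inl i)))) = false) then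
      A.init (fun i => b (.inr (.inr (.inr (.inr i)))))
    else 0

/-- The final state `A_q O^H ⋯ A_1 O^H A_0 |start⟩`. -/
def final (A : QOracleAlg nin nq ny nout) (H : Bits nq → Bits ny) (x : Bits nin) :
    QState (OracleReg nin nq ny nout A.work) :=
  A.rounds.foldl (fun ψ c => QCircuit.toOp c *ᵥ (queryOp H *ᵥ ψ))
    (A.first.toOp *ᵥ A.start x)

/-- `Pr[P y : y ← A^H(x)]`. -/
def prob (A : QOracleAlg nin nq ny nout) (H : Bits nq → Bits ny) (x : Bits nin)
    (P : Bits nout → Prop) : ℝ :=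
  measureProb (fun i => .inr (.inr (.inr (.inl i)))) (A.final H x) P

end QOracleAlg

/-! ### Hard relations -/

/-- A family, indexed by the security parameter, of relations `R ⊆ 𝒳 × 𝒲` between instances
`𝒳 ⊆ {0,1}^nx` and witnesses in `{0,1}^nw`. -/
structure RelFamily where
  nx : ℕ → ℕ
  nw : ℕ → ℕ
  nx_poly : PolyBounded nx
  nw_poly : PolyBounded nw
  inst : ∀ η, Set (Bits (nx η))
  rel : ∀ η, Bits (nx η) → Bits (nw η) → Prop
  rel_inst : ∀ η x w, rel η x w → x ∈ inst η

/-- An instance generator: it always outputs a pair in the relation. -/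
structure InstanceGen (R : RelFamily) where
  gen : ∀ η, PMF (Bits (R.nx η) × Bits (R.nw η))
  gen_rel : ∀ η, ∀ xw ∈ (gen η).support, R.rel η xw.1 xw.2

/-- The relation `R` with the instance generator `G` is hard: every quantum polynomial-time
algorithm, given `x` from `(x, w) ← G`, finds a witness for `x` with negligible probability. -/
def IsHard (R : RelFamily) (G : InstanceGen R) : Prop :=
  ∀ B : ∀ η, QAlg (R.nx η) (R.nw η), PolyBounded (fun η => (B η).size) →
    Negligible fun η =>
      ∑ xw, (G.gen η xw).toReal * (B η).prob xw.1 (fun w' => R.rel η xw.1 w')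

/-! ### Σ-protocols -/

/-- A Σ-protocol for `R`: the prover sends `a`, the verifier a uniformly random `c ∈ chal`, the
prover `z`, and the verifier accepts iff `verify x a c z`. The honest prover is given by the
law of its first message and the conditional law, given `a` and `c`, of its response. No
correctness is required. -/
structure SigmaProtocol (R : RelFamily) where
  na : ℕ → ℕ
  nc : ℕ → ℕ
  nz : ℕ → ℕ
  na_poly : PolyBounded na
  nc_poly : PolyBounded nc
  nz_poly : PolyBounded nz
  chal : ∀ η, Finset (Bits (nc η))
  chal_nonempty : ∀ η, (chal η).Nonempty
  commit : ∀ η, Bits (R.nx η) → Bits (R.nw η) → PMF (Bits (na η))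
  respond : ∀ η, Bits (R.nx η) → Bits (R.nw η) → Bits (na η) → Bits (nc η) → PMF (Bits (nz η))
  verify : ∀ η, Bits (R.nx η) → Bits (na η) → Bits (nc η) → Bits (nz η) → Prop

/-- The challenge space has superpolynomial size. -/
def SigmaProtocol.SuperpolyChallenges {R : RelFamily} (S : SigmaProtocol R) : Prop :=
  Superpolynomial fun η => (S.chal η).card

open Classical in
/-- The verifier can sample its challenge in polynomial time: a function `f` of polynomially many
random bits, computed by polynomial-size circuits, has an output whose law is
negligibly close, in `ℓ¹` distance, to the uniform distribution on the challenge space. -/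
def SigmaProtocol.EfficientChallenges {R : RelFamily} (S : SigmaProtocol R) : Prop :=
  ∃ (r m : ℕ → ℕ) (f : ∀ η, Bits (r η) → Bits (S.nc η))
    (circ : ∀ η, QCircuit (Fin (r η) ⊕ Fin (S.nc η) ⊕ Fin (m η))),
    PolyBounded r ∧ PolyBounded m ∧ PolyBounded (fun η => (circ η).cost) ∧
    (∀ η u, (circ η).toOp *ᵥ
        ket (Sum.elim u (Sum.elim (fun _ => false) (fun _ => false))) =
      ket (Sum.elim u (Sum.elim (f η u) (fun _ => false)))) ∧
    Negligible fun η => ∑ c : Bits (S.nc η),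
      |uniformAvg (fun u : Bits (r η) => if f η u = c then (1 : ℝ) else 0) -
        (if c ∈ S.chal η then ((S.chal η).card : ℝ)⁻¹ else 0)|

/-- A two-stage quantum adversary against a Σ-protocol (a dishonest prover), for a fixed instance.
Its private work register starts in an arbitrary state. The first stage acts on the message
register for `a` (initially `0`) and the work register, after which `a` is measured. The second
stage acts on the registers for `c` (holding the challenge) and `z` (initially `0`) and the work
register, after which `z` is measured. -/
structure SigmaAdversary (na nc nz : ℕ) where
  work : ℕ
  init : QState (Fin work)
  init_unit : IsUnitState init
  stage₁ : QCircuit (Fin na ⊕ Fin work)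
  stage₂ : QCircuit ((Fin nc ⊕ Fin nz) ⊕ Fin work)

namespace SigmaAdversary

variable {na nc nz : ℕ}

/-- Number of work qubits plus total circuit size. -/
def size (A : SigmaAdversary na nc nz) : ℕ := A.work + A.stage₁.cost + A.stage₂.cost

/-- The state after the first stage, before `a` is measured. -/
def state₁ (A : SigmaAdversary na nc nz) : QState (Fin na ⊕ Fin A.work) :=
  A.stage₁.toOp *ᵥ fun b =>
    if ∀ i, b (.inl i) = false then A.init (fun i => b (.inr i)) else 0

/-- The (subnormalized) state after the second stage, when the first message was measured to be
`a` and the challenge is `c`; its squared norm is the probability of `a`. -/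
def state₂ (A : SigmaAdversary na nc nz) (a : Bits na) (c : Bits nc) :
    QState ((Fin nc ⊕ Fin nz) ⊕ Fin A.work) :=
  A.stage₂.toOp *ᵥ fun b =>
    if (∀ i, b (.inl (.inl i)) = c i) ∧ (∀ i, b (.inl (.inr i)) = false) then
      A.state₁ (Sum.elim a (fun i => b (.inr i)))
    else 0

end SigmaAdversary

/-- `Pr[⟨A, 𝒱(x)⟩ = accept]`. -/
def SigmaProtocol.acceptProb {R : RelFamily} (S : SigmaProtocol R) (η : ℕ) (x : Bits (R.nx η))
    (A : SigmaAdversary (S.na η) (S.nc η) (S.nz η)) : ℝ :=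
  uniformAvg fun c : {c // c ∈ S.chal η} =>
    ∑ a, measureProb (fun i => .inl (.inr i)) (A.state₂ a c) (fun z => S.verify η x a c z)

/-! ### Black-box knowledge extractors -/

/-- The registers of an extractor itself: its input `x`, its output `w`, and its work space. -/
abbrev OwnReg (nx nw m : ℕ) : Type := Fin nx ⊕ Fin nw ⊕ Fin m

/-- The message registers `a`, `c`, `z` that an extractor shares with the prover. -/
abbrev MsgReg (na nc nz : ℕ) : Type := Fin na ⊕ (Fin nc ⊕ Fin nz)

/-- The instructions of a black-box algorithm with oracle access to a two-stage prover: apply a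
gate to its own and the message registers, or call the unitary of one of the two stages of the
prover (or the inverse of that unitary, if `inv` is true), possibly controlled on one of its own
qubits. -/
inductive BBInstr (nx nw m na nc nz : ℕ) where
  | gate (g : QGate (OwnReg nx nw m ⊕ MsgReg na nc nz))
  | call₁ (inv : Bool) (ctrl : Option (OwnReg nx nw m))
  | call₂ (inv : Bool) (ctrl : Option (OwnReg nx nw m))

namespace BBInstr

variable {nx nw m na nc nz : ℕ}

/-- A call counts as one step. -/
def cost : BBInstr nx nw m na nc nz → ℕ
  | .gate g => g.cost
  | .call₁ _ _ => 1
  | .call₂ _ _ => 1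

/-- `U` or its inverse, possibly controlled. -/
def callOp {ι own : Type} [DecidableEq ι] [Fintype ι] (U : QOp ι) (pos : own → ι) (inv : Bool)
    (ctrl : Option own) : QOp ι :=
  let U' : QOp ι := if inv then Uᴴ else U
  match ctrl with
  | none => U'
  | some t => QOp.controlled (pos t) U'

/-- The effect of an instruction on the joint system of the extractor's registers, the message
registers and the prover's `k` private qubits, where `U₁` and `U₂` are the unitaries of the
prover's two stages. The extractor acts on the private qubits by calls only. -/
def toOp {k : ℕ} (U₁ : QOp (Fin na ⊕ Fin k)) (U₂ : QOp ((Fin nc ⊕ Fin nz) ⊕ Fin k)) :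
    BBInstr nx nw m na nc nz → QOp ((OwnReg nx nw m ⊕ MsgReg na nc nz) ⊕ Fin k)
  | .gate g => QOp.lift Sum.inl g.toOp
  | .call₁ inv ctrl =>
      callOp (QOp.lift (Sum.map (fun i => .inr (.inl i)) id) U₁) (fun t => .inl (.inl t)) inv ctrl
  | .call₂ inv ctrl =>
      callOp (QOp.lift (Sum.map (fun i => .inr (.inr i)) id) U₂) (fun t => .inl (.inl t)) inv ctrl

end BBInstr

/-- A black-box extractor at a given security parameter. It does not depend on the prover. -/
structure BBExtractor (nx nw na nc nz : ℕ) where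
  work : ℕ
  prog : List (BBInstr nx nw work na nc nz)

namespace BBExtractor

variable {nx nw na nc nz : ℕ}

/-- Number of work qubits plus running time, each call counting as one step. -/
def size (K : BBExtractor nx nw na nc nz) : ℕ := K.work + (K.prog.map BBInstr.cost).sum

/-- The final state of `K^A(x)`. The prover's private register starts in the prover's initial
state (of which there is one copy), the input register in `|x⟩`, all else in `|0⟩`. -/
def final (K : BBExtractor nx nw na nc nz) (A : SigmaAdversary na nc nz) (x : Bits nx) :
    QState ((OwnReg nx nw K.work ⊕ MsgReg na nc nz) ⊕ Fin A.work) :=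
  K.prog.foldl (fun ψ t => t.toOp A.stage₁.toOp A.stage₂.toOp *ᵥ ψ) fun b =>
    if (∀ i, b (.inl (.inl (.inl i))) = x i) ∧ (∀ i, b (.inl (.inl (.inr i))) = false) ∧
        (∀ i, b (.inl (.inr i)) = false) then
      A.init (fun i => b (.inr i))
    else 0

/-- `Pr[P w : w ← K^A(x)]`. -/
def prob (K : BBExtractor nx nw na nc nz) (A : SigmaAdversary na nc nz) (x : Bits nx)
    (P : Bits nw → Prop) : ℝ :=
  measureProb (fun i => .inl (.inl (.inr (.inl i)))) (K.final A x) P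

end BBExtractor

/-- The Σ-protocol is a (computational) proof of knowledge, with negligible knowledge error, for
static adversaries. -/
def SigmaProtocol.IsProofOfKnowledge {R : RelFamily} (S : SigmaProtocol R) : Prop :=
  ∃ (K : ∀ η, BBExtractor (R.nx η) (R.nw η) (S.na η) (S.nc η) (S.nz η))
    (p : Polynomial ℕ) (d : ℝ),
    PolyBounded (fun η => (K η).size) ∧ (∀ η, 0 < p.eval η) ∧ 0 ≤ d ∧
    ∀ A : ∀ η, SigmaAdversary (S.na η) (S.nc η) (S.nz η), PolyBounded (fun η => (A η).size) →
      ∃ κ : ℕ → ℝ, Negligible κ ∧ ∀ η, ∀ x ∈ R.inst η,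
        (K η).prob (A η) x (fun w => R.rel η x w) ≥
          1 / ((p.eval η : ℕ) : ℝ) * (S.acceptProb η x (A η)) ^ d - κ η

/-! ### The Fiat–Shamir transformation -/

namespace SigmaProtocol

variable {R : RelFamily}

/-- The type of hash functions for the Fiat–Shamir transformation at security parameter `η`;
`(x, a)` is hashed as the concatenation of `x` and `a`. -/
abbrev Hash (S : SigmaProtocol R) (η : ℕ) : Type :=
  Bits (R.nx η + S.na η) → {c // c ∈ S.chal η}

/-- One run of the Fiat–Shamir prover. -/
def fsRun (S : SigmaProtocol R) (η : ℕ) (H : S.Hash η) (x : Bits (R.nx η)) (w : Bits (R.nw η)) :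
    PMF (Bits (S.na η) × Bits (S.nz η)) :=
  (S.commit η x w).bind fun a =>
    (S.respond η x w a (H (Fin.append x a))).map fun z => (a, z)

/-- The check of the Fiat–Shamir verifier. -/
def fsVerify (S : SigmaProtocol R) (η : ℕ) (H : S.Hash η) (x : Bits (R.nx η))
    (π : Bits (S.na η) × Bits (S.nz η)) : Prop :=
  S.verify η x π.1 (H (Fin.append x π.1)) π.2

open Classical in
/-- The Fiat–Shamir prover: it repeats the run until the proof verifies, at most `n` more times
after the first run. -/
def fsProve (S : SigmaProtocol R) (η : ℕ) (H : S.Hash η) (x : Bits (R.nx η))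
    (w : Bits (R.nw η)) : ℕ → PMF (Bits (S.na η) × Bits (S.nz η))
  | 0 => S.fsRun η H x w
  | n + 1 => (S.fsRun η H x w).bind fun π =>
      if S.fsVerify η H x π then PMF.pure π else fsProve S η H x w n

end SigmaProtocol

/-! ### Signature schemes in the random-oracle model -/

/-- A signature scheme in the random-oracle model. The oracle maps `nq`-bit strings to the
nonempty set `range` of `ny`-bit strings. Public keys, messages and signatures have `npk`, `nm`
and `ns` bits. -/
structure ROSignature where
  npk : ℕ → ℕ
  nm : ℕ → ℕ
  ns : ℕ → ℕ
  nq : ℕ → ℕ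
  ny : ℕ → ℕ
  range : ∀ η, Finset (Bits (ny η))
  range_nonempty : ∀ η, (range η).Nonempty
  SK : ℕ → Type
  gen : ∀ η, PMF (Bits (npk η) × SK η)
  sign : ∀ η, (Bits (nq η) → {c // c ∈ range η}) → SK η → Bits (nm η) → PMF (Bits (ns η))
  verify : ∀ η, (Bits (nq η) → {c // c ∈ range η}) →
    Bits (npk η) → Bits (nm η) → Bits (ns η) → Prop

namespace ROSignature

/-- The advantage of a quantum no-message adversary, which gets the public key and superposition
access to a uniformly random oracle `H`, and outputs a message followed by a signature. -/
def advNMA (T : ROSignature) (η : ℕ)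
    (A : QOracleAlg (T.npk η) (T.nq η) (T.ny η) (T.nm η + T.ns η)) : ℝ :=
  ∑ pk, (((T.gen η).map Prod.fst) pk).toReal *
    uniformAvg fun H : Bits (T.nq η) → {c // c ∈ T.range η} =>
      A.prob (fun q => (H q : Bits (T.ny η))) pk fun out =>
        T.verify η H pk (fun i => out (Fin.castAdd _ i)) (fun i => out (Fin.natAdd _ i))

/-- Existential unforgeability under no-message attacks against quantum polynomial-time
adversaries in the quantum random-oracle model. -/
def EUFNMA (T : ROSignature) : Prop :=
  ∀ A : ∀ η, QOracleAlg (T.npk η) (T.nq η) (T.ny η) (T.nm η + T.ns η),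
    PolyBounded (fun η => (A η).size) → Negligible fun η => T.advNMA η (A η)

end ROSignature

/-! ### Fiat–Shamir signatures -/

/-- Polynomially bounded functions are closed under addition. -/
theorem PolyBounded.add {f g : ℕ → ℕ} (hf : PolyBounded f) (hg : PolyBounded g) :
    PolyBounded fun η => f η + g η := by
  obtain ⟨p, hp⟩ := hf
  obtain ⟨q, hq⟩ := hg
  exact ⟨p + q, fun η => by rw [Polynomial.eval_add]; exact add_le_add (hp η) (hq η)⟩

/-- The relation `R*` on composite instances `x ‖ m`, which ignores the `nm`-bit message `m`. -/
def RelFamily.star (R : RelFamily) (nm : ℕ → ℕ) (hm : PolyBounded nm) : RelFamily where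
  nx η := R.nx η + nm η
  nw := R.nw
  nx_poly := R.nx_poly.add hm
  nw_poly := R.nw_poly
  inst η := {y | (fun i => y (Fin.castAdd _ i)) ∈ R.inst η}
  rel η y w := R.rel η (fun i => y (Fin.castAdd _ i)) w
  rel_inst η _ w h := R.rel_inst η _ w h

/-- The Σ-protocol `Σ*` for composite instances `x ‖ m`, which ignores `m`. -/
def SigmaProtocol.star {R : RelFamily} (S : SigmaProtocol R) (nm : ℕ → ℕ) (hm : PolyBounded nm) :
    SigmaProtocol (R.star nm hm) where
  na := S.na
  nc := S.nc
  nz := S.nz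
  na_poly := S.na_poly
  nc_poly := S.nc_poly
  nz_poly := S.nz_poly
  chal := S.chal
  chal_nonempty := S.chal_nonempty
  commit η y w := S.commit η (fun i => y (Fin.castAdd _ i)) w
  respond η y w := S.respond η (fun i => y (Fin.castAdd _ i)) w
  verify η y := S.verify η (fun i => y (Fin.castAdd _ i))

/-- The Fiat–Shamir signature scheme `Sig[Σ]` for `nm`-bit messages. The secret key is `(x, w)`,
the public key is `x`, and a signature of `m` is a Fiat–Shamir proof `(a, z)` for `x ‖ m` with
respect to `Σ*`, encoded as the concatenation of `a` and `z`. The signer makes at most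
`reps η` repetitions. -/
def SigmaProtocol.signature {R : RelFamily} (S : SigmaProtocol R) (G : InstanceGen R)
    (nm : ℕ → ℕ) (hm : PolyBounded nm) (reps : ℕ → ℕ) : ROSignature where
  npk := R.nx
  nm := nm
  ns η := S.na η + S.nz η
  nq η := R.nx η + nm η + S.na η
  ny := S.nc
  range := S.chal
  range_nonempty := S.chal_nonempty
  SK η := Bits (R.nx η) × Bits (R.nw η)
  gen η := (G.gen η).map fun xw => (xw.1, xw)
  sign η H sk m :=
    ((S.star nm hm).fsProve η H (Fin.append sk.1 m) sk.2 (reps η)).map fun π =>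
      Fin.append π.1 π.2
  verify η H pk m σ :=
    (S.star nm hm).fsVerify η H (Fin.append pk m)
      (fun i => σ (Fin.castAdd _ i), fun i => σ (Fin.natAdd _ i))

end

/-!
A forger `A` that makes `q` quantum queries to a random oracle `H` is turned into an efficient
dishonest prover for the Σ-protocol; the knowledge extractor, run on this prover, is then an
efficient algorithm that finds witnesses, against the hardness of the relation.

*Measure and reprogram.* The forger succeeds if the challenge `H y` verifies, where `y = x ‖ m ‖ a` is
read off from its output. Drawing the value `H y` anew does not change the law of `H`, so `H y` may
be replaced by an independent challenge `c`, with the oracle reprogrammed at `y` to `c`. Telescoping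
over the queries and Cauchy–Schwarz (`sqNorm_restrictTo_runRounds_le`) bound the success
probability with the reprogrammed oracle, for each fixed oracle `H`, by `2 q + 1` times the sum of
the success probabilities of `2 q + 1` dishonest provers: such a prover stops the forger just before
one of its queries (or at its end), measures the query point, sends its last part `a` as first
message, and answers this query (or only the later ones) with the oracle reprogrammed to the challenge
at the measured point (`sum_reprogrammed_le`).

*Making the prover efficient.* The prover cannot store a random function. First, the oracle values
are replaced by outputs of the sampler of the verifier. A union bound over the exponentially many
values would lose too much; instead the two laws are written as mixtures with a common part, and the
points at which the mixtures differ form a sparse random set, on which a second application of the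
hybrid argument shows that replacing the values changes little (`prodExp_success_le`). Secondly, the
success probability with a reprogrammed oracle is a polynomial of degree at most `2 q` in the
indicators of the oracle values (`norm_sq_runRounds_mem_degreeLE`), so a function whose values at any
`2 q + 1` points are independent serves as well (`sum_mul_eq_of_mem_degreeLE`). Such functions are
given by random `𝔽₂`-linear images of the first powers of the query, read as an element of a finite
field of characteristic two (`linearHash_independent`), followed by the sampler. They are computed by
explicit circuits of controlled NOT gates (`computeCirc`), also in a version that is reprogrammed at
a marked point (`markedQuery`). The prover is non-uniform, so the best index of the hash function and
the best of the `2 q + 1` provers can be fixed (`exists_advNMA_le`).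

*Extraction.* The circuits of the prover do not depend on the public key `x`, which only enters its
initial state. So the extractor can be run by an algorithm that gets `x` as its input, copies it to
the private register of the prover, and executes each black-box call as a circuit
(`BBExtractor.finder_prob`). The knowledge error belongs to a family of provers that has a single
member for each security parameter; applying the definition to the instances with the largest
extraction deficit makes the error uniform in the instance. By convexity of the power function, the
mean acceptance probability has a power that is negligible, hence is negligible itself
(`negligible_acceptProb`).
-/

set_option linter.unusedSectionVars false
set_option synthInstance.maxSize 512

/-! ### Matrices acting on qubits -/

/-- The squared `ℓ²` norm of an amplitude vector. -/
noncomputable def sqNorm {α : Type*} [Fintype α] (ψ : α → ℂ) : ℝ := ∑ b, ‖ψ b‖ ^ 2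

theorem sqNorm_mulVec {α : Type*} [Fintype α] [DecidableEq α] {M : Matrix α α ℂ}
    (hM : Mᴴ * M = 1) (ψ : α → ℂ) : sqNorm (M *ᵥ ψ) = sqNorm ψ := by
  have key : ∀ v : α → ℂ, ((sqNorm v : ℝ) : ℂ) = star v ⬝ᵥ v := by
    intro v
    simp only [sqNorm, dotProduct, Pi.star_apply]
    push_cast
    refine Finset.sum_congr rfl fun b _ => ?_
    rw [RCLike.star_def, Complex.conj_mul']
  apply Complex.ofReal_injective
  rw [key, key, Matrix.star_mulVec, ← Matrix.dotProduct_mulVec, Matrix.mulVec_mulVec, hM,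
    Matrix.one_mulVec]

theorem Matrix.ext_mulVec {α : Type*} [Fintype α] [DecidableEq α] {M M' : Matrix α α ℂ}
    (h : ∀ ψ, M *ᵥ ψ = M' *ᵥ ψ) : M = M' :=
  Matrix.toLin'.injective (LinearMap.ext fun ψ => by simpa using h ψ)

section Lift

variable {κ ι : Type} [Fintype κ] [DecidableEq κ] [Fintype ι] [DecidableEq ι]

theorem QOp.lift_mulVec (e : κ ↪ ι) (M : QOp κ) (Ψ : QState ι) (b : ι → Bool) :
    (QOp.lift e M *ᵥ Ψ) b = (M *ᵥ fun b' => Ψ (Function.extend e b' b)) (b ∘ e) := by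
  classical
  symm
  simp only [Matrix.mulVec, dotProduct]
  refine Finset.sum_of_injOn (fun b' => Function.extend e b' b) ?_
    (fun _ _ => Finset.mem_coe.2 (Finset.mem_univ _)) ?_ ?_
  · intro b₁ _ b₂ _ h
    funext i
    have := congrFun h (e i)
    simpa [e.injective.extend_apply] using this
  · intro b'' _ h
    have : ¬ ∀ i, i ∉ Set.range e → b i = b'' i := by
      intro h'
      apply h
      refine ⟨b'' ∘ e, by simp, ?_⟩
      funext i
      by_cases hi : i ∈ Set.range e
      · obtain ⟨j, rfl⟩ := hi
        simp [e.injective.extend_apply]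
      · exact (Function.extend_apply' _ _ _ hi).trans (h' i hi)
    simp only [QOp.lift, if_neg this, zero_mul]
  · intro b' _
    have h1 : ∀ i, i ∉ Set.range e → b i = Function.extend e b' b i := fun i hi => by
      rw [Function.extend_apply' _ _ _ hi]
    have h2 : Function.extend e b' b ∘ e = b' := by
      funext j; simp [e.injective.extend_apply]
    simp only [QOp.lift, if_pos h1, h2]

theorem QOp.extend_comp (e : κ ↪ ι) (b : κ → Bool) (b' : ι → Bool) :
    Function.extend e b b' ∘ e = b := by
  funext j; simp [e.injective.extend_apply]

theorem QOp.extend_extend (e : κ ↪ ι) (b₁ b₂ : κ → Bool) (b' : ι → Bool) :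
    Function.extend e b₁ (Function.extend e b₂ b') = Function.extend e b₁ b' := by
  funext i
  by_cases hi : i ∈ Set.range e
  · obtain ⟨j, rfl⟩ := hi
    simp [e.injective.extend_apply]
  · simp [Function.extend_apply' _ _ _ hi]

theorem QOp.extend_self (e : κ ↪ ι) (b : ι → Bool) : Function.extend e (b ∘ e) b = b := by
  funext i
  by_cases hi : i ∈ Set.range e
  · obtain ⟨j, rfl⟩ := hi
    simp [e.injective.extend_apply]
  · simp [Function.extend_apply' _ _ _ hi]

theorem QOp.lift_one (e : κ ↪ ι) : QOp.lift e (1 : QOp κ) = 1 := by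
  refine Matrix.ext_mulVec fun ψ => ?_
  funext b
  rw [QOp.lift_mulVec, Matrix.one_mulVec, Matrix.one_mulVec, QOp.extend_self]

theorem QOp.lift_mul (e : κ ↪ ι) (M M' : QOp κ) :
    QOp.lift e (M * M') = QOp.lift e M * QOp.lift e M' := by
  refine Matrix.ext_mulVec fun ψ => ?_
  funext b
  rw [← Matrix.mulVec_mulVec, QOp.lift_mulVec, QOp.lift_mulVec, ← Matrix.mulVec_mulVec]
  refine congrFun (congrArg _ ?_) _
  funext b'
  rw [QOp.lift_mulVec, QOp.extend_comp]
  simp only [QOp.extend_extend]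

end Lift

/-! ### Gates and circuits -/

section Gates

variable {κ ι : Type} [Fintype κ] [DecidableEq κ] [Fintype ι] [DecidableEq ι]

/-- The inverse of a gate. -/
def QGate.inverse (g : QGate ι) : QGate ι := { g with u := g.u⁻¹ }

/-- A gate, applied at the positions `e` of a larger system. -/
def QGate.rename (e : κ ↪ ι) (g : QGate κ) : QGate ι where
  target := e g.target
  controls := g.controls.map e
  target_notMem := by simpa using g.target_notMem
  u := g.u

/-- A gate, additionally controlled on the qubit `t`. If `t` is the target of the gate, then the
gate is left as it is. -/
def QGate.control (t : ι) (g : QGate ι) : QGate ι where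
  target := g.target
  controls := if g.target = t then g.controls else insert t g.controls
  target_notMem := by
    split_ifs with h
    · exact g.target_notMem
    · simpa [h] using g.target_notMem
  u := g.u

theorem QGate.toOp_mulVec (g : QGate ι) (ψ : QState ι) (b : ι → Bool) :
    (g.toOp *ᵥ ψ) b = if ∀ i ∈ g.controls, b i = true then
        ∑ v : Bool, (g.u : Matrix Bool Bool ℂ) (b g.target) v * ψ (Function.update b g.target v)
      else ψ b := by
  classical
  have hc : ∀ b' : ι → Bool, (∀ i, i ≠ g.target → b i = b' i) →
      ((∀ i ∈ g.controls, b' i = true) ↔ ∀ i ∈ g.controls, b i = true) := by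
    intro b' h
    refine forall_congr' fun i => imp_congr_right fun hi => ?_
    have : i ≠ g.target := fun h' => g.target_notMem (h' ▸ hi)
    rw [h i this]
  split_ifs with h
  · symm
    simp only [Matrix.mulVec, dotProduct]
    refine Finset.sum_of_injOn (fun v => Function.update b g.target v) ?_
      (fun _ _ => Finset.mem_coe.2 (Finset.mem_univ _)) ?_ ?_
    · intro v _ w _ hvw
      simpa using congrFun hvw g.target
    · intro b' _ hb'
      have hne : ¬ ∀ i, i ≠ g.target → b i = b' i := by
        intro h'
        apply hb'
        refine ⟨b' g.target, by simp, ?_⟩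
        funext i
        by_cases hi : i = g.target
        · subst hi; simp
        · simp [hi, h' i hi]
      have hne' : b ≠ b' := fun h' => hne fun i _ => by rw [h']
      simp only [QGate.toOp, if_neg hne, if_neg hne', ite_self, zero_mul]
    · intro v _
      have h1 : ∀ i, i ≠ g.target → b i = Function.update b g.target v i := fun i hi => by
        simp [hi]
      simp only [QGate.toOp, if_pos h1, if_pos ((hc _ h1).2 h), Function.update_self]
  · simp only [Matrix.mulVec, dotProduct]
    rw [Finset.sum_eq_single b]
    · simp only [QGate.toOp, if_neg h, if_true, one_mul]
    · intro b' _ hb'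
      by_cases h' : ∀ i, i ≠ g.target → b i = b' i
      · simp only [QGate.toOp, if_neg (fun h'' => h ((hc _ h').1 h'')), if_neg hb'.symm, zero_mul]
      · simp only [QGate.toOp, if_neg h', if_neg hb'.symm, ite_self, zero_mul]
    · intro hb
      exact absurd (Finset.mem_univ _) hb

theorem QGate.toOp_rename (e : κ ↪ ι) (g : QGate κ) :
    (g.rename e).toOp = QOp.lift e g.toOp := by
  refine Matrix.ext_mulVec fun ψ => ?_
  funext b
  rw [QGate.toOp_mulVec, QOp.lift_mulVec, QGate.toOp_mulVec]
  simp only [QGate.rename, Finset.forall_mem_map, Function.comp_apply, QOp.extend_self]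
  congr 1
  refine Finset.sum_congr rfl fun v _ => ?_
  congr 2
  funext i
  by_cases hi : i ∈ Set.range e
  · obtain ⟨j, rfl⟩ := hi
    rw [e.injective.extend_apply]
    by_cases hj : j = g.target
    · subst hj; simp
    · simp [hj, e.injective.ne hj]
  · rw [Function.extend_apply' _ _ _ hi, Function.update_of_ne]
    rintro rfl
    exact hi ⟨_, rfl⟩

theorem QGate.inverse_mul (g : QGate ι) : g.inverse.toOp * g.toOp = 1 := by
  refine Matrix.ext_mulVec fun ψ => ?_
  funext b
  rw [← Matrix.mulVec_mulVec, Matrix.one_mulVec, QGate.toOp_mulVec]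
  simp only [QGate.toOp_mulVec]
  have hc : ∀ v, (∀ i ∈ g.controls, Function.update b g.target v i = true) ↔
      ∀ i ∈ g.controls, b i = true := by
    intro v
    refine forall_congr' fun i => imp_congr_right fun hi => ?_
    have : i ≠ g.target := fun h' => g.target_notMem (h' ▸ hi)
    rw [Function.update_of_ne this]
  by_cases h : ∀ i ∈ g.controls, b i = true
  · have hu : ∀ v w : Bool, ∑ x, ((g.u⁻¹ : Matrix.unitaryGroup Bool ℂ) : Matrix Bool Bool ℂ) v x *
        (g.u : Matrix Bool Bool ℂ) x w = (1 : Matrix Bool Bool ℂ) v w := by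
      intro v w
      rw [← Matrix.mul_apply, ← Submonoid.coe_mul, inv_mul_cancel, Submonoid.coe_one]
    have h' : ∀ i ∈ g.inverse.controls, b i = true := h
    rw [if_pos h']
    simp only [QGate.inverse, hc, if_pos h, Function.update_self,
      Function.update_idem, Finset.mul_sum, ← mul_assoc]
    rw [Finset.sum_comm]
    simp only [← Finset.sum_mul, hu, Matrix.one_apply, ite_mul, one_mul, zero_mul,
      Finset.sum_ite_eq, Finset.mem_univ, if_true, Function.update_eq_self]
  · have h' : ¬ ∀ i ∈ g.inverse.controls, b i = true := h
    rw [if_neg h', if_neg h]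

theorem QGate.inverse_toOp (g : QGate ι) : g.inverse.toOp = g.toOpᴴ := by
  ext b b'
  have hu : ∀ v w, ((g.u⁻¹ : Matrix.unitaryGroup Bool ℂ) : Matrix Bool Bool ℂ) v w =
      star ((g.u : Matrix Bool Bool ℂ) w v) := by
    intro v w; rfl
  have e1 : (∀ i, i ≠ g.target → b' i = b i) ↔ (∀ i, i ≠ g.target → b i = b' i) :=
    forall_congr' fun i => imp_congr_right fun _ => eq_comm
  simp only [QGate.toOp, QGate.inverse, Matrix.conjTranspose_apply, hu, e1, @eq_comm _ b' b]
  by_cases h : ∀ i, i ≠ g.target → b i = b' i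
  · have : (∀ i ∈ g.controls, b' i = true) ↔ ∀ i ∈ g.controls, b i = true := by
      refine forall_congr' fun i => imp_congr_right fun hi => ?_
      have : i ≠ g.target := fun h' => g.target_notMem (h' ▸ hi)
      rw [h i this]
    simp only [this]
    split_ifs <;> simp
  · have hne : b ≠ b' := fun h' => h fun i _ => by rw [h']
    simp only [if_neg h, if_neg hne, ite_self, star_zero]

theorem QGate.control_mulVec (t : ι) (g : QGate ι) (h : g.target ≠ t) :
    (g.control t).toOp = QOp.controlled t g.toOp := by
  refine Matrix.ext_mulVec fun ψ => ?_
  funext b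
  have hg := QGate.toOp_mulVec g (fun b' => if b' t = true then ψ b' else 0) b
  have h1 : (QOp.controlled t g.toOp *ᵥ ψ) b =
      (g.toOp *ᵥ fun b' => if b' t = true then ψ b' else 0) b +
        if b t = true then 0 else ψ b := by
    have : (if b t = true then 0 else ψ b) =
        ((1 : QOp ι) *ᵥ fun b' => if b' t = true then 0 else ψ b') b := by
      rw [Matrix.one_mulVec]
    rw [this]
    simp only [Matrix.mulVec, dotProduct, ← Finset.sum_add_distrib]
    refine Finset.sum_congr rfl fun b' _ => ?_
    by_cases hb : b' t = true <;> simp [QOp.controlled, hb]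
  rw [h1, hg, QGate.toOp_mulVec]
  simp only [QGate.control, if_neg h, Finset.forall_mem_insert, Function.update_of_ne h.symm]
  by_cases hb : b t = true <;> simp [hb]

end Gates

section Circuits

variable {κ ι : Type}

/-- A circuit, applied at the positions `e` of a larger system. -/
def QCircuit.rename (e : κ ↪ ι) (C : QCircuit κ) : QCircuit ι := C.map (QGate.rename e)

/-- The inverse of a circuit. -/
def QCircuit.inverse (C : QCircuit ι) : QCircuit ι := (C.map QGate.inverse).reverse

/-- A circuit, controlled on the qubit `t`. -/
def QCircuit.control [DecidableEq ι] (t : ι) (C : QCircuit ι) : QCircuit ι := C.map (QGate.control t)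

theorem QCircuit.cost_append (C C' : QCircuit ι) :
    QCircuit.cost (C ++ C') = QCircuit.cost C + QCircuit.cost C' := by
  simp [QCircuit.cost]

theorem QCircuit.cost_rename (e : κ ↪ ι) (C : QCircuit κ) :
    (QCircuit.rename e C).cost = C.cost := by
  simp only [QCircuit.cost, QCircuit.rename, List.map_map]
  congr 2
  funext g
  simp [QGate.cost, QGate.rename]

theorem QCircuit.cost_inverse (C : QCircuit ι) : (QCircuit.inverse C).cost = C.cost := by
  simp only [QCircuit.cost, QCircuit.inverse, List.map_reverse, List.sum_reverse, List.map_map]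
  congr 2

theorem QCircuit.cost_control_le [DecidableEq ι] (t : ι) (C : QCircuit ι) :
    (QCircuit.control t C).cost ≤ 2 * C.cost := by
  induction C with
  | nil => simp [QCircuit.cost, QCircuit.control]
  | cons g C ih =>
    have hg : (g.control t).cost ≤ 2 * g.cost := by
      simp only [QGate.cost, QGate.control]
      split_ifs
      · omega
      · have := Finset.card_insert_le t g.controls
        omega
    simp only [QCircuit.cost, QCircuit.control, List.map_cons, List.sum_cons] at ih ⊢
    omega

variable [Fintype κ] [DecidableEq κ] [Fintype ι] [DecidableEq ι]

theorem QCircuit.toOp_append (C C' : QCircuit ι) :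
    QCircuit.toOp (C ++ C') = QCircuit.toOp C' * QCircuit.toOp C := by
  induction C with
  | nil => simp [QCircuit.toOp]
  | cons g C ih =>
    change QCircuit.toOp (C ++ C') * g.toOp = _ * (QCircuit.toOp C * g.toOp)
    rw [ih, Matrix.mul_assoc]

theorem QCircuit.toOp_rename (e : κ ↪ ι) (C : QCircuit κ) :
    (QCircuit.rename e C).toOp = QOp.lift e C.toOp := by
  induction C with
  | nil => exact (QOp.lift_one e).symm
  | cons g C ih =>
    change (QCircuit.rename e C).toOp * (g.rename e).toOp = QOp.lift e (QCircuit.toOp C * g.toOp)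
    rw [ih, QGate.toOp_rename, QOp.lift_mul]

theorem QCircuit.toOp_inverse (C : QCircuit ι) : (QCircuit.inverse C).toOp = (C.toOp)ᴴ := by
  induction C with
  | nil => simp [QCircuit.inverse, QCircuit.toOp]
  | cons g C ih =>
    have : QCircuit.inverse (g :: C) = QCircuit.inverse C ++ [g.inverse] := by
      simp [QCircuit.inverse]
    rw [this, QCircuit.toOp_append, ih]
    change (1 * g.inverse.toOp) * _ = (QCircuit.toOp C * g.toOp)ᴴ
    rw [one_mul, QGate.inverse_toOp, Matrix.conjTranspose_mul]

theorem QCircuit.conjTranspose_mul_toOp (C : QCircuit ι) : (C.toOp)ᴴ * C.toOp = 1 := by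
  induction C with
  | nil => simp [QCircuit.toOp]
  | cons g C ih =>
    change (QCircuit.toOp C * g.toOp)ᴴ * (QCircuit.toOp C * g.toOp) = 1
    rw [Matrix.conjTranspose_mul, Matrix.mul_assoc, ← Matrix.mul_assoc _ _ g.toOp, ih, one_mul,
      ← QGate.inverse_toOp, QGate.inverse_mul]

theorem QCircuit.sqNorm_mulVec (C : QCircuit ι) (ψ : QState ι) :
    sqNorm (C.toOp *ᵥ ψ) = sqNorm ψ :=
  _root_.sqNorm_mulVec C.conjTranspose_mul_toOp ψ

theorem QOp.controlled_mul (t : ι) (M M' : QOp ι) (h : ∀ b b', M' b b' ≠ 0 → b t = b' t) :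
    QOp.controlled t (M * M') = QOp.controlled t M * QOp.controlled t M' := by
  ext b b'
  simp only [Matrix.mul_apply, QOp.controlled]
  by_cases hb : b' t = true
  · simp only [hb, if_true]
    refine Finset.sum_congr rfl fun c _ => ?_
    by_cases hc : M' c b' = 0
    · simp [hc]
    · rw [h _ _ hc, if_pos hb]
  · simp only [hb, if_false, Matrix.one_apply, mul_ite, mul_one, mul_zero, Finset.sum_ite_eq',
      Finset.mem_univ, if_true, Bool.false_eq_true]

theorem QCircuit.toOp_control (t : ι) (C : QCircuit ι) (h : ∀ g ∈ C, g.target ≠ t) :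
    (QCircuit.control t C).toOp = QOp.controlled t C.toOp := by
  induction C with
  | nil =>
    ext b b'
    simp [QCircuit.toOp, QCircuit.control, QOp.controlled]
  | cons g C ih =>
    change (QCircuit.control t C).toOp * (g.control t).toOp = QOp.controlled t (QCircuit.toOp C * g.toOp)
    rw [ih fun g' hg' => h g' (List.mem_cons_of_mem _ hg'),
      QGate.control_mulVec t g (h g List.mem_cons_self), QOp.controlled_mul]
    intro b b' hb
    have ht : t ≠ g.target := (h g List.mem_cons_self).symm
    by_contra hne
    apply hb
    have h1 : ¬ ∀ i, i ≠ g.target → b i = b' i := fun h' => hne (h' t ht)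
    have h2 : b ≠ b' := fun h' => hne (by rw [h'])
    simp only [QGate.toOp, if_neg h1, if_neg h2, ite_self]

end Circuits

/-! ### Action on basis states -/

section Basis

variable {κ ι : Type} [Fintype κ] [DecidableEq κ] [Fintype ι] [DecidableEq ι]

/-- The circuit `C` maps the basis state `b` to the basis state `b'`. -/
def QCircuit.Maps (C : QCircuit ι) (b b' : ι → Bool) : Prop := C.toOp *ᵥ ket b = ket b'

theorem QCircuit.Maps.append {C C' : QCircuit ι} {b b' b'' : ι → Bool}
    (h : QCircuit.Maps C b b') (h' : QCircuit.Maps C' b' b'') : QCircuit.Maps (C ++ C') b b'' := by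
  unfold QCircuit.Maps at *
  rw [QCircuit.toOp_append, ← Matrix.mulVec_mulVec, h, h']

theorem QCircuit.Maps.inverse {C : QCircuit ι} {b b' : ι → Bool} (h : QCircuit.Maps C b b') :
    QCircuit.Maps (QCircuit.inverse C) b' b := by
  unfold QCircuit.Maps at *
  rw [QCircuit.toOp_inverse, ← h, Matrix.mulVec_mulVec, QCircuit.conjTranspose_mul_toOp,
    Matrix.one_mulVec]

theorem QOp.lift_mulVec_ket (e : κ ↪ ι) (M : QOp κ) (b : ι → Bool) (c : ι → Bool) :
    (QOp.lift e M *ᵥ ket b) c =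
      if ∀ i, i ∉ Set.range e → c i = b i then (M *ᵥ ket (b ∘ e)) (c ∘ e) else 0 := by
  classical
  rw [QOp.lift_mulVec]
  split_ifs with h
  · congr 1
    funext b'
    have : Function.extend e b' c = b ↔ b' = b ∘ e := by
      constructor
      · rintro rfl; rw [QOp.extend_comp]
      · rintro rfl
        funext i
        by_cases hi : i ∈ Set.range e
        · obtain ⟨j, rfl⟩ := hi
          rw [e.injective.extend_apply]; rfl
        · rw [Function.extend_apply' _ _ _ hi, h i hi]
    simp only [ket, this]
  · have : (fun b' => (ket b : QState ι) (Function.extend e b' c)) = 0 := by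
      funext b'
      have : Function.extend e b' c ≠ b := by
        rintro rfl
        exact h fun i hi => by rw [Function.extend_apply' _ _ _ hi]
      simp [ket, this]
    rw [this, Matrix.mulVec_zero, Pi.zero_apply]

theorem QCircuit.Maps.rename {C : QCircuit κ} (e : κ ↪ ι) {b b' : ι → Bool}
    (h : QCircuit.Maps C (b ∘ e) (b' ∘ e)) (hb : ∀ i, i ∉ Set.range e → b i = b' i) :
    QCircuit.Maps (QCircuit.rename e C) b b' := by
  unfold QCircuit.Maps at *
  rw [QCircuit.toOp_rename]
  funext c
  rw [QOp.lift_mulVec_ket, h]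
  simp only [ket]
  by_cases hc : c = b'
  · subst hc
    rw [if_pos fun i hi => (hb i hi).symm, if_pos rfl, if_pos rfl]
  · rw [if_neg hc]
    split_ifs with h1 h2
    · exfalso
      apply hc
      funext i
      by_cases hi : i ∈ Set.range e
      · obtain ⟨j, rfl⟩ := hi
        exact congrFun h2 j
      · rw [h1 i hi, hb i hi]
    · rfl
    · rfl

/-- The NOT gate with target `t`, controlled on the qubits in `s`. -/
def QGate.mcx (t : ι) (s : Finset ι) (h : t ∉ s) : QGate ι where
  target := t
  controls := s
  target_notMem := h
  u := ⟨Matrix.of fun a b : Bool => if a = b then 0 else 1, by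
    rw [Matrix.mem_unitaryGroup_iff]
    ext a b
    cases a <;> cases b <;> simp [Matrix.mul_apply, Matrix.star_apply]⟩

/-- The map on basis states of a controlled NOT gate. -/
def mcxMap (t : ι) (s : Finset ι) (b : ι → Bool) : ι → Bool :=
  Function.update b t (xor (b t) (decide (∀ i ∈ s, b i = true)))

theorem mcx_mulVec (t : ι) (s : Finset ι) (h : t ∉ s) (ψ : QState ι) (b : ι → Bool) :
    ((QGate.mcx t s h).toOp *ᵥ ψ) b = ψ (mcxMap t s b) := by
  rw [QGate.toOp_mulVec]
  have hb : Function.update b t (b t) = b := Function.update_eq_self t b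
  by_cases hs : ∀ i ∈ s, b i = true
  · have hs' : ∀ i ∈ (QGate.mcx t s h).controls, b i = true := hs
    rw [if_pos hs']
    simp only [mcxMap, decide_eq_true hs, QGate.mcx, Matrix.of_apply]
    cases b t <;> simp
  · have hs' : ¬ ∀ i ∈ (QGate.mcx t s h).controls, b i = true := hs
    rw [if_neg hs']
    simp only [mcxMap, decide_eq_false hs, Bool.xor_false, hb]

theorem mcxMap_mcxMap (t : ι) (s : Finset ι) (h : t ∉ s) (b : ι → Bool) :
    mcxMap t s (mcxMap t s b) = b := by
  have hc : (∀ i ∈ s, mcxMap t s b i = true) ↔ ∀ i ∈ s, b i = true := by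
    refine forall_congr' fun i => imp_congr_right fun hi => ?_
    have : i ≠ t := fun h' => h (h' ▸ hi)
    rw [mcxMap, Function.update_of_ne this]
  have : mcxMap t s (mcxMap t s b) = Function.update (mcxMap t s b) t
    (xor (mcxMap t s b t) (decide (∀ i ∈ s, mcxMap t s b i = true))) := rfl
  rw [this]
  simp only [hc]
  simp [mcxMap]

theorem mcx_maps (t : ι) (s : Finset ι) (h : t ∉ s) (b : ι → Bool) :
    QCircuit.Maps [QGate.mcx t s h] b (mcxMap t s b) := by
  unfold QCircuit.Maps
  change (1 * (QGate.mcx t s h).toOp) *ᵥ _ = _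
  rw [one_mul]
  funext c
  rw [mcx_mulVec]
  simp only [ket]
  have : mcxMap t s c = b ↔ c = mcxMap t s b := by
    constructor
    · rintro rfl; rw [mcxMap_mcxMap t s h]
    · rintro rfl; rw [mcxMap_mcxMap t s h]
  simp only [this]

end Basis

/-! ### Oracle queries -/

section SqNorm

variable {α : Type*} [Fintype α]

theorem sqNorm_sum_le {J : Type*} [Fintype J] (v : J → α → ℂ) :
    sqNorm (∑ j, v j) ≤ Fintype.card J * ∑ j, sqNorm (v j) := by
  unfold sqNorm
  rw [Finset.sum_comm, Finset.mul_sum]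
  refine Finset.sum_le_sum fun b _ => ?_
  rw [Finset.sum_apply]
  calc ‖∑ j, v j b‖ ^ 2 ≤ (∑ j, ‖v j b‖) ^ 2 := by
        gcongr
        exact norm_sum_le _ _
    _ ≤ _ := by
        have := sq_sum_le_card_mul_sum_sq (s := Finset.univ) (f := fun j => ‖v j b‖)
        simpa using this

theorem norm_sq_le_two_mul (u v : ℂ) : ‖u‖ ^ 2 ≤ 2 * ‖v‖ ^ 2 + 2 * ‖u - v‖ ^ 2 := by
  have h : ‖u‖ ≤ ‖v‖ + ‖u - v‖ := by
    simpa using norm_add_le v (u - v)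
  nlinarith [norm_nonneg u, norm_nonneg v, norm_nonneg (u - v), sq_nonneg (‖v‖ - ‖u - v‖)]

theorem sqNorm_sub_le (u v : α → ℂ) : sqNorm (u - v) ≤ 2 * sqNorm u + 2 * sqNorm v := by
  unfold sqNorm
  rw [Finset.mul_sum, Finset.mul_sum, ← Finset.sum_add_distrib]
  refine Finset.sum_le_sum fun b _ => ?_
  have := norm_sq_le_two_mul (u b - v b) (u b)
  simpa [norm_neg] using this

open Classical in
/-- The projection of an amplitude vector to the basis states with `p`. -/
noncomputable def restrictTo (p : α → Prop) (ψ : α → ℂ) : α → ℂ := fun b => if p b then ψ b else 0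

theorem restrictTo_sub (p : α → Prop) (u v : α → ℂ) :
    restrictTo p (u - v) = restrictTo p u - restrictTo p v := by
  funext b; by_cases h : p b <;> simp [restrictTo, h]

theorem restrictTo_add (p : α → Prop) (u v : α → ℂ) :
    restrictTo p (u + v) = restrictTo p u + restrictTo p v := by
  funext b; by_cases h : p b <;> simp [restrictTo, h]

theorem restrictTo_sum {J : Type*} [Fintype J] (p : α → Prop) (v : J → α → ℂ) :
    restrictTo p (∑ j, v j) = ∑ j, restrictTo p (v j) := by
  funext b; by_cases h : p b <;> simp [restrictTo, h]

theorem sqNorm_neg (v : α → ℂ) : sqNorm (-v) = sqNorm v := by simp [sqNorm]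

open Classical in
theorem sqNorm_restrictTo (p : α → Prop) (ψ : α → ℂ) :
    sqNorm (restrictTo p ψ) = ∑ b, if p b then ‖ψ b‖ ^ 2 else 0 := by
  unfold sqNorm restrictTo
  refine Finset.sum_congr rfl fun b _ => ?_
  by_cases h : p b <;> simp [h]

end SqNorm

section Query

variable {nin nq ny nout work : ℕ}

/-- The content of the query register. -/
def queryPart (b : OracleReg nin nq ny nout work → Bool) : Bits nq := fun k => b (.inr (.inl k))

theorem queryPart_queryMap (H : Bits nq → Bits ny) (b : OracleReg nin nq ny nout work → Bool) :
    queryPart (queryMap H b) = queryPart b := rfl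

theorem queryMap_queryMap (H : Bits nq → Bits ny) (b : OracleReg nin nq ny nout work → Bool) :
    queryMap H (queryMap H b) = b := by
  funext i
  rcases i with i | i | i | i
  · rfl
  · rfl
  · simp [queryMap]
  · rfl

theorem queryMap_congr {H H' : Bits nq → Bits ny} {b : OracleReg nin nq ny nout work → Bool}
    (h : H (queryPart b) = H' (queryPart b)) : queryMap H b = queryMap H' b := by
  funext i
  rcases i with i | i | i | i
  · rfl
  · rfl
  · exact congrArg (fun v : Bits ny => xor (b (.inr (.inr (.inl i)))) (v i)) h
  · rfl

theorem queryOp_mulVec (H : Bits nq → Bits ny) (ψ : QState (OracleReg nin nq ny nout work))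
    (b : OracleReg nin nq ny nout work → Bool) :
    (queryOp H *ᵥ ψ) b = ψ (queryMap H b) := by
  simp only [Matrix.mulVec, dotProduct, queryOp]
  rw [Finset.sum_eq_single (queryMap H b)]
  · rw [queryMap_queryMap, if_pos rfl, one_mul]
  · intro b' _ hb'
    rw [if_neg, zero_mul]
    rintro rfl
    exact hb' (queryMap_queryMap H b').symm
  · intro h
    exact absurd (Finset.mem_univ _) h

/-- The permutation of the basis states made by an oracle query. -/
def queryEquiv (H : Bits nq → Bits ny) :
    (OracleReg nin nq ny nout work → Bool) ≃ (OracleReg nin nq ny nout work → Bool) where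
  toFun := queryMap H
  invFun := queryMap H
  left_inv := queryMap_queryMap H
  right_inv := queryMap_queryMap H

theorem sqNorm_queryOp (H : Bits nq → Bits ny) (ψ : QState (OracleReg nin nq ny nout work)) :
    sqNorm (queryOp H *ᵥ ψ) = sqNorm ψ := by
  unfold sqNorm
  simp only [queryOp_mulVec]
  exact Equiv.sum_comp (queryEquiv H) fun b => ‖ψ b‖ ^ 2

theorem queryOp_sub_queryOp (H H' : Bits nq → Bits ny) (T : Bits nq → Prop)
    (hT : ∀ u, ¬ T u → H' u = H u) (ψ : QState (OracleReg nin nq ny nout work)) :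
    queryOp H' *ᵥ ψ - queryOp H *ᵥ ψ =
      queryOp H' *ᵥ restrictTo (fun b => T (queryPart b)) ψ -
        queryOp H *ᵥ restrictTo (fun b => T (queryPart b)) ψ := by
  funext b
  simp only [Pi.sub_apply, queryOp_mulVec, restrictTo, queryPart_queryMap]
  by_cases h : T (queryPart b)
  · simp [h]
  · have h' : queryMap H' b = queryMap H b := queryMap_congr (hT _ h)
    simp [h, h']

/-- The effect of the oracle queries and of the circuits that follow each of them. -/
noncomputable def runRounds (H : Bits nq → Bits ny) (L : List (QCircuit (OracleReg nin nq ny nout work)))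
    (ψ : QState (OracleReg nin nq ny nout work)) : QState (OracleReg nin nq ny nout work) :=
  L.foldl (fun ψ c => QCircuit.toOp c *ᵥ (queryOp H *ᵥ ψ)) ψ

theorem runRounds_cons (H : Bits nq → Bits ny) (c : QCircuit (OracleReg nin nq ny nout work))
    (L : List (QCircuit (OracleReg nin nq ny nout work)))
    (ψ : QState (OracleReg nin nq ny nout work)) :
    runRounds H (c :: L) ψ = runRounds H L (c.toOp *ᵥ (queryOp H *ᵥ ψ)) := rfl

theorem sqNorm_runRounds (H : Bits nq → Bits ny)
    (L : List (QCircuit (OracleReg nin nq ny nout work)))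
    (ψ : QState (OracleReg nin nq ny nout work)) : sqNorm (runRounds H L ψ) = sqNorm ψ := by
  induction L generalizing ψ with
  | nil => rfl
  | cons c L ih => rw [runRounds_cons, ih, QCircuit.sqNorm_mulVec, sqNorm_queryOp]

theorem runRounds_add (H : Bits nq → Bits ny)
    (L : List (QCircuit (OracleReg nin nq ny nout work)))
    (ψ φ : QState (OracleReg nin nq ny nout work)) :
    runRounds H L (ψ + φ) = runRounds H L ψ + runRounds H L φ := by
  induction L generalizing ψ φ with
  | nil => rfl
  | cons c L ih =>
    rw [runRounds_cons, Matrix.mulVec_add, Matrix.mulVec_add, ih]; rfl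

theorem runRounds_sub (H : Bits nq → Bits ny)
    (L : List (QCircuit (OracleReg nin nq ny nout work)))
    (ψ φ : QState (OracleReg nin nq ny nout work)) :
    runRounds H L (ψ - φ) = runRounds H L ψ - runRounds H L φ := by
  induction L generalizing ψ φ with
  | nil => rfl
  | cons c L ih =>
    rw [runRounds_cons, Matrix.mulVec_sub, Matrix.mulVec_sub, ih]; rfl

/-- The state before the query number `i`. -/
noncomputable def stateBefore (H : Bits nq → Bits ny)
    (L : List (QCircuit (OracleReg nin nq ny nout work)))
    (ψ : QState (OracleReg nin nq ny nout work)) (i : ℕ) :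
    QState (OracleReg nin nq ny nout work) :=
  runRounds H (L.take i) ψ

/-- The evolution from the query number `i` on, where this query is answered by `K` and the later
ones by `H`. -/
noncomputable def runFrom (K H : Bits nq → Bits ny)
    (L : List (QCircuit (OracleReg nin nq ny nout work))) (i : Fin L.length)
    (ψ : QState (OracleReg nin nq ny nout work)) :
    QState (OracleReg nin nq ny nout work) :=
  runRounds H (L.drop (i + 1)) ((L.get i).toOp *ᵥ (queryOp K *ᵥ ψ))

theorem runFrom_eq (K H : Bits nq → Bits ny)
    (L : List (QCircuit (OracleReg nin nq ny nout work))) (i : Fin L.length)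
    (ψ : QState (OracleReg nin nq ny nout work)) :
    runFrom K H L i ψ = runRounds H (L.drop (i + 1)) (runRounds K [L.get i] ψ) := rfl

theorem sqNorm_runFrom (K H : Bits nq → Bits ny)
    (L : List (QCircuit (OracleReg nin nq ny nout work))) (i : Fin L.length)
    (ψ : QState (OracleReg nin nq ny nout work)) : sqNorm (runFrom K H L i ψ) = sqNorm ψ := by
  rw [runFrom_eq, sqNorm_runRounds, sqNorm_runRounds]

/-- The hybrid argument: replacing the oracle `H` by `H'` changes the final state by the sum over
the queries of the contributions of the query points at which the two oracles differ. -/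
theorem runRounds_eq_add_sum (H H' : Bits nq → Bits ny) (T : Bits nq → Prop)
    (hT : ∀ u, ¬ T u → H' u = H u)
    (L : List (QCircuit (OracleReg nin nq ny nout work)))
    (ψ : QState (OracleReg nin nq ny nout work)) :
    runRounds H' L ψ = runRounds H L ψ + ∑ i : Fin L.length,
      (runFrom H' H' L i (restrictTo (fun b => T (queryPart b)) (stateBefore H L ψ i)) -
        runFrom H H' L i (restrictTo (fun b => T (queryPart b)) (stateBefore H L ψ i))) := by
  induction L generalizing ψ with
  | nil => simp [runRounds]
  | cons c L ih =>
    refine Eq.trans ?_ (congrArg _ (Fin.sum_univ_succ (n := L.length) _).symm)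
    rw [runRounds_cons, runRounds_cons]
    have h1 : c.toOp *ᵥ (queryOp H' *ᵥ ψ) = c.toOp *ᵥ (queryOp H *ᵥ ψ) +
        c.toOp *ᵥ (queryOp H' *ᵥ ψ - queryOp H *ᵥ ψ) := by
      rw [← Matrix.mulVec_add, add_sub_cancel]
    rw [h1, runRounds_add, ih, queryOp_sub_queryOp H H' T hT, Matrix.mulVec_sub, runRounds_sub,
      add_assoc]
    congr 1
    exact add_comm _ _

theorem sqNorm_runRounds_sub_le (H H' : Bits nq → Bits ny) (T : Bits nq → Prop)
    (hT : ∀ u, ¬ T u → H' u = H u)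
    (L : List (QCircuit (OracleReg nin nq ny nout work)))
    (ψ : QState (OracleReg nin nq ny nout work)) :
    sqNorm (runRounds H' L ψ - runRounds H L ψ) ≤ L.length * ∑ i : Fin L.length,
      4 * sqNorm (restrictTo (fun b => T (queryPart b)) (stateBefore H L ψ i)) := by
  rw [runRounds_eq_add_sum H H' T hT, add_sub_cancel_left]
  refine (sqNorm_sum_le _).trans ?_
  rw [Fintype.card_fin]
  refine mul_le_mul_of_nonneg_left (Finset.sum_le_sum fun i _ => ?_) (Nat.cast_nonneg _)
  refine (sqNorm_sub_le _ _).trans (le_of_eq ?_)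
  rw [sqNorm_runFrom, sqNorm_runFrom]
  ring

/-- Measure and reprogram: if `H'` differs from `H` at most at the point `y`, then a run with
oracle `H'` is bounded by the run with oracle `H` together with the runs in which one of the
queries is found to be `y` and the oracle is switched from `H` to `H'` before or after it. -/
theorem sqNorm_restrictTo_runRounds_le (H H' : Bits nq → Bits ny) (y : Bits nq)
    (hy : ∀ u, u ≠ y → H' u = H u)
    (L : List (QCircuit (OracleReg nin nq ny nout work)))
    (ψ : QState (OracleReg nin nq ny nout work))
    (p : (OracleReg nin nq ny nout work → Bool) → Prop) :
    sqNorm (restrictTo p (runRounds H' L ψ)) ≤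
      (2 * L.length + 1) * (sqNorm (restrictTo p (runRounds H L ψ)) +
        ∑ i : Fin L.length, ∑ s : Bool, sqNorm (restrictTo p
          (runFrom (if s then H' else H) H' L i
            (restrictTo (fun b => queryPart b = y) (stateBefore H L ψ i))))) := by
  let w : Fin L.length → Bool → QState (OracleReg nin nq ny nout work) := fun i s =>
    restrictTo p (runFrom (if s then H' else H) H' L i
      (restrictTo (fun b => queryPart b = y) (stateBefore H L ψ i)))
  let v : Option (Fin L.length × Bool) → QState (OracleReg nin nq ny nout work)
    | none => restrictTo p (runRounds H L ψ)
    | some (i, s) => if s then w i s else - w i s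
  have hv : restrictTo p (runRounds H' L ψ) = ∑ j, v j := by
    rw [runRounds_eq_add_sum H H' (fun u => u = y) (fun u hu => hy u hu), restrictTo_add,
      restrictTo_sum, Fintype.sum_option, Fintype.sum_prod_type]
    congr 1
    refine Finset.sum_congr rfl fun i _ => ?_
    rw [restrictTo_sub, Fintype.sum_bool]
    simp only [v, w, if_true, Bool.false_eq_true, if_false, sub_eq_add_neg]
  have hcard : (Fintype.card (Option (Fin L.length × Bool)) : ℝ) = 2 * L.length + 1 := by
    simp [mul_comm]
  rw [hv, ← hcard]
  refine (sqNorm_sum_le v).trans (le_of_eq ?_)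
  rw [Fintype.sum_option, Fintype.sum_prod_type]
  congr 2
  refine Finset.sum_congr rfl fun i _ => Finset.sum_congr rfl fun s _ => ?_
  cases s
  · exact sqNorm_neg _
  · rfl

end Query

/-! ### Random functions with independent values -/

section ProdExp

variable {Y V Ω : Type*} [Fintype Y] [DecidableEq Y] [Fintype V] [DecidableEq V] [Fintype Ω]
  [DecidableEq Ω]

/-- The expectation of `F H` for a random function `H` with independent values of law `w`. -/
noncomputable def prodExp (w : V → ℝ) (F : (Y → V) → ℝ) : ℝ := ∑ H, (∏ u, w (H u)) * F H

theorem prodExp_mono {w : V → ℝ} (hw : ∀ v, 0 ≤ w v) {F G : (Y → V) → ℝ} (h : ∀ H, F H ≤ G H) :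
    prodExp w F ≤ prodExp w G :=
  Finset.sum_le_sum fun H _ =>
    mul_le_mul_of_nonneg_left (h H) (Finset.prod_nonneg fun _ _ => hw _)

theorem prodExp_nonneg {w : V → ℝ} (hw : ∀ v, 0 ≤ w v) {F : (Y → V) → ℝ} (h : ∀ H, 0 ≤ F H) :
    0 ≤ prodExp w F :=
  Finset.sum_nonneg fun H _ => mul_nonneg (Finset.prod_nonneg fun _ _ => hw _) (h H)

theorem prodExp_add (w : V → ℝ) (F G : (Y → V) → ℝ) :
    prodExp w (fun H => F H + G H) = prodExp w F + prodExp w G := by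
  simp [prodExp, mul_add, Finset.sum_add_distrib]

theorem prodExp_sum {J : Type*} (s : Finset J) (w : V → ℝ) (F : J → (Y → V) → ℝ) :
    prodExp w (fun H => ∑ j ∈ s, F j H) = ∑ j ∈ s, prodExp w (F j) := by
  simp only [prodExp, Finset.mul_sum]
  exact Finset.sum_comm

theorem prodExp_const_mul (w : V → ℝ) (c : ℝ) (F : (Y → V) → ℝ) :
    prodExp w (fun H => c * F H) = c * prodExp w F := by
  simp only [prodExp, Finset.mul_sum]
  exact Finset.sum_congr rfl fun H _ => by ring

theorem sum_prod_apply (w : Y → V → ℝ) : ∑ H : Y → V, ∏ u, w u (H u) = ∏ u, ∑ v, w u v := by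
  rw [Finset.prod_univ_sum, Fintype.piFinset_univ]

theorem prodExp_const {w : V → ℝ} (hw : ∑ v, w v = 1) (c : ℝ) :
    prodExp w (fun _ : Y → V => c) = c := by
  rw [prodExp, ← Finset.sum_mul, sum_prod_apply fun _ => w]
  simp [hw]

/-- The law of the image under `m` of a random element with law `w`. -/
noncomputable def pushLaw (m : Ω → V) (w : Ω → ℝ) (v : V) : ℝ := ∑ o, if m o = v then w o else 0

theorem prodExp_map (m : Ω → V) (w : Ω → ℝ) (F : (Y → V) → ℝ) :
    prodExp w (fun ω => F fun u => m (ω u)) = prodExp (pushLaw m w) F := by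
  unfold prodExp pushLaw
  have h : ∀ H : Y → V, ∏ u, ∑ o, (if m o = H u then w o else 0) =
      ∑ ω : Y → Ω, if (fun u => m (ω u)) = H then ∏ u, w (ω u) else 0 := by
    intro H
    rw [← sum_prod_apply fun u o => if m o = H u then w o else 0]
    refine Finset.sum_congr rfl fun ω _ => ?_
    rw [Finset.prod_ite_zero]
    simp [funext_iff]
  simp only [h, Finset.sum_mul]
  rw [Finset.sum_comm]
  refine Finset.sum_congr rfl fun ω _ => ?_
  simp [ite_mul]

/-- The value of a random function at one point can be drawn anew. -/
theorem prodExp_resample {w : V → ℝ} (hw : ∑ v, w v = 1) (u : Y) (F : (Y → V) → ℝ) :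
    prodExp w F = ∑ v, w v * prodExp w fun H => F (Function.update H u v) := by
  unfold prodExp
  simp only [Finset.mul_sum]
  rw [← Fintype.sum_prod_type']
  let e : V × (Y → V) ≃ V × (Y → V) :=
    { toFun := fun p => (p.2 u, Function.update p.2 u p.1)
      invFun := fun p => (p.2 u, Function.update p.2 u p.1)
      left_inv := fun p => by simp
      right_inv := fun p => by simp }
  rw [← Equiv.sum_comp e, Fintype.sum_prod_type_right]
  refine Finset.sum_congr rfl fun H _ => ?_
  have h1 : ∀ v, w (H u) * ((∏ x, w (Function.update H u v x)) * F H) =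
      w v * ((∏ x, w (H x)) * F H) := by
    intro v
    rw [← Finset.mul_prod_erase Finset.univ (fun x => w (H x)) (Finset.mem_univ u),
      ← Finset.mul_prod_erase Finset.univ _ (Finset.mem_univ u), Function.update_self,
      Finset.prod_congr rfl fun x hx => by rw [Function.update_of_ne (Finset.ne_of_mem_erase hx)]]
    ring
  simp only [e, Equiv.coe_fn_mk, Function.update_idem, Function.update_eq_self, h1,
    ← Finset.sum_mul, hw, one_mul]

theorem prodExp_indicator {w : V → ℝ} (hw : ∑ v, w v = 1) (T : Finset Y) (g : Y → V) :
    prodExp w (fun H => if ∀ u ∈ T, H u = g u then 1 else 0) = ∏ u ∈ T, w (g u) := by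
  unfold prodExp
  have h : ∀ H : Y → V, (∏ u, w (H u)) * (if ∀ u ∈ T, H u = g u then (1 : ℝ) else 0) =
      ∏ u, if u ∈ T → H u = g u then w (H u) else 0 := by
    intro H
    rw [Finset.prod_ite_zero]
    simp
  simp only [h]
  rw [sum_prod_apply fun u v => if u ∈ T → v = g u then w v else 0]
  rw [← Finset.prod_subset (Finset.subset_univ T)]
  · refine Finset.prod_congr rfl fun u hu => ?_
    simp [hu]
  · intro u _ hu
    simp [hu, hw]

end ProdExp

/-! ### Replacing the law of the oracle values -/

/-- Two laws are convex combinations, with the same weights, of a common law and of further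
laws, where the common law has weight one minus their statistical distance. -/
theorem exists_common_part {V : Type*} [Fintype V] (D U : V → ℝ) (hD : ∀ v, 0 ≤ D v)
    (hU : ∀ v, 0 ≤ U v) (hD1 : ∑ v, D v = 1) (hU1 : ∑ v, U v = 1) :
    ∃ (δ : ℝ) (C E E' : V → ℝ), δ = (∑ v, |D v - U v|) / 2 ∧ 0 ≤ δ ∧ δ ≤ 1 ∧
      (∀ v, 0 ≤ C v) ∧ (∀ v, 0 ≤ E v) ∧ (∀ v, 0 ≤ E' v) ∧
      ∑ v, C v = 1 ∧ ∑ v, E v = 1 ∧ ∑ v, E' v = 1 ∧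
      (∀ v, D v = (1 - δ) * C v + δ * E v) ∧ (∀ v, U v = (1 - δ) * C v + δ * E' v) := by
  set δ := (∑ v, |D v - U v|) / 2 with hδ
  have hmin : ∀ v, min (D v) (U v) = (D v + U v) / 2 - |D v - U v| / 2 := by
    intro v
    rcases le_total (D v) (U v) with h | h
    · rw [min_eq_left h, abs_of_nonpos (by linarith)]; ring
    · rw [min_eq_right h, abs_of_nonneg (by linarith)]; ring
  have hM : ∑ v, min (D v) (U v) = 1 - δ := by
    simp only [hmin, Finset.sum_sub_distrib, ← Finset.sum_div, Finset.sum_add_distrib, hD1, hU1, hδ]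
    ring
  have h0 : 0 ≤ δ := div_nonneg (Finset.sum_nonneg fun _ _ => abs_nonneg _) zero_le_two
  have hM0 : ∀ v, 0 ≤ min (D v) (U v) := fun v => le_min (hD v) (hU v)
  have h1 : δ ≤ 1 := by
    have := Finset.sum_nonneg fun v (_ : v ∈ Finset.univ) => hM0 v
    linarith
  rcases eq_or_ne δ 0 with hz | hz
  · have heq : ∀ v, D v = U v := by
      intro v
      have hs : ∑ v, |D v - U v| = 0 := by linarith
      have := (Finset.sum_eq_zero_iff_of_nonneg fun v _ => abs_nonneg (D v - U v)).1 hs v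
        (Finset.mem_univ v)
      linarith [abs_eq_zero.1 this]
    exact ⟨δ, D, D, D, rfl, h0, h1, hD, hD, hD, hD1, hD1, hD1, fun v => by ring,
      fun v => by rw [← heq v]; ring⟩
  rcases eq_or_ne δ 1 with ho | ho
  · exact ⟨δ, D, D, U, rfl, h0, h1, hD, hD, hU, hD1, hD1, hU1, fun v => by rw [ho]; ring,
      fun v => by rw [ho]; ring⟩
  have hp : 0 < δ := lt_of_le_of_ne h0 hz.symm
  have hq : 0 < 1 - δ := by linarith [lt_of_le_of_ne h1 ho]
  refine ⟨δ, fun v => min (D v) (U v) / (1 - δ), fun v => (D v - min (D v) (U v)) / δ,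
    fun v => (U v - min (D v) (U v)) / δ, rfl, h0, h1, fun v => div_nonneg (hM0 v) hq.le,
    fun v => div_nonneg (sub_nonneg.2 (min_le_left _ _)) h0,
    fun v => div_nonneg (sub_nonneg.2 (min_le_right _ _)) h0, ?_, ?_, ?_, fun v => ?_, fun v => ?_⟩
  · rw [← Finset.sum_div, hM, div_self hq.ne']
  · rw [← Finset.sum_div, Finset.sum_sub_distrib, hM, hD1, sub_sub_cancel, div_self hz]
  · rw [← Finset.sum_div, Finset.sum_sub_distrib, hM, hU1, sub_sub_cancel, div_self hz]
  · field_simp; ring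
  · field_simp; ring

section Coupling

variable {Y V : Type*} [Fintype Y] [DecidableEq Y] [Fintype V] [DecidableEq V]

/-- The joint law of a flag, a value drawn from the common part `C` of two laws, and values drawn
from their remaining parts `E` and `E'`; the flag says whether the remaining part is to be used. -/
noncomputable def flagLaw (δ : ℝ) (C E E' : V → ℝ) (o : Bool × V × V × V) : ℝ :=
  (if o.1 then δ else 1 - δ) * (C o.2.1 * (E o.2.2.1 * E' o.2.2.2))

theorem sum_flagLaw_mul {δ : ℝ} {C E E' : V → ℝ} (hE : ∑ v, E v = 1) (hE' : ∑ v, E' v = 1)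
    (f : Bool → V → ℝ) :
    ∑ o, flagLaw δ C E E' o * f o.1 o.2.1 =
      δ * (∑ v, C v * f true v) + (1 - δ) * ∑ v, C v * f false v := by
  simp only [Fintype.sum_prod_type, flagLaw, Fintype.sum_bool, if_true, Bool.false_eq_true, if_false]
  have h : ∀ (t x y : ℝ), ∑ a, ∑ b, t * (x * (E a * E' b)) * y = t * (x * y) := by
    intro t x y
    have : ∀ a b, t * (x * (E a * E' b)) * y = (t * (x * y)) * (E a * E' b) := fun a b => by ring
    simp only [this, ← Finset.mul_sum, hE', mul_one, hE]
  simp only [h, Finset.mul_sum]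

theorem sum_flagLaw {δ : ℝ} {C E E' : V → ℝ} (hC : ∑ v, C v = 1) (hE : ∑ v, E v = 1)
    (hE' : ∑ v, E' v = 1) : ∑ o, flagLaw δ C E E' o = 1 := by
  have := sum_flagLaw_mul (δ := δ) (C := C) hE hE' fun _ _ => 1
  simpa [hC] using this

theorem flagLaw_nonneg {δ : ℝ} {C E E' : V → ℝ} (h0 : 0 ≤ δ) (h1 : δ ≤ 1) (hC : ∀ v, 0 ≤ C v)
    (hE : ∀ v, 0 ≤ E v) (hE' : ∀ v, 0 ≤ E' v) (o : Bool × V × V × V) :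
    0 ≤ flagLaw δ C E E' o := by
  refine mul_nonneg ?_ (mul_nonneg (hC _) (mul_nonneg (hE _) (hE' _)))
  split_ifs <;> linarith

theorem pushLaw_flagLaw_fst {δ : ℝ} {C E E' : V → ℝ} (hC : ∑ v, C v = 1) (hE : ∑ v, E v = 1)
    (hE' : ∑ v, E' v = 1) (v : V) :
    pushLaw (fun o : Bool × V × V × V => if o.1 then o.2.2.1 else o.2.1) (flagLaw δ C E E') v =
      (1 - δ) * C v + δ * E v := by
  have h1 : ∀ t a : ℝ, ∑ x, ∑ y, t * (a * (E x * E' y)) = t * a := by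
    intro t a
    simp only [← Finset.mul_sum, hE', mul_one, hE]
  simp only [pushLaw, flagLaw, Fintype.sum_prod_type, Fintype.sum_bool, if_true,
    Bool.false_eq_true, if_false]
  have h2 : ∀ x : V, ∑ a : V, ∑ b : V, (if a = v then δ * (C x * (E a * E' b)) else 0) =
      C x * (δ * E v) := by
    intro x
    rw [Finset.sum_eq_single v]
    · simp only [if_true, ← Finset.mul_sum, hE', mul_one]; ring
    · intro a _ ha; simp [ha]
    · intro h; exact absurd (Finset.mem_univ _) h
  have h3 : ∑ x : V, ∑ a : V, ∑ b : V, (if x = v then (1 - δ) * (C x * (E a * E' b)) else 0) =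
      (1 - δ) * C v := by
    rw [Finset.sum_eq_single v]
    · simp only [if_true, h1]
    · intro a _ ha; simp [ha]
    · intro h; exact absurd (Finset.mem_univ _) h
  rw [h3]
  simp only [h2, ← Finset.sum_mul, hC]
  ring

theorem pushLaw_flagLaw_snd {δ : ℝ} {C E E' : V → ℝ} (hC : ∑ v, C v = 1) (hE : ∑ v, E v = 1)
    (hE' : ∑ v, E' v = 1) (v : V) :
    pushLaw (fun o : Bool × V × V × V => if o.1 then o.2.2.2 else o.2.1) (flagLaw δ C E E') v =
      (1 - δ) * C v + δ * E' v := by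
  rw [← pushLaw_flagLaw_fst hC hE' hE v]
  unfold pushLaw
  let e : Bool × V × V × V ≃ Bool × V × V × V :=
    { toFun := fun o => (o.1, o.2.1, o.2.2.2, o.2.2.1)
      invFun := fun o => (o.1, o.2.1, o.2.2.2, o.2.2.1)
      left_inv := fun _ => rfl
      right_inv := fun _ => rfl }
  rw [← Equiv.sum_comp e]
  refine Finset.sum_congr rfl fun o _ => ?_
  simp only [e, Equiv.coe_fn_mk, flagLaw, mul_comm (E o.2.2.2)]

/-- The flag at one point is independent of the values drawn from the common part. -/
theorem prodExp_flagLaw_flag {δ : ℝ} {C E E' : V → ℝ} (hC : ∑ v, C v = 1) (hE : ∑ v, E v = 1)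
    (hE' : ∑ v, E' v = 1) (u : Y) (k : (Y → V) → ℝ) :
    prodExp (flagLaw δ C E E') (fun ω => if (ω u).1 then k fun v => (ω v).2.1 else 0) =
      δ * prodExp (flagLaw δ C E E') fun ω => k fun v => (ω v).2.1 := by
  have hupd : ∀ (ω : Y → Bool × V × V × V) (o : Bool × V × V × V),
      (fun v => (Function.update ω u o v).2.1) = Function.update (fun v => (ω v).2.1) u o.2.1 := by
    intro ω o
    funext v
    by_cases hv : v = u
    · subst hv; simp
    · simp [hv]
  set K : V → ℝ := fun c => prodExp (flagLaw δ C E E') fun ω : Y → Bool × V × V × V =>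
    k (Function.update (fun v => (ω v).2.1) u c) with hK
  have e1 : ∀ o : Bool × V × V × V, prodExp (flagLaw δ C E E')
      (fun ω : Y → Bool × V × V × V => if (Function.update ω u o u).1 then
        k fun v => (Function.update ω u o v).2.1 else 0) = if o.1 then K o.2.1 else 0 := by
    intro o
    simp only [Function.update_self, hupd]
    cases o.1
    · simp [prodExp]
    · simp [hK]
  have e2 : ∀ o : Bool × V × V × V, prodExp (flagLaw δ C E E')
      (fun ω : Y → Bool × V × V × V => k fun v => (Function.update ω u o v).2.1) = K o.2.1 := by
    intro o
    simp only [hupd, hK]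
  rw [prodExp_resample (sum_flagLaw hC hE hE') u,
    prodExp_resample (sum_flagLaw hC hE hE') u fun ω => k fun v => (ω v).2.1]
  simp only [e1, e2]
  rw [sum_flagLaw_mul hE hE' fun t v => if t then K v else 0, sum_flagLaw_mul hE hE' fun _ v => K v]
  simp only [if_true, Bool.false_eq_true, if_false, mul_zero, Finset.sum_const_zero]
  ring

end Coupling

section Replace

variable {nin nq ny nout work : ℕ}

/-- The success probability, with oracle values of law `U`, of an algorithm whose output `b` has to
satisfy `ver b (H (y b))`, is at most a constant times the success probability with oracle values
of law `D` for which the value at the point `y b` is drawn anew from `U`, up to an error that is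
linear in the statistical distance of `U` and `D`. -/
theorem prodExp_success_le (L : List (QCircuit (OracleReg nin nq ny nout work)))
    (ψ : QState (OracleReg nin nq ny nout work)) (hψ : sqNorm ψ = 1)
    (y : (OracleReg nin nq ny nout work → Bool) → Bits nq)
    (ver : (OracleReg nin nq ny nout work → Bool) → Bits ny → Prop)
    [∀ b c, Decidable (ver b c)]
    (D U : Bits ny → ℝ) (hD : ∀ v, 0 ≤ D v) (hU : ∀ v, 0 ≤ U v) (hD1 : ∑ v, D v = 1)
    (hU1 : ∑ v, U v = 1) :
    prodExp U (fun H => ∑ b, if ver b (H (y b)) then ‖runRounds H L ψ b‖ ^ 2 else 0) ≤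
      4 * prodExp D (fun H => ∑ c, U c * ∑ b, if ver b c then
          ‖runRounds (Function.update H (y b) c) L ψ b‖ ^ 2 else 0) +
        (1 + 12 * (L.length : ℝ) ^ 2) * ∑ v, |D v - U v| := by
  classical
  obtain ⟨δ, C, E, E', hδ, h0, h1, hC, hE, hE', hC1, hE1, hE'1, hDC, hUC⟩ :=
    exists_common_part D U hD hU hD1 hU1
  set w := flagLaw δ C E E' with hw
  have hw0 : ∀ o, 0 ≤ w o := flagLaw_nonneg h0 h1 hC hE hE'
  have hw1 : ∑ o, w o = 1 := sum_flagLaw hC1 hE1 hE'1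
  let mD : Bool × Bits ny × Bits ny × Bits ny → Bits ny := fun o => if o.1 then o.2.2.1 else o.2.1
  let mU : Bool × Bits ny × Bits ny × Bits ny → Bits ny := fun o => if o.1 then o.2.2.2 else o.2.1
  have hpD : pushLaw mD w = D := funext fun v => by
    rw [hDC v]; exact pushLaw_flagLaw_fst hC1 hE1 hE'1 v
  have hpU : pushLaw mU w = U := funext fun v => by
    rw [hUC v]; exact pushLaw_flagLaw_snd hC1 hE1 hE'1 v
  let a : (Bits nq → Bits ny) → QState (OracleReg nin nq ny nout work) := fun H => runRounds H L ψ
  have ha : ∀ H, sqNorm (a H) = 1 := fun H => by rw [← hψ]; exact sqNorm_runRounds H L ψ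
  -- the common oracle
  let g : (Bits nq → Bool × Bits ny × Bits ny × Bits ny) → Bits nq → Bits ny :=
    fun ω u => (ω u).2.1
  -- a state that depends on the common oracle only has weight `δ` on the flagged points
  have hflag : ∀ (z : (OracleReg nin nq ny nout work → Bool) → Bits nq)
      (φ : (Bits nq → Bits ny) → QState (OracleReg nin nq ny nout work)),
      (∀ H, sqNorm (φ H) = 1) →
      prodExp w (fun ω => ∑ b, if (ω (z b)).1 then ‖φ (g ω) b‖ ^ 2 else 0) = δ := by
    intro z φ hφ
    rw [prodExp_sum]
    have : ∀ b, prodExp w (fun ω : Bits nq → Bool × Bits ny × Bits ny × Bits ny =>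
        if (ω (z b)).1 then ‖φ (g ω) b‖ ^ 2 else 0) = δ * prodExp w fun ω => ‖φ (g ω) b‖ ^ 2 :=
      fun b => prodExp_flagLaw_flag hC1 hE1 hE'1 (z b) fun H => ‖φ H b‖ ^ 2
    simp only [this, ← Finset.mul_sum]
    rw [← prodExp_sum]
    have : ∀ ω, ∑ b, ‖φ (g ω) b‖ ^ 2 = 1 := fun ω => hφ _
    simp only [this]
    rw [prodExp_const hw1, mul_one]
  have hdiff : ∀ m : Bool × Bits ny × Bits ny × Bits ny → Bits ny,
      (∀ o, o.1 = false → m o = o.2.1) →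
      prodExp w (fun ω => sqNorm (a (fun u => m (ω u)) - a (g ω))) ≤ 4 * (L.length : ℝ) ^ 2 * δ := by
    intro m hm
    have hle : ∀ ω : Bits nq → Bool × Bits ny × Bits ny × Bits ny,
        sqNorm (a (fun u => m (ω u)) - a (g ω)) ≤ ∑ i : Fin L.length, (4 * (L.length : ℝ)) *
          ∑ b, if (ω (queryPart b)).1 then ‖stateBefore (g ω) L ψ i b‖ ^ 2 else 0 := by
      intro ω
      refine (sqNorm_runRounds_sub_le (g ω) (fun u => m (ω u)) (fun u => (ω u).1 = true)
        (fun u hu => hm _ (by simpa using hu)) L ψ).trans (le_of_eq ?_)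
      rw [Finset.mul_sum]
      refine Finset.sum_congr rfl fun i _ => ?_
      rw [sqNorm_restrictTo, ← mul_assoc, mul_comm (L.length : ℝ) 4]
      congr 1
      refine Finset.sum_congr rfl fun b _ => ?_
      congr
    refine (prodExp_mono hw0 hle).trans (le_of_eq ?_)
    rw [prodExp_sum]
    have : ∀ i : Fin L.length, prodExp w (fun ω => (4 * (L.length : ℝ)) *
          ∑ b, if (ω (queryPart b)).1 then ‖stateBefore (g ω) L ψ i b‖ ^ 2 else 0) =
        4 * (L.length : ℝ) * δ := by
      intro i
      rw [prodExp_const_mul, hflag _ (fun H => stateBefore H L ψ i)]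
      intro H
      rw [← hψ]
      exact sqNorm_runRounds _ _ _
    rw [Finset.sum_congr rfl fun i _ => this i, Finset.sum_const, Finset.card_univ,
      Fintype.card_fin, nsmul_eq_mul]
    ring
  -- the part of the success probability at points that are not flagged
  let G : (Bits nq → Bool × Bits ny × Bits ny × Bits ny) → (Bits nq → Bits ny) → ℝ := fun ω H =>
    ∑ b, if (ω (y b)).1 = false ∧ ver b (g ω (y b)) then ‖a H b‖ ^ 2 else 0
  have hUle : prodExp U (fun H => ∑ b, if ver b (H (y b)) then ‖a H b‖ ^ 2 else 0) ≤
      2 * prodExp w (fun ω => G ω (g ω)) + 2 * δ + 2 * (4 * (L.length : ℝ) ^ 2 * δ) := by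
    rw [← hpU, ← prodExp_map]
    have hle : ∀ ω : Bits nq → Bool × Bits ny × Bits ny × Bits ny,
        (∑ b, if ver b (mU (ω (y b))) then ‖a (fun u => mU (ω u)) b‖ ^ 2 else 0) ≤
          2 * G ω (g ω) + 2 * (∑ b, if (ω (y b)).1 then ‖a (g ω) b‖ ^ 2 else 0) +
            2 * sqNorm (a (fun u => mU (ω u)) - a (g ω)) := by
      intro ω
      simp only [G, sqNorm, Finset.mul_sum, ← Finset.sum_add_distrib]
      refine Finset.sum_le_sum fun b _ => ?_
      have h2 := norm_sq_le_two_mul (a (fun u => mU (ω u)) b) (a (g ω) b)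
      have hp1 := sq_nonneg ‖a (fun u => mU (ω u)) b‖
      have hp2 := sq_nonneg ‖a (g ω) b‖
      have hp3 := sq_nonneg ‖a (fun u => mU (ω u)) b - a (g ω) b‖
      rw [Pi.sub_apply]
      cases hf : (ω (y b)).1
      · have : mU (ω (y b)) = g ω (y b) := by simp [mU, g, hf]
        rw [this]
        by_cases hv : ver b (g ω (y b))
        · simp only [hv, if_true, and_self, Bool.false_eq_true, if_false]
          linarith
        · simp only [hv, if_false, and_false, Bool.false_eq_true]
          linarith
      · simp only [Bool.true_eq_false, false_and, if_false, if_true]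
        split_ifs <;> linarith
    refine (prodExp_mono hw0 hle).trans ?_
    rw [prodExp_add, prodExp_add, prodExp_const_mul, prodExp_const_mul, prodExp_const_mul,
      hflag y a ha]
    have := hdiff mU (fun o ho => by simp [mU, ho])
    linarith
  have hGle : prodExp w (fun ω => G ω (g ω)) ≤
      2 * prodExp w (fun ω => G ω fun u => mD (ω u)) + 2 * (4 * (L.length : ℝ) ^ 2 * δ) := by
    have hle : ∀ ω : Bits nq → Bool × Bits ny × Bits ny × Bits ny,
        G ω (g ω) ≤ 2 * (G ω fun u => mD (ω u)) + 2 * sqNorm (a (fun u => mD (ω u)) - a (g ω)) := by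
      intro ω
      simp only [G, sqNorm, Finset.mul_sum, ← Finset.sum_add_distrib]
      refine Finset.sum_le_sum fun b _ => ?_
      have h2 := norm_sq_le_two_mul (a (g ω) b) (a (fun u => mD (ω u)) b)
      rw [norm_sub_rev] at h2
      rw [Pi.sub_apply]
      split_ifs
      · exact h2
      · positivity
    refine (prodExp_mono hw0 hle).trans ?_
    rw [prodExp_add, prodExp_const_mul, prodExp_const_mul]
    have := hdiff mD (fun o ho => by simp [mD, ho])
    linarith
  have hDle : prodExp w (fun ω => G ω fun u => mD (ω u)) ≤
      prodExp D (fun H => ∑ c, U c * ∑ b, if ver b c then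
          ‖a (Function.update H (y b) c) b‖ ^ 2 else 0) := by
    have hR : prodExp D (fun H => ∑ c, U c * ∑ b, if ver b c then
          ‖a (Function.update H (y b) c) b‖ ^ 2 else 0) =
        ∑ b, ∑ c, U c * if ver b c then
          prodExp D (fun H => ‖a (Function.update H (y b) c) b‖ ^ 2) else 0 := by
      rw [prodExp_sum, Finset.sum_comm]
      refine Finset.sum_congr rfl fun c _ => ?_
      rw [prodExp_const_mul, prodExp_sum, Finset.mul_sum]
      refine Finset.sum_congr rfl fun b _ => ?_
      by_cases hv : ver b c <;> simp [hv, prodExp]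
    rw [hR, prodExp_sum]
    refine Finset.sum_le_sum fun b _ => ?_
    rw [prodExp_resample hw1 (y b)]
    set Q : Bits ny → ℝ := fun c => if ver b c then
          prodExp D (fun H => ‖a (Function.update H (y b) c) b‖ ^ 2) else 0 with hQ
    have hQ0 : ∀ c, 0 ≤ Q c := by
      intro c
      simp only [hQ]
      split_ifs
      · exact prodExp_nonneg hD fun H => by positivity
      · exact le_rfl
    have hterm : ∀ o, prodExp w (fun ω =>
        if (Function.update ω (y b) o (y b)).1 = false ∧ ver b (g (Function.update ω (y b) o) (y b))
          then ‖a (fun u => mD (Function.update ω (y b) o u)) b‖ ^ 2 else 0) =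
        if o.1 then 0 else Q o.2.1 := by
      intro o
      have hg : ∀ ω : Bits nq → Bool × Bits ny × Bits ny × Bits ny,
          g (Function.update ω (y b) o) (y b) = o.2.1 := fun ω => by simp [g]
      simp only [Function.update_self, hg]
      cases ho : o.1
      · by_cases hv : ver b o.2.1
        · simp only [hv, true_and, if_true, hQ, Bool.false_eq_true, if_false]
          have hupd : ∀ ω : Bits nq → Bool × Bits ny × Bits ny × Bits ny,
              (fun u => mD (Function.update ω (y b) o u)) =
                Function.update (fun u => mD (ω u)) (y b) o.2.1 := by
            intro ω
            funext u
            by_cases hu : u = y b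
            · subst hu; simp [mD, ho]
            · simp [hu]
          simp only [hupd]
          rw [← hpD]
          exact prodExp_map mD w fun H => ‖a (Function.update H (y b) o.2.1) b‖ ^ 2
        · simp [hv, hQ, prodExp]
      · simp [prodExp]
    simp only [hterm]
    rw [sum_flagLaw_mul hE1 hE'1 fun t v => if t then 0 else Q v]
    simp only [if_true, mul_zero, Finset.sum_const_zero, Bool.false_eq_true, if_false, zero_add,
      Finset.mul_sum]
    refine Finset.sum_le_sum fun c _ => ?_
    rw [← mul_assoc]
    refine mul_le_mul_of_nonneg_right ?_ (hQ0 c)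
    rw [hUC c]
    linarith [mul_nonneg h0 (hE' c)]
  have hs : ∑ v, |D v - U v| = 2 * δ := by rw [hδ]; ring
  rw [hs]
  have := hUle.trans (by linarith : _ ≤ 4 * prodExp D (fun H => ∑ c, U c * ∑ b, if ver b c then
          ‖a (Function.update H (y b) c) b‖ ^ 2 else 0) +
        (1 + 12 * (L.length : ℝ) ^ 2) * (2 * δ))
  exact this

end Replace

/-! ### The polynomial method -/

section Degree

variable {Y V : Type*} [Fintype Y] [DecidableEq Y] [Fintype V] [DecidableEq V]

/-- The indicator functions of events that prescribe at most `k` values of a function. -/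
def localIndicators (Y V : Type*) [DecidableEq V] (k : ℕ) : Set ((Y → V) → ℂ) :=
  {f | ∃ (T : Finset Y) (g : Y → V), T.card ≤ k ∧
    f = fun H => if ∀ u ∈ T, H u = g u then 1 else 0}

/-- The functions of degree at most `k` of the values of a function `H : Y → V`: the linear
combinations of indicator functions of events that prescribe at most `k` values of `H`. -/
def degreeLE (Y V : Type*) [DecidableEq V] (k : ℕ) : Submodule ℂ ((Y → V) → ℂ) :=
  Submodule.span ℂ (localIndicators Y V k)

theorem const_mem_degreeLE (c : ℂ) (k : ℕ) : (fun _ : Y → V => c) ∈ degreeLE Y V k := by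
  by_cases hV : Nonempty (Y → V)
  · obtain ⟨g⟩ := hV
    have : (fun _ : Y → V => c) = c • fun H : Y → V =>
        if ∀ u ∈ (∅ : Finset Y), H u = g u then (1 : ℂ) else 0 := by
      funext H; simp
    rw [this]
    exact Submodule.smul_mem _ _ (Submodule.subset_span ⟨∅, g, by simp, by simp⟩)
  · have : (fun _ : Y → V => c) = 0 := by
      funext H; exact absurd ⟨H⟩ hV
    rw [this]; exact Submodule.zero_mem _

theorem eval_mem_degreeLE (u : Y) (v : V) :
    (fun H : Y → V => if H u = v then (1 : ℂ) else 0) ∈ degreeLE Y V 1 :=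
  Submodule.subset_span ⟨{u}, fun _ => v, by simp, by simp⟩

theorem mul_mem_degreeLE {k k' : ℕ} {f f' : (Y → V) → ℂ} (hf : f ∈ degreeLE Y V k)
    (hf' : f' ∈ degreeLE Y V k') : f * f' ∈ degreeLE Y V (k + k') := by
  have h : degreeLE Y V k * degreeLE Y V k' ≤ degreeLE Y V (k + k') := by
    unfold degreeLE
    rw [Submodule.span_mul_span, Submodule.span_le]
    rintro _ ⟨_, ⟨T, g, hT, rfl⟩, _, ⟨T', g', hT', rfl⟩, rfl⟩
    by_cases hc : ∀ u ∈ T, u ∈ T' → g u = g' u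
    · refine Submodule.subset_span ⟨T ∪ T', fun u => if u ∈ T then g u else g' u,
        (Finset.card_union_le _ _).trans (add_le_add hT hT'), ?_⟩
      funext H
      have : (∀ u ∈ T ∪ T', H u = if u ∈ T then g u else g' u) ↔
          (∀ u ∈ T, H u = g u) ∧ ∀ u ∈ T', H u = g' u := by
        constructor
        · intro h
          refine ⟨fun u hu => ?_, fun u hu => ?_⟩
          · simpa [hu] using h u (Finset.mem_union_left _ hu)
          · have := h u (Finset.mem_union_right _ hu)
            by_cases hu' : u ∈ T
            · rw [if_pos hu', hc u hu' hu] at this; exact this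
            · rwa [if_neg hu'] at this
        · rintro ⟨h1, h2⟩ u hu
          by_cases hu' : u ∈ T
          · rw [if_pos hu', h1 u hu']
          · rw [if_neg hu', h2 u ((Finset.mem_union.1 hu).resolve_left hu')]
      simp only [this, Pi.mul_apply, ite_and]
      split_ifs <;> simp
    · refine (congrArg (· ∈ Submodule.span ℂ (localIndicators Y V (k + k'))) ?_).mpr
        (Submodule.zero_mem _)
      funext H
      simp only [Pi.mul_apply, Pi.zero_apply]
      push Not at hc
      obtain ⟨u, hu, hu', hne⟩ := hc
      by_cases h1 : ∀ u ∈ T, H u = g u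
      · have : ¬ ∀ u ∈ T', H u = g' u := fun h2 => hne (by rw [← h1 u hu, h2 u hu'])
        rw [if_neg this, mul_zero]
      · rw [if_neg h1, zero_mul]
  exact h (Submodule.mul_mem_mul hf hf')

theorem star_mem_degreeLE {k : ℕ} {f : (Y → V) → ℂ} (hf : f ∈ degreeLE Y V k) :
    star f ∈ degreeLE Y V k := by
  induction hf using Submodule.span_induction with
  | mem x hx =>
    obtain ⟨T, g, hT, rfl⟩ := hx
    refine Submodule.subset_span ⟨T, g, hT, ?_⟩
    funext H
    simp only [Pi.star_apply]
    split_ifs <;> simp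
  | zero => simp
  | add x y _ _ hx hy => rw [star_add]; exact Submodule.add_mem _ hx hy
  | smul c x _ hx => rw [star_smul]; exact Submodule.smul_mem _ _ hx

theorem update_mem_degreeLE {k : ℕ} {f : (Y → V) → ℂ} (hf : f ∈ degreeLE Y V k) (y : Y) (c : V) :
    (fun H => f (Function.update H y c)) ∈ degreeLE Y V k := by
  induction hf using Submodule.span_induction with
  | mem x hx =>
    obtain ⟨T, g, hT, rfl⟩ := hx
    by_cases h : y ∈ T → g y = c
    · refine Submodule.subset_span ⟨T.erase y, g, (Finset.card_erase_le).trans hT, ?_⟩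
      funext H
      have : (∀ u ∈ T, Function.update H y c u = g u) ↔ ∀ u ∈ T.erase y, H u = g u := by
        constructor
        · intro h' u hu
          have := h' u (Finset.mem_of_mem_erase hu)
          rwa [Function.update_of_ne (Finset.ne_of_mem_erase hu)] at this
        · intro h' u hu
          by_cases huy : u = y
          · subst huy; rw [Function.update_self, h hu]
          · rw [Function.update_of_ne huy, h' u (Finset.mem_erase.2 ⟨huy, hu⟩)]
      simp only [this]
      congr
    · push Not at h
      refine (congrArg (· ∈ degreeLE Y V k) ?_).mpr (Submodule.zero_mem _)
      funext H
      simp only [Pi.zero_apply]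
      rw [if_neg]
      intro h'
      have := h' y h.1
      rw [Function.update_self] at this
      exact h.2 this.symm
  | zero => exact Submodule.zero_mem _
  | add x y _ _ hx hy => exact Submodule.add_mem _ hx hy
  | smul c x _ hx => exact Submodule.smul_mem _ c hx

/-- Two random functions for which any `k` values have the same joint law give the same
expectation to functions of degree at most `k`. -/
theorem sum_mul_eq_of_mem_degreeLE {I J : Type*} [Fintype I] [Fintype J] (w : I → ℝ) (h : I → Y → V)
    (w' : J → ℝ) (h' : J → Y → V) (k : ℕ)
    (hk : ∀ T : Finset Y, T.card ≤ k → ∀ g : Y → V,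
      ∑ i, w i * (if ∀ u ∈ T, h i u = g u then 1 else 0) =
        ∑ j, w' j * (if ∀ u ∈ T, h' j u = g u then 1 else 0))
    {F : (Y → V) → ℝ} (hF : (fun H => (F H : ℂ)) ∈ degreeLE Y V k) :
    ∑ i, w i * F (h i) = ∑ j, w' j * F (h' j) := by
  have key : ∀ f ∈ degreeLE Y V k, ∑ i, (w i : ℂ) * f (h i) = ∑ j, (w' j : ℂ) * f (h' j) := by
    intro f hf
    induction hf using Submodule.span_induction with
    | mem x hx =>
      obtain ⟨T, g, hT, rfl⟩ := hx
      have := congrArg (fun r : ℝ => (r : ℂ)) (hk T hT g)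
      simp only [Complex.ofReal_sum, Complex.ofReal_mul] at this
      simpa [apply_ite] using this
    | zero => simp
    | add x y _ _ hx hy =>
      simp only [Pi.add_apply, mul_add, Finset.sum_add_distrib, hx, hy]
    | smul c x _ hx =>
      simp only [Pi.smul_apply, smul_eq_mul, mul_left_comm _ c, ← Finset.mul_sum, hx]
  have := key _ hF
  apply Complex.ofReal_injective
  simpa using this

end Degree

section DegreeRun

variable {nin nq ny nout work : ℕ}

theorem runRounds_mem_degreeLE (L : List (QCircuit (OracleReg nin nq ny nout work))) (k : ℕ)
    (ψ : (Bits nq → Bits ny) → QState (OracleReg nin nq ny nout work))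
    (hψ : ∀ b, (fun H => ψ H b) ∈ degreeLE (Bits nq) (Bits ny) k)
    (b : OracleReg nin nq ny nout work → Bool) :
    (fun H => runRounds H L (ψ H) b) ∈ degreeLE (Bits nq) (Bits ny) (k + L.length) := by
  induction L generalizing k ψ with
  | nil => exact hψ b
  | cons c L ih =>
    have h1 : ∀ b, (fun H => (queryOp H *ᵥ ψ H) b) ∈ degreeLE (Bits nq) (Bits ny) (k + 1) := by
      intro b
      have : (fun H => (queryOp H *ᵥ ψ H) b) = ∑ v : Bits ny,
          (fun H => ψ H (queryMap (fun _ => v) b)) *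
            (fun H : Bits nq → Bits ny => if H (queryPart b) = v then (1 : ℂ) else 0) := by
        funext H
        simp only [queryOp_mulVec, Finset.sum_apply, Pi.mul_apply, mul_ite, mul_one, mul_zero,
          Finset.sum_ite_eq, Finset.mem_univ, if_true]
        congr 1
      rw [this]
      exact Submodule.sum_mem _ fun v _ => mul_mem_degreeLE (hψ _) (eval_mem_degreeLE _ _)
    have h2 : ∀ b, (fun H => (c.toOp *ᵥ (queryOp H *ᵥ ψ H)) b) ∈
        degreeLE (Bits nq) (Bits ny) (k + 1) := by
      intro b
      have : (fun H => (c.toOp *ᵥ (queryOp H *ᵥ ψ H)) b) =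
          ∑ b', c.toOp b b' • fun H => (queryOp H *ᵥ ψ H) b' := by
        funext H
        simp only [Finset.sum_apply, Pi.smul_apply, smul_eq_mul]
        rfl
      rw [this]
      exact Submodule.sum_mem _ fun b' _ => Submodule.smul_mem _ _ (h1 b')
    have := ih (k + 1) (fun H => c.toOp *ᵥ (queryOp H *ᵥ ψ H)) h2
    rw [List.length_cons, show k + (L.length + 1) = k + 1 + L.length by ring]
    exact this

/-- The squared modulus of an amplitude, after reprogramming the oracle at one point, has degree at
most twice the number of queries. -/
theorem norm_sq_runRounds_mem_degreeLE (L : List (QCircuit (OracleReg nin nq ny nout work)))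
    (ψ : QState (OracleReg nin nq ny nout work)) (y : Bits nq) (c : Bits ny)
    (b : OracleReg nin nq ny nout work → Bool) :
    (fun H => ((‖runRounds (Function.update H y c) L ψ b‖ ^ 2 : ℝ) : ℂ)) ∈
      degreeLE (Bits nq) (Bits ny) (2 * L.length) := by
  have h0 := runRounds_mem_degreeLE L 0 (fun _ => ψ) (fun b => const_mem_degreeLE _ _) b
  have h1 := update_mem_degreeLE h0 y c
  have h2 := mul_mem_degreeLE h1 (star_mem_degreeLE h1)
  rw [show 2 * L.length = 0 + L.length + (0 + L.length) by ring]
  convert h2 using 1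
  funext H
  simp only [Pi.mul_apply, Pi.star_apply, RCLike.star_def, Complex.mul_conj']
  push_cast
  rfl

end DegreeRun

/-! ### A family of functions with independent values at few points -/

section Independent

/-- A bit as an element of the field with two elements. -/
def bitVal (b : Bool) : ZMod 2 := if b then 1 else 0

theorem bitVal_injective : Function.Injective bitVal := by decide

/-- An element of the field with two elements as a bit. -/
def valBit (z : ZMod 2) : Bool := decide (z = 1)

theorem bitVal_valBit (z : ZMod 2) : bitVal (valBit z) = z := by revert z; decide

theorem valBit_bitVal (b : Bool) : valBit (bitVal b) = b := by revert b; decide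

theorem bitVal_xor (a b : Bool) : bitVal (xor a b) = bitVal a + bitVal b := by revert a b; decide

/-- The field whose elements are encoded by `n + 1` bits. -/
abbrev BitField (n : ℕ) : Type := GaloisField 2 (n + 1)

/-- A basis of the field over the field with two elements. -/
noncomputable def bitBasis (n : ℕ) : Module.Basis (Fin (n + 1)) (ZMod 2) (BitField n) :=
  Module.finBasisOfFinrankEq _ _ (GaloisField.finrank 2 (Nat.succ_ne_zero n))

/-- The field element encoded by an `n`-bit string. -/
noncomputable def encode {n : ℕ} (u : Bits n) : BitField n :=
  ∑ i : Fin n, bitVal (u i) • bitBasis n i.castSucc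

theorem encode_injective {n : ℕ} : Function.Injective (encode (n := n)) := by
  intro u u' h
  funext i
  have := congrArg (fun z => (bitBasis n).repr z i.castSucc) h
  simp only [encode, map_sum, map_smul, Module.Basis.repr_self, Finsupp.coe_finsetSum, Finset.sum_apply,
    Finsupp.smul_apply, Finsupp.single_apply, smul_eq_mul, mul_ite, mul_one, mul_zero] at this
  simp only [Fin.castSucc_inj, Finset.sum_ite_eq', Finset.mem_univ, if_true] at this
  exact bitVal_injective this

/-- The coordinates of the first `k` powers of the field element encoded by `u`. -/
noncomputable def powerBits {n : ℕ} (k : ℕ) (u : Bits n) (i : Fin k × Fin (n + 1)) : ZMod 2 :=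
  (bitBasis n).repr (encode u ^ (i.1 : ℕ)) i.2

/-- The linear functionals of `powerBits k` take all combinations of values at `k` points: this is
polynomial interpolation. -/
theorem exists_functional {n : ℕ} (k : ℕ) (T : Finset (Bits n)) (hT : T.card ≤ k)
    (τ : Bits n → ZMod 2) :
    ∃ ℓ : Fin k × Fin (n + 1) → ZMod 2, ∀ u ∈ T, ∑ i, ℓ i * powerBits k u i = τ u := by
  classical
  obtain ⟨j, hj⟩ : ∃ j, (bitBasis n).repr (1 : BitField n) j = 1 := by
    by_contra! h
    have h0 : ∀ z : ZMod 2, z ≠ 1 → z = 0 := by decide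
    have : (bitBasis n).repr (1 : BitField n) = 0 := Finsupp.ext fun j => h0 _ (h j)
    rw [map_eq_zero_iff _ (LinearEquiv.injective _)] at this
    exact one_ne_zero this
  let lam : BitField n →ₗ[ZMod 2] ZMod 2 := (bitBasis n).coord j
  let P : Polynomial (BitField n) :=
    Lagrange.interpolate T encode fun u => algebraMap (ZMod 2) (BitField n) (τ u)
  have hinj : Set.InjOn (encode (n := n)) T := encode_injective.injOn
  have hdeg : P.degree < (k : WithBot ℕ) :=
    (Lagrange.degree_interpolate_lt _ hinj).trans_le (by exact_mod_cast hT)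
  refine ⟨fun i => lam (P.coeff i.1 * bitBasis n i.2), fun u hu => ?_⟩
  have h1 : ∀ i : Fin k, ∑ t : Fin (n + 1), lam (P.coeff i * bitBasis n t) * powerBits k u (i, t) =
      lam (P.coeff i * encode u ^ (i : ℕ)) := by
    intro i
    conv_rhs => rw [← (bitBasis n).sum_repr (encode u ^ (i : ℕ)), Finset.mul_sum, map_sum]
    refine Finset.sum_congr rfl fun t _ => ?_
    rw [mul_smul_comm, map_smul, smul_eq_mul, mul_comm]
    rfl
  rw [Fintype.sum_prod_type]
  simp only [h1]
  have h2 : P.eval (encode u) = ∑ i : Fin k, P.coeff i * encode u ^ (i : ℕ) :=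
    Polynomial.eval_eq_sum_degreeLTEquiv (Polynomial.mem_degreeLT.2 hdeg) _
  have h3 : P.eval (encode u) = τ u • (1 : BitField n) := by
    rw [Lagrange.eval_interpolate_at_node _ hinj hu, Algebra.algebraMap_eq_smul_one]
  rw [← map_sum, ← h2, h3, map_smul, smul_eq_mul]
  have : lam 1 = 1 := hj
  rw [this, mul_one]

/-- The value at `u` of the member with index `M` of a family of functions to the bit strings of
length `r`: each bit is a linear functional of `powerBits k u`. -/
noncomputable def linearHash {n r : ℕ} (k : ℕ) (M : Fin r → Fin k × Fin (n + 1) → ZMod 2)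
    (u : Bits n) : Bits r :=
  fun l => valBit (∑ i, M l i * powerBits k u i)

theorem card_mul_sum_comp_eq {A B : Type*} [AddCommGroup A] [AddCommGroup B] [Fintype A] [Fintype B]
    (π : A →+ B) (hπ : Function.Surjective π) (F : B → ℝ) :
    (∑ a, F (π a)) / Fintype.card A = (∑ b, F b) / Fintype.card B := by
  classical
  set N := (Finset.univ.filter fun a => π a = 0).card with hN
  have hfib : ∀ b, (Finset.univ.filter fun a => π a = b).card = N := by
    intro b
    obtain ⟨a₀, rfl⟩ := hπ b
    refine Finset.card_bij (fun a _ => a - a₀) ?_ ?_ ?_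
    · intro a ha
      simp only [Finset.mem_filter, Finset.mem_univ, true_and] at ha ⊢
      rw [map_sub, ha, sub_self]
    · intro a _ a' _ h
      exact sub_left_injective h
    · intro a ha
      simp only [Finset.mem_filter, Finset.mem_univ, true_and] at ha
      exact ⟨a + a₀, by simp [ha], by simp⟩
  have hsum : ∀ G : B → ℝ, ∑ a, G (π a) = N * ∑ b, G b := by
    intro G
    rw [← Finset.sum_fiberwise Finset.univ π, Finset.mul_sum]
    refine Finset.sum_congr rfl fun b _ => ?_
    rw [Finset.sum_congr rfl (g := fun _ => G b) fun a ha => by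
      rw [(Finset.mem_filter.1 ha).2], Finset.sum_const, hfib, nsmul_eq_mul]
  have hcard : (Fintype.card A : ℝ) = N * Fintype.card B := by
    have := hsum fun _ => 1
    simpa using this
  have hN0 : (N : ℝ) ≠ 0 := by
    have : 0 < N := Finset.card_pos.2 ⟨0, by simp⟩
    exact_mod_cast this.ne'
  rw [hsum, hcard, mul_div_mul_left _ _ hN0]

/-- The values of `linearHash` at any `k` points are independent and uniform; so their images under
`f` are independent and have the law of the image of a uniform bit string. -/
theorem linearHash_independent {n r : ℕ} {V : Type*} [DecidableEq V] (k : ℕ) (f : Bits r → V)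
    (T : Finset (Bits n)) (hT : T.card ≤ k) (g : Bits n → V) :
    uniformAvg (fun M : Fin r → Fin k × Fin (n + 1) → ZMod 2 =>
      if ∀ u ∈ T, f (linearHash k M u) = g u then (1 : ℝ) else 0) =
      ∏ u ∈ T, uniformAvg fun s : Bits r => if f s = g u then (1 : ℝ) else 0 := by
  classical
  let π : (Fin r → Fin k × Fin (n + 1) → ZMod 2) →+ (T → Fin r → ZMod 2) :=
    { toFun := fun M u l => ∑ i, M l i * powerBits k u.1 i
      map_zero' := by funext u l; simp
      map_add' := fun M M' => by
        funext u l
        simp [add_mul, Finset.sum_add_distrib] }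
  have hπ : Function.Surjective π := by
    intro τ
    have : ∀ l, ∃ ℓ : Fin k × Fin (n + 1) → ZMod 2, ∀ u ∈ T, ∑ i, ℓ i * powerBits k u i =
        if h : u ∈ T then τ ⟨u, h⟩ l else 0 := fun l => exists_functional k T hT _
    choose ℓ hℓ using this
    refine ⟨ℓ, ?_⟩
    funext u l
    have := hℓ l u.1 u.2
    rw [dif_pos u.2] at this
    exact this
  let e : (Fin r → ZMod 2) ≃ Bits r :=
    { toFun := fun z l => valBit (z l)
      invFun := fun b l => bitVal (b l)
      left_inv := fun z => funext fun l => bitVal_valBit _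
      right_inv := fun b => funext fun l => valBit_bitVal _ }
  have h1 := card_mul_sum_comp_eq π hπ fun τ => ∏ u : T, if f (e (τ u)) = g u then (1 : ℝ) else 0
  have h2 : ∀ M, (if ∀ u ∈ T, f (linearHash k M u) = g u then (1 : ℝ) else 0) =
      ∏ u : T, if f (e (π M u)) = g u then (1 : ℝ) else 0 := by
    intro M
    rw [Finset.prod_ite_zero]
    simp only [Finset.prod_const_one, Finset.mem_univ, forall_const, Subtype.forall]
    rfl
  have h3 : ∀ u : T, ∑ z : Fin r → ZMod 2, (if f (e z) = g u then (1 : ℝ) else 0) =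
      ∑ s : Bits r, if f s = g u then (1 : ℝ) else 0 := fun u =>
    Equiv.sum_comp e fun s => if f s = g u then (1 : ℝ) else 0
  have h4 : (Fintype.card (Fin r → ZMod 2) : ℝ) = Fintype.card (Bits r) := by
    rw [Fintype.card_congr e]
  unfold uniformAvg
  simp only [h2]
  rw [h1, sum_prod_apply fun (u : T) z => if f (e z) = g u then (1 : ℝ) else 0]
  simp only [h3]
  rw [Finset.prod_coe_sort T fun u => ∑ s : Bits r, if f s = g u then (1 : ℝ) else 0,
    Finset.prod_div_distrib, Finset.prod_const, ← h4, Fintype.card_fun, Fintype.card_coe]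
  push_cast
  rfl

end Independent

/-! ### Circuits for the hash functions -/

section Layer

variable {ι : Type} [Fintype ι] [DecidableEq ι] {α : Type*}

/-- A list of controlled NOT gates, indexed by a finite set. -/
noncomputable def mcxLayer (s : Finset α) (tgt : α → ι) (ctl : α → Finset ι)
    (h : ∀ a, tgt a ∉ ctl a) : QCircuit ι :=
  s.toList.map fun a => QGate.mcx (tgt a) (ctl a) (h a)

theorem cost_mcxLayer_le (s : Finset α) (tgt : α → ι) (ctl : α → Finset ι)
    (h : ∀ a, tgt a ∉ ctl a) (K : ℕ) (hK : ∀ a, (ctl a).card ≤ K) :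
    (mcxLayer s tgt ctl h).cost ≤ s.card * (1 + K) := by
  unfold mcxLayer QCircuit.cost
  rw [List.map_map]
  have := List.sum_le_card_nsmul (s.toList.map (QGate.cost ∘ fun a => QGate.mcx (tgt a) (ctl a) (h a)))
    (1 + K) (by
      intro x hx
      obtain ⟨a, _, rfl⟩ := List.mem_map.1 hx
      exact Nat.add_le_add_left (hK a) 1)
  simpa using this

/-- A layer of controlled NOT gates in which no target is a control adds to each bit the values of
the monomials given by the gates with this target. -/
theorem mcxLayer_maps (s : Finset α) (tgt : α → ι) (ctl : α → Finset ι)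
    (h : ∀ a a', tgt a ∉ ctl a') (b b' : ι → Bool)
    (hb : ∀ i, bitVal (b' i) = bitVal (b i) +
      ∑ a ∈ s, if tgt a = i then ∏ c ∈ ctl a, bitVal (b c) else 0) :
    QCircuit.Maps (mcxLayer s tgt ctl fun a => h a a) b b' := by
  have key : ∀ (l : List α) (b b' : ι → Bool), (∀ i, bitVal (b' i) = bitVal (b i) +
      (l.map fun a => if tgt a = i then ∏ c ∈ ctl a, bitVal (b c) else 0).sum) →
      QCircuit.Maps (l.map fun a => QGate.mcx (tgt a) (ctl a) (h a a)) b b' := by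
    intro l
    induction l with
    | nil =>
      intro b b' hb
      have : b' = b := funext fun i => bitVal_injective (by simpa using hb i)
      subst this
      unfold QCircuit.Maps
      exact Matrix.one_mulVec _
    | cons a l ih =>
      intro b b' hb
      refine QCircuit.Maps.append (C := [_]) (mcx_maps (tgt a) (ctl a) (h a a) b) (ih _ _ ?_)
      have hctl : ∀ a', ∏ c ∈ ctl a', bitVal (mcxMap (tgt a) (ctl a) b c) =
          ∏ c ∈ ctl a', bitVal (b c) := by
        intro a'
        refine Finset.prod_congr rfl fun c hc => ?_
        have : c ≠ tgt a := fun h' => h a a' (h' ▸ hc)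
        rw [mcxMap, Function.update_of_ne this]
      have hval : ∀ i, bitVal (mcxMap (tgt a) (ctl a) b i) = bitVal (b i) +
          if tgt a = i then ∏ c ∈ ctl a, bitVal (b c) else 0 := by
        intro i
        by_cases hi : tgt a = i
        · subst hi
          rw [mcxMap, Function.update_self, bitVal_xor, if_pos rfl]
          congr 1
          by_cases hc : ∀ c ∈ ctl a, b c = true
          · rw [decide_eq_true hc, Finset.prod_eq_one fun c hc' => by rw [hc c hc']; rfl]
            rfl
          · rw [decide_eq_false hc]
            push Not at hc
            obtain ⟨c, hc, hcb⟩ := hc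
            rw [Finset.prod_eq_zero hc (by rw [Bool.eq_false_of_not_eq_true hcb]; rfl)]
            rfl
        · rw [mcxMap, Function.update_of_ne (Ne.symm hi), if_neg hi, add_zero]
      intro i
      rw [hb i, List.map_cons, List.sum_cons, hval]
      simp only [hctl, add_assoc]
  refine key _ _ _ fun i => ?_
  rw [hb i, Finset.sum_map_toList]

end Layer

section Hash

/-- The work space for the evaluation of a hash function: the coordinates of the powers of the
encoded query, and the registers of the sampler of challenges (random bits, challenge, work). -/
abbrev HashReg (n k r nc m : ℕ) : Type :=
  (Fin (k + 1) × Fin (n + 1)) ⊕ (Fin r ⊕ Fin nc ⊕ Fin m)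

/-- The work space for simulated oracle queries: a marked query point, the bitwise comparison of
the query with it, a flag for their equality, and the work space of the hash function. -/
abbrev SimReg (n k r nc m : ℕ) : Type := Fin n ⊕ Fin n ⊕ Unit ⊕ HashReg n k r nc m

/-- The contents of the work space: marked point, comparison, flag, powers, random bits, challenge
and work. -/
def simBits {n k r nc m : ℕ} (y e : Bits n) (t : Bool) (p : Fin (k + 1) × Fin (n + 1) → Bool)
    (s : Bits r) (v : Bits nc) (w : Bits m) : SimReg n k r nc m → Bool :=
  Sum.elim y (Sum.elim e (Sum.elim (fun _ => t) (Sum.elim p (Sum.elim s (Sum.elim v w)))))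

/-- The work space with marked point `y`, all else being zero. -/
def simZero {n k r nc m : ℕ} (y : Bits n) : SimReg n k r nc m → Bool :=
  simBits y (fun _ => false) false (fun _ => false) (fun _ => false) (fun _ => false)
    (fun _ => false)

variable {n k r nc m : ℕ}

/-- Compares the query with the marked point. -/
noncomputable def compareCirc : QCircuit (Fin n ⊕ SimReg n k r nc m) :=
  mcxLayer (Finset.univ : Finset (Fin n × Option Bool)) (fun a => .inr (.inr (.inl a.1)))
    (fun a => match a.2 with
      | none => ∅
      | some false => {.inl a.1}
      | some true => {.inr (.inl a.1)})
    (by rintro ⟨a, _ | _ | _⟩ <;> simp) ++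
  mcxLayer (Finset.univ : Finset Unit) (fun _ => .inr (.inr (.inr (.inl ()))))
    (fun _ => Finset.univ.image fun i => .inr (.inr (.inl i))) (by simp)

theorem bitVal_decide_eq (q y : Bits n) :
    bitVal (decide (q = y)) = ∏ i, (1 + bitVal (q i) + bitVal (y i)) := by
  have h : ∀ a b : Bool, 1 + bitVal a + bitVal b = if a = b then 1 else 0 := by decide
  simp only [h, Finset.prod_ite_zero, Finset.prod_const_one, Finset.mem_univ, forall_const,
    ← funext_iff]
  by_cases hq : q = y <;> simp [hq, bitVal]

theorem compareCirc_maps (q y : Bits n) (p : Fin (k + 1) × Fin (n + 1) → Bool)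
    (s : Bits r) (v : Bits nc) (w : Bits m) :
    QCircuit.Maps (compareCirc (n := n) (k := k) (r := r) (nc := nc) (m := m))
      (Sum.elim q (simBits y (fun _ => false) false p s v w))
      (Sum.elim q (simBits y (fun i => decide (q i = y i)) (decide (q = y)) p s v w)) := by
  have h : ∀ a b : Bool, bitVal (decide (a = b)) = 1 + bitVal a + bitVal b := by decide
  have h0 : bitVal false = 0 := rfl
  refine QCircuit.Maps.append (b' := Sum.elim q (simBits y (fun i => decide (q i = y i)) false p s v w))
    (mcxLayer_maps _ _ _ ?_ _ _ ?_) (mcxLayer_maps _ _ _ ?_ _ _ ?_)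
  · rintro ⟨a, _ | _ | _⟩ ⟨a', _ | _ | _⟩ <;> simp
  · rintro (i | i | i | i | i | i | i | i)
    · simp [simBits]
    · simp [simBits]
    · simp [simBits, Fintype.sum_prod_type, Fintype.sum_option, h, h0,
        add_assoc, add_comm, add_left_comm]
    all_goals simp [simBits]
  · simp
  · rintro (i | i | i | i | i | i | i | i)
    · simp [simBits]
    · simp [simBits]
    · simp [simBits]
    · rw [Fintype.sum_unique, if_pos rfl, Finset.prod_image fun i _ j _ hij => by simpa using hij]
      simp [simBits, h0, h, bitVal_decide_eq]
    all_goals simp [simBits]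

/-- Multiplies the power number `i` by the encoded query. -/
noncomputable def powerLayer (i : Fin k) : QCircuit (Fin n ⊕ SimReg n k r nc m) :=
  mcxLayer (Finset.univ.filter fun a : Fin (n + 1) × Fin n × Fin (n + 1) =>
      (bitBasis n).repr (bitBasis n a.1 * bitBasis n a.2.1.castSucc) a.2.2 = 1)
    (fun a => .inr (.inr (.inr (.inr (.inl (i.succ, a.2.2))))))
    (fun a => {.inr (.inr (.inr (.inr (.inl (i.castSucc, a.1))))), .inl a.2.1})
    (by intro a; simp [Fin.ext_iff])

/-- Writes the power number zero. -/
noncomputable def oneLayer : QCircuit (Fin n ⊕ SimReg n k r nc m) :=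
  mcxLayer (Finset.univ.filter fun a : Fin (n + 1) => (bitBasis n).repr (1 : BitField n) a = 1)
    (fun a => .inr (.inr (.inr (.inr (.inl (0, a)))))) (fun _ => ∅) (by simp)

/-- Computes the powers up to number `t`. -/
noncomputable def powersCirc (t : ℕ) : QCircuit (Fin n ⊕ SimReg n k r nc m) :=
  oneLayer ++ (List.range t).flatMap fun i => if h : i < k then powerLayer ⟨i, h⟩ else []

theorem sum_filter_eq_one {β : Type*} [Fintype β] (f : β → ZMod 2) (g : β → ZMod 2) :
    ∑ a ∈ Finset.univ.filter (fun a => f a = 1), g a = ∑ a, f a * g a := by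
  rw [Finset.sum_filter]
  refine Finset.sum_congr rfl fun a _ => ?_
  have : ∀ z x : ZMod 2, (if z = 1 then x else 0) = z * x := by decide
  exact this _ _

theorem repr_mul_encode (u : Bits n) (z : BitField n) (c : Fin (n + 1)) :
    (bitBasis n).repr (z * encode u) c = ∑ a : Fin (n + 1), ∑ b : Fin n,
      (bitBasis n).repr (bitBasis n a * bitBasis n b.castSucc) c *
        ((bitBasis n).repr z a * bitVal (u b)) := by
  conv_lhs => rw [← (bitBasis n).sum_repr z]
  unfold encode
  simp only [Finset.sum_mul_sum, map_sum, smul_mul_smul_comm, map_smul, Finsupp.coe_finsetSum,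
    Finset.sum_apply, Finsupp.smul_apply, smul_eq_mul]
  refine Finset.sum_congr rfl fun a _ => Finset.sum_congr rfl fun b _ => ?_
  ring

/-- The powers up to number `t` of the encoded query `q`. -/
noncomputable def powersUpTo (q : Bits n) (t : ℕ) (j : Fin (k + 1) × Fin (n + 1)) : Bool :=
  if (j.1 : ℕ) ≤ t then valBit (powerBits (k + 1) q j) else false

theorem powersCirc_maps (t : ℕ) (ht : t ≤ k) (q y e : Bits n) (f : Bool)
    (s : Bits r) (v : Bits nc) (w : Bits m) :
    QCircuit.Maps (powersCirc (n := n) (k := k) (r := r) (nc := nc) (m := m) t)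
      (Sum.elim q (simBits y e f (fun _ => false) s v w))
      (Sum.elim q (simBits y e f (powersUpTo q t) s v w)) := by
  have h0 : bitVal false = 0 := rfl
  induction t with
  | zero =>
    unfold powersCirc
    rw [List.range_zero, List.flatMap_nil, List.append_nil]
    refine mcxLayer_maps _ _ _ ?_ _ _ ?_
    · simp
    · rintro (i | i | i | i | i | i | i | i)
      · simp [simBits]
      · simp [simBits]
      · simp [simBits]
      · simp [simBits]
      · obtain ⟨j, c⟩ := i
        rw [sum_filter_eq_one]
        by_cases hj : j = 0
        · subst hj
          simp [simBits, powersUpTo, h0, bitVal_valBit, powerBits]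
        · have hj' : ¬ (j : ℕ) = 0 := fun h => hj (Fin.ext h)
          simp [simBits, powersUpTo, h0, hj, Ne.symm hj]
      all_goals simp [simBits]
  | succ t ih =>
    have hsplit : powersCirc (n := n) (k := k) (r := r) (nc := nc) (m := m) (t + 1) =
        powersCirc t ++ powerLayer ⟨t, ht⟩ := by
      unfold powersCirc
      rw [List.range_succ, List.flatMap_append, List.append_assoc]
      simp [Nat.lt_of_succ_le ht]
    rw [hsplit]
    refine (ih (Nat.le_of_succ_le ht)).append (mcxLayer_maps _ _ _ ?_ _ _ ?_)
    · intro a a'; simp [Fin.ext_iff]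
    · rintro (i | i | i | i | i | i | i | i)
      · simp [simBits]
      · simp [simBits]
      · simp [simBits]
      · simp [simBits]
      · obtain ⟨j, c⟩ := i
        rw [sum_filter_eq_one]
        by_cases hj : (j : ℕ) = t + 1
        · have hj' : (⟨t, ht⟩ : Fin k).succ = j := Fin.ext hj.symm
          subst hj'
          have hpair : ∀ (a : Fin (n + 1)) (b : Fin n), ∏ c ∈
              ({.inr (.inr (.inr (.inr (.inl ((⟨t, ht⟩ : Fin k).castSucc, a))))), .inl b} :
                Finset (Fin n ⊕ SimReg n k r nc m)),
              bitVal (Sum.elim q (simBits y e f (powersUpTo q t) s v w) c) =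
              (bitBasis n).repr (encode q ^ t) a * bitVal (q b) := by
            intro a b
            rw [Finset.prod_pair (by simp)]
            simp [simBits, powersUpTo, bitVal_valBit, powerBits]
          simp only [hpair, Fintype.sum_prod_type]
          simp [simBits, powersUpTo, h0, bitVal_valBit, powerBits, pow_succ, repr_mul_encode]
        · have hj' : ¬ (⟨t + 1, Nat.succ_lt_succ ht⟩ : Fin (k + 1)) = j :=
            fun h => hj (by rw [← h])
          have hle : (j : ℕ) ≤ t + 1 ↔ (j : ℕ) ≤ t := by omega
          simp [simBits, powersUpTo, hj', hle]
      all_goals simp [simBits]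

/-- Computes the random bits for the sampler from the powers of the encoded query. -/
noncomputable def linearCirc (M : Fin r → Fin (k + 1) × Fin (n + 1) → ZMod 2) :
    QCircuit (Fin n ⊕ SimReg n k r nc m) :=
  mcxLayer (Finset.univ.filter fun a : Fin r × (Fin (k + 1) × Fin (n + 1)) => M a.1 a.2 = 1)
    (fun a => .inr (.inr (.inr (.inr (.inr (.inl a.1))))))
    (fun a => {.inr (.inr (.inr (.inr (.inl a.2))))}) (by simp)

theorem linearCirc_maps (M : Fin r → Fin (k + 1) × Fin (n + 1) → ZMod 2) (q y e : Bits n)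
    (f : Bool) (v : Bits nc) (w : Bits m) :
    QCircuit.Maps (linearCirc M)
      (Sum.elim q (simBits y e f (powersUpTo q k) (fun _ => false) v w))
      (Sum.elim q (simBits y e f (powersUpTo q k) (linearHash (k + 1) M q) v w)) := by
  have h0 : bitVal false = 0 := rfl
  refine mcxLayer_maps _ _ _ ?_ _ _ ?_
  · simp
  · rintro (i | i | i | i | i | i | i | i)
    · simp [simBits]
    · simp [simBits]
    · simp [simBits]
    · simp [simBits]
    · simp [simBits]
    · rw [sum_filter_eq_one fun a : Fin r × (Fin (k + 1) × Fin (n + 1)) => M a.1 a.2,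
        Fintype.sum_prod_type]
      have hle : ∀ j : Fin (k + 1), (j : ℕ) ≤ k := fun j => Nat.le_of_lt_succ j.2
      simp [simBits, linearHash, h0, bitVal_valBit, powersUpTo, hle]
    all_goals simp [simBits]

/-- The embedding of the registers of the sampler. -/
def samplerEmb : (Fin r ⊕ Fin nc ⊕ Fin m) ↪ Fin n ⊕ SimReg n k r nc m where
  toFun i := .inr (.inr (.inr (.inr (.inr i))))
  inj' := fun i j h => by simpa using h

/-- Computes all contents of the work space for a simulated oracle query. -/
noncomputable def computeCirc (M : Fin r → Fin (k + 1) × Fin (n + 1) → ZMod 2)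
    (circ : QCircuit (Fin r ⊕ Fin nc ⊕ Fin m)) : QCircuit (Fin n ⊕ SimReg n k r nc m) :=
  ((compareCirc ++ powersCirc k) ++ linearCirc M) ++ QCircuit.rename samplerEmb circ

/-- The circuit `circ` computes the function `f` into its second register. -/
def ComputesInto (circ : QCircuit (Fin r ⊕ Fin nc ⊕ Fin m)) (f : Bits r → Bits nc) : Prop :=
  ∀ u, QCircuit.Maps circ (Sum.elim u (Sum.elim (fun _ => false) (fun _ => false)))
    (Sum.elim u (Sum.elim (f u) (fun _ => false)))

theorem computeCirc_maps (M : Fin r → Fin (k + 1) × Fin (n + 1) → ZMod 2)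
    (circ : QCircuit (Fin r ⊕ Fin nc ⊕ Fin m)) (f : Bits r → Bits nc) (hf : ComputesInto circ f)
    (q y : Bits n) :
    QCircuit.Maps (computeCirc M circ) (Sum.elim q (simZero y))
      (Sum.elim q (simBits y (fun i => decide (q i = y i)) (decide (q = y)) (powersUpTo q k)
        (linearHash (k + 1) M q) (f (linearHash (k + 1) M q)) (fun _ => false))) := by
  refine (((compareCirc_maps q y _ _ _ _).append (powersCirc_maps k le_rfl q y _ _ _ _ _)).append
    (linearCirc_maps M q y _ _ _ _)).append (QCircuit.Maps.rename _ (hf (linearHash (k + 1) M q)) ?_)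
  rintro (i | i | i | i | i | i) hi
  · rfl
  · rfl
  · rfl
  · rfl
  · rfl
  · exact absurd ⟨i, rfl⟩ hi

theorem cost_flatMap_range_le {ι : Type} (F : ℕ → QCircuit ι) (B : ℕ) (hB : ∀ i, (F i).cost ≤ B)
    (t : ℕ) : QCircuit.cost ((List.range t).flatMap F) ≤ t * B := by
  induction t with
  | zero => simp [QCircuit.cost]
  | succ t ih =>
    rw [List.range_succ, List.flatMap_append, QCircuit.cost_append]
    simp only [List.flatMap_cons, List.flatMap_nil, List.append_nil]
    have := hB t
    nlinarith

theorem cost_computeCirc_le (M : Fin r → Fin (k + 1) × Fin (n + 1) → ZMod 2)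
    (circ : QCircuit (Fin r ⊕ Fin nc ⊕ Fin m)) :
    (computeCirc (n := n) M circ).cost ≤ 6 * n + (1 + n) + (n + 1) +
      k * ((n + 1) * (n * (n + 1)) * 3) + r * ((k + 1) * (n + 1)) * 2 + circ.cost := by
  have h1 : QCircuit.cost (compareCirc (n := n) (k := k) (r := r) (nc := nc) (m := m)) ≤
      6 * n + (1 + n) := by
    unfold compareCirc
    rw [QCircuit.cost_append]
    refine add_le_add ((cost_mcxLayer_le _ _ _ _ 1 ?_).trans ?_)
      ((cost_mcxLayer_le _ _ _ _ n ?_).trans ?_)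
    · rintro ⟨a, _ | _ | _⟩ <;> simp
    · simp; omega
    · intro _
      exact Finset.card_image_le.trans (by simp)
    · simp
  have h2 : QCircuit.cost (powersCirc (n := n) (k := k) (r := r) (nc := nc) (m := m) k) ≤
      (n + 1) + k * ((n + 1) * (n * (n + 1)) * 3) := by
    unfold powersCirc
    rw [QCircuit.cost_append]
    refine add_le_add ((cost_mcxLayer_le _ _ _ _ 0 ?_).trans ?_) (cost_flatMap_range_le _ _ ?_ _)
    · simp
    · simpa using Finset.card_filter_le (Finset.univ : Finset (Fin (n + 1))) _
    · intro i
      split_ifs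
      · refine (cost_mcxLayer_le _ _ _ _ 2 fun a => Finset.card_le_two).trans ?_
        refine Nat.mul_le_mul_right _ ((Finset.card_filter_le _ _).trans ?_)
        simp
      · simp [QCircuit.cost]
  have h3 : QCircuit.cost (linearCirc (nc := nc) (m := m) M) ≤ r * ((k + 1) * (n + 1)) * 2 := by
    refine (cost_mcxLayer_le _ _ _ _ 1 ?_).trans ?_
    · simp
    · refine Nat.mul_le_mul_right _ ((Finset.card_filter_le _ _).trans ?_)
      simp
  unfold computeCirc
  simp only [QCircuit.cost_append, QCircuit.cost_rename]
  omega

end Hash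

section SimulatedOracle

variable {n k r nc m nin nout work : ℕ}

/-- The registers of an oracle algorithm together with the work space for simulated queries. -/
abbrev SimSys (nin n nc nout work k r m : ℕ) : Type :=
  OracleReg nin n nc nout work ⊕ SimReg n k r nc m

/-- The embedding of the query register and the work space for simulated queries. -/
def computeEmb : (Fin n ⊕ SimReg n k r nc m) ↪ SimSys nin n nc nout work k r m where
  toFun := Sum.map (fun i => .inr (.inl i)) id
  inj' := by
    rintro (i | i) (j | j) h <;> simp_all

/-- The position of the oracle answer. -/
abbrev ansPos (j : Fin nc) : OracleReg nin n nc nout work := .inr (.inr (.inl j))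

/-- The position of the hash value. -/
abbrev valPos (j : Fin nc) : SimReg n k r nc m := .inr (.inr (.inr (.inr (.inr (.inl j)))))

/-- The position of the flag. -/
abbrev flagPos : SimReg n k r nc m := .inr (.inr (.inl ()))

/-- The simulation of an oracle query to the hash function. -/
noncomputable def plainQuery (M : Fin r → Fin (k + 1) × Fin (n + 1) → ZMod 2)
    (circ : QCircuit (Fin r ⊕ Fin nc ⊕ Fin m)) : QCircuit (SimSys nin n nc nout work k r m) :=
  (QCircuit.rename computeEmb (computeCirc M circ) ++
    mcxLayer (Finset.univ : Finset (Fin nc)) (fun j => .inl (ansPos j)) (fun j => {.inr (valPos j)})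
      (by simp)) ++
  QCircuit.inverse (QCircuit.rename computeEmb (computeCirc M circ))

/-- The simulation of an oracle query to the hash function, reprogrammed at the marked point to the
value in an additional register. -/
noncomputable def markedQuery (M : Fin r → Fin (k + 1) × Fin (n + 1) → ZMod 2)
    (circ : QCircuit (Fin r ⊕ Fin nc ⊕ Fin m)) :
    QCircuit (Fin nc ⊕ SimSys nin n nc nout work k r m) :=
  (QCircuit.rename (computeEmb.trans .inr) (computeCirc M circ) ++
    mcxLayer (Finset.univ : Finset (Fin nc × Option Bool)) (fun a => .inr (.inl (ansPos a.1)))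
      (fun a => match a.2 with
        | none => {.inr (.inr (valPos a.1))}
        | some false => {.inr (.inr flagPos), .inr (.inr (valPos a.1))}
        | some true => {.inr (.inr flagPos), .inl a.1})
      (by rintro ⟨a, _ | _ | _⟩ <;> simp)) ++
  QCircuit.inverse (QCircuit.rename (computeEmb.trans .inr) (computeCirc M circ))

variable (M : Fin r → Fin (k + 1) × Fin (n + 1) → ZMod 2)
  (circ : QCircuit (Fin r ⊕ Fin nc ⊕ Fin m)) (f : Bits r → Bits nc)

/-- The contents of the work space when the hash value of `q` has been computed. -/
noncomputable def simDone (f : Bits r → Bits nc) (q y : Bits n) : SimReg n k r nc m → Bool :=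
  simBits y (fun i => decide (q i = y i)) (decide (q = y)) (powersUpTo q k)
    (linearHash (k + 1) M q) (f (linearHash (k + 1) M q)) (fun _ => false)

theorem computeCirc_rename_maps (hf : ComputesInto circ f)
    (b : OracleReg nin n nc nout work → Bool) (y : Bits n) :
    QCircuit.Maps (QCircuit.rename computeEmb (computeCirc M circ)) (Sum.elim b (simZero y))
      (Sum.elim b (simDone M f (queryPart b) y)) := by
  refine QCircuit.Maps.rename _ ?_ ?_
  · convert computeCirc_maps M circ f hf (queryPart b) y using 1
    · funext i; rcases i with i | i <;> rfl
    · funext i; rcases i with i | i <;> rfl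
  · rintro (i | i) hi
    · rfl
    · exact absurd ⟨.inr i, rfl⟩ hi

theorem plainQuery_maps (hf : ComputesInto circ f)
    (b : OracleReg nin n nc nout work → Bool) (y : Bits n) :
    QCircuit.Maps (plainQuery M circ) (Sum.elim b (simZero y))
      (Sum.elim (queryMap (fun q => f (linearHash (k + 1) M q)) b) (simZero y)) := by
  have h1 := computeCirc_rename_maps M circ f hf b y
  have h2 := computeCirc_rename_maps M circ f hf
    (queryMap (fun q => f (linearHash (k + 1) M q)) b) y
  rw [queryPart_queryMap] at h2
  refine (h1.append (mcxLayer_maps _ _ _ ?_ _ _ ?_)).append h2.inverse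
  · simp
  · rintro ((i | i | i | i | i) | i)
    · simp [queryMap]
    · simp [queryMap]
    · simp [queryMap, bitVal_xor, simDone, simBits]
      rfl
    · simp [queryMap]
    · simp [queryMap]
    · simp

theorem markedQuery_maps (hf : ComputesInto circ f) (c : Bits nc)
    (b : OracleReg nin n nc nout work → Bool) (y : Bits n) :
    QCircuit.Maps (markedQuery M circ) (Sum.elim c (Sum.elim b (simZero y)))
      (Sum.elim c (Sum.elim
        (queryMap (Function.update (fun q => f (linearHash (k + 1) M q)) y c) b) (simZero y))) := by
  have hren : ∀ b : OracleReg nin n nc nout work → Bool,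
      QCircuit.Maps (QCircuit.rename (computeEmb.trans .inr) (computeCirc M circ))
        (Sum.elim c (Sum.elim b (simZero y))) (Sum.elim c (Sum.elim b (simDone M f (queryPart b) y))) := by
    intro b
    refine QCircuit.Maps.rename _ ?_ ?_
    · convert computeCirc_maps M circ f hf (queryPart b) y using 1
      · funext i; rcases i with i | i <;> rfl
      · funext i; rcases i with i | i <;> rfl
    · rintro (i | i | i) hi
      · rfl
      · rfl
      · exact absurd ⟨.inr i, rfl⟩ hi
  have h1 := hren b
  have h2 := hren (queryMap (Function.update (fun q => f (linearHash (k + 1) M q)) y c) b)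
  rw [queryPart_queryMap] at h2
  refine (h1.append (mcxLayer_maps _ _ _ ?_ _ _ ?_)).append h2.inverse
  · rintro ⟨a, _ | _ | _⟩ ⟨a', _ | _ | _⟩ <;> simp
  · rintro (i | (i | i | i | i | i) | i)
    · simp
    · simp [queryMap]
    · simp [queryMap]
    · have hv : ∀ q : Bits n,
          bitVal (Function.update (fun q => f (linearHash (k + 1) M q)) y c q i) =
          bitVal (f (linearHash (k + 1) M q) i) +
            (bitVal (decide (q = y)) * bitVal (f (linearHash (k + 1) M q) i) +
              bitVal (decide (q = y)) * bitVal (c i)) := by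
        intro q
        have hz : ∀ z x : ZMod 2, x = z + (1 * z + 1 * x) := by decide
        by_cases hq : q = y
        · subst hq
          rw [Function.update_self, decide_eq_true rfl]
          exact hz _ _
        · rw [Function.update_of_ne hq, decide_eq_false hq]
          simp [bitVal]
      have hv' := hv (queryPart b)
      simp [Fintype.sum_prod_type, Fintype.sum_option, queryMap, bitVal_xor, simDone, simBits]
      rw [add_comm (bitVal (decide (queryPart b = y)) * bitVal (c i))]
      exact hv'
    · simp [queryMap]
    · simp [queryMap]
    · simp

end SimulatedOracle

/-! ### The dishonest prover obtained from a forger -/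

section Emb

variable {κ ι : Type} [Fintype κ] [DecidableEq κ] [Fintype ι] [DecidableEq ι]

/-- The image of an amplitude vector under a map of basis states. -/
noncomputable def embState (g : (κ → Bool) → (ι → Bool)) (ψ : QState κ) : QState ι :=
  ∑ b, ψ b • ket (g b)

theorem embState_apply (g : (κ → Bool) → (ι → Bool)) (ψ : QState κ) (c : ι → Bool) :
    embState g ψ c = ∑ b, if c = g b then ψ b else 0 := by
  simp [embState, ket, Finset.sum_apply]

theorem embState_sumElim {κ' : Type} [Fintype κ'] [DecidableEq κ'] (β : κ' → Bool)
    (ψ : QState κ) (c : κ' ⊕ κ → Bool) :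
    embState (fun b => Sum.elim β b) ψ c = if c ∘ Sum.inl = β then ψ (c ∘ Sum.inr) else 0 := by
  rw [embState_apply]
  have h : ∀ b : κ → Bool, c = Sum.elim β b ↔ c ∘ Sum.inl = β ∧ c ∘ Sum.inr = b := by
    intro b
    constructor
    · rintro rfl; exact ⟨rfl, rfl⟩
    · rintro ⟨rfl, rfl⟩; exact (Sum.elim_comp_inl_inr c).symm
  simp only [h, ite_and]
  split_ifs
  · simp
  · simp

theorem mulVec_embState (M : QOp ι) (g : (κ → Bool) → (ι → Bool)) (ψ : QState κ) :
    M *ᵥ embState g ψ = ∑ b, ψ b • (M *ᵥ ket (g b)) := by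
  rw [embState, Matrix.mulVec_sum]
  simp only [Matrix.mulVec_smul]

theorem lift_mulVec_embState (e : κ ↪ ι) (g : (κ → Bool) → (ι → Bool)) (h1 : ∀ b, g b ∘ e = b)
    (h2 : ∀ b b' i, i ∉ Set.range e → g b i = g b' i) (M : QOp κ) (ψ : QState κ) :
    QOp.lift e M *ᵥ embState g ψ = embState g (M *ᵥ ψ) := by
  have hcol : ∀ b, QOp.lift e M *ᵥ ket (g b) = ∑ b', M b' b • ket (g b') := by
    intro b
    funext c
    rw [QOp.lift_mulVec_ket, h1]
    simp only [Finset.sum_apply, Pi.smul_apply, ket, smul_eq_mul, mul_ite, mul_one, mul_zero]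
    have hc : ∀ b', c = g b' ↔ (∀ i, i ∉ Set.range e → c i = g b i) ∧ c ∘ e = b' := by
      intro b'
      constructor
      · rintro rfl
        exact ⟨fun i hi => h2 _ _ i hi, h1 b'⟩
      · rintro ⟨h, h'⟩
        funext i
        by_cases hi : i ∈ Set.range e
        · obtain ⟨j, rfl⟩ := hi
          have := congrFun (h1 b') j
          rw [← h'] at this ⊢
          exact this.symm
        · rw [h i hi, h2 b b' i hi]
    simp only [hc, ite_and]
    split_ifs
    · have : (M *ᵥ ket b) = fun c => M c b := by
        funext c
        simp [Matrix.mulVec, dotProduct, ket]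
      rw [this]
      simp
    · simp
  rw [mulVec_embState]
  simp only [hcol, Finset.smul_sum, smul_smul]
  rw [Finset.sum_comm]
  refine Finset.sum_congr rfl fun b' _ => ?_
  rw [← Finset.sum_smul]
  congr 1
  simp only [Matrix.mulVec, dotProduct, mul_comm]

theorem toOp_mulVec_embState {C : QCircuit ι} {g g' : (κ → Bool) → (ι → Bool)}
    (h : ∀ b, QCircuit.Maps C (g b) (g' b)) (ψ : QState κ) :
    C.toOp *ᵥ embState g ψ = embState g' ψ := by
  rw [mulVec_embState]
  exact Finset.sum_congr rfl fun b _ => by rw [h b]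

/-- Measuring a sum of images of amplitude vectors under maps with disjoint images. -/
theorem measureProb_sum_embState {J κ' : Type} [Fintype J] (e : κ' → ι) (g : J → (κ → Bool) → (ι → Bool))
    (hg : ∀ j b j' b', g j b = g j' b' → j = j' ∧ b = b') (ψ : J → QState κ)
    (P : (κ' → Bool) → Prop) [DecidablePred P] :
    measureProb e (∑ j, embState (g j) (ψ j)) P =
      ∑ j, ∑ b, if P (g j b ∘ e) then ‖ψ j b‖ ^ 2 else 0 := by
  classical
  have hval : ∀ j b, (∑ j, embState (g j) (ψ j)) (g j b) = ψ j b := by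
    intro j b
    simp only [Finset.sum_apply, embState_apply]
    rw [Finset.sum_eq_single j, Finset.sum_eq_single b]
    · simp
    · intro b' _ hb'
      rw [if_neg]
      exact fun h => hb' (hg _ _ _ _ h).2.symm
    · simp
    · intro j' _ hj'
      refine Finset.sum_eq_zero fun b' _ => ?_
      rw [if_neg]
      exact fun h => hj' (hg _ _ _ _ h).1.symm
    · simp
  have hzero : ∀ c, (∀ j b, c ≠ g j b) → (∑ j, embState (g j) (ψ j)) c = 0 := by
    intro c hc
    simp only [Finset.sum_apply, embState_apply]
    exact Finset.sum_eq_zero fun j _ => Finset.sum_eq_zero fun b _ => if_neg (hc j b)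
  rw [← Fintype.sum_prod_type']
  unfold measureProb
  symm
  refine Finset.sum_of_injOn (fun p : J × (κ → Bool) => g p.1 p.2) ?_
    (fun _ _ => Finset.mem_coe.2 (Finset.mem_univ _)) ?_ ?_
  · intro p _ p' _ h
    exact Prod.ext (hg _ _ _ _ h).1 (hg _ _ _ _ h).2
  · intro c _ hc
    rw [hzero c fun j b h => hc ⟨(j, b), by simp, h.symm⟩]
    simp
  · intro p _
    rw [hval]
    congr

theorem sqNorm_embState (g : (κ → Bool) → (ι → Bool)) (hg : Function.Injective g) (ψ : QState κ) :
    sqNorm (embState g ψ) = sqNorm ψ := by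
  have := measureProb_sum_embState (J := Unit) (fun i : ι => i) (fun _ => g)
    (fun _ _ _ _ h => ⟨rfl, hg h⟩) (fun _ => ψ) (fun _ => True)
  simpa [measureProb, sqNorm] using this

/-- Reindexing the qubits along a bijection. -/
theorem toOp_rename_equiv (E : κ ≃ ι) (C : QCircuit κ) (Φ : QState κ) :
    (QCircuit.rename E.toEmbedding C).toOp *ᵥ (fun b => Φ (b ∘ E)) =
      fun b => (C.toOp *ᵥ Φ) (b ∘ E) := by
  funext b
  rw [QCircuit.toOp_rename, QOp.lift_mulVec]
  simp only [Equiv.coe_toEmbedding]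
  have : ∀ b' : κ → Bool, Function.extend E b' b ∘ E = b' := fun b' =>
    QOp.extend_comp E.toEmbedding b' b
  simp only [this]

theorem sum_comp_equiv (E : κ ≃ ι) (F : (κ → Bool) → ℝ) :
    ∑ b : ι → Bool, F (b ∘ E) = ∑ b, F b :=
  Equiv.sum_comp (E.arrowCongr (Equiv.refl Bool)).symm F

end Emb

section Simulation

variable {nin n nc nout work : ℕ}

/-- The effect of a list of oracle queries, each to one of two oracles and followed by a circuit. -/
noncomputable def runMixed (H : Bool → Bits n → Bits nc)
    (l : List (Bool × QCircuit (OracleReg nin n nc nout work)))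
    (ψ : QState (OracleReg nin n nc nout work)) : QState (OracleReg nin n nc nout work) :=
  l.foldl (fun ψ p => QCircuit.toOp p.2 *ᵥ (queryOp (H p.1) *ᵥ ψ)) ψ

theorem runMixed_map (H : Bool → Bits n → Bits nc) (s : Bool)
    (L : List (QCircuit (OracleReg nin n nc nout work)))
    (ψ : QState (OracleReg nin n nc nout work)) :
    runMixed H (L.map fun c => (s, c)) ψ = runRounds (H s) L ψ := by
  simp [runMixed, runRounds, List.foldl_map]

theorem runMixed_zero (H : Bool → Bits n → Bits nc)
    (l : List (Bool × QCircuit (OracleReg nin n nc nout work))) :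
    runMixed H l 0 = 0 := by
  induction l with
  | nil => rfl
  | cons p l ih =>
    change runMixed H l (QCircuit.toOp p.2 *ᵥ (queryOp (H p.1) *ᵥ 0)) = 0
    rw [Matrix.mulVec_zero, Matrix.mulVec_zero, ih]

theorem toOp_simulation {ι : Type} [Fintype ι] [DecidableEq ι]
    (e : OracleReg nin n nc nout work ↪ ι)
    (g : (OracleReg nin n nc nout work → Bool) → (ι → Bool)) (h1 : ∀ b, g b ∘ e = b)
    (h2 : ∀ b b' i, i ∉ Set.range e → g b i = g b' i) (Q : Bool → QCircuit ι)
    (H : Bool → Bits n → Bits nc)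
    (l : List (Bool × QCircuit (OracleReg nin n nc nout work)))
    (hQ : ∀ p ∈ l, ∀ b, QCircuit.Maps (Q p.1) (g b) (g (queryMap (H p.1) b)))
    (ψ : QState (OracleReg nin n nc nout work)) :
    QCircuit.toOp (l.flatMap fun p => Q p.1 ++ QCircuit.rename e p.2) *ᵥ embState g ψ =
      embState g (runMixed H l ψ) := by
  induction l generalizing ψ with
  | nil => exact Matrix.one_mulVec _
  | cons p l ih =>
    rw [List.flatMap_cons, QCircuit.toOp_append, QCircuit.toOp_append, ← Matrix.mulVec_mulVec,
      ← Matrix.mulVec_mulVec]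
    have hq : (Q p.1).toOp *ᵥ embState g ψ = embState g (queryOp (H p.1) *ᵥ ψ) := by
      rw [mulVec_embState, embState, ← Equiv.sum_comp (queryEquiv (H p.1))]
      refine Finset.sum_congr rfl fun b _ => ?_
      have hb := hQ p List.mem_cons_self (queryMap (H p.1) b)
      rw [queryMap_queryMap] at hb
      change ψ (queryMap (H p.1) b) • ((Q p.1).toOp *ᵥ ket (g (queryMap (H p.1) b))) = _
      rw [show _ *ᵥ _ = _ from hb, queryOp_mulVec]
    rw [hq, QCircuit.toOp_rename, lift_mulVec_embState e g h1 h2, ih fun p' hp' =>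
      hQ p' (List.mem_cons_of_mem _ hp')]
    rfl

end Simulation

section Prover

variable {nin n₀ na nc nz nout k r m : ℕ}

/-- The registers of the prover in the first stage. -/
abbrev Stage₁Reg (na nin n nc nout work k r m : ℕ) : Type := Fin na ⊕ SimSys nin n nc nout work k r m

/-- The registers of the prover in the second stage. -/
abbrev Stage₂Reg (nz nin n nc nout work k r m : ℕ) : Type :=
  (Fin nc ⊕ Fin nz) ⊕ SimSys nin n nc nout work k r m

/-- The embedding of the registers for a query to the marked oracle in the second stage. -/
def markedEmb {nin n nc nout work : ℕ} :
    (Fin nc ⊕ SimSys nin n nc nout work k r m) ↪ Stage₂Reg nz nin n nc nout work k r m where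
  toFun := Sum.map .inl id
  inj' := by rintro (i | i) (j | j) h <;> simp_all

/-- The last `na` bits of a query point: the first message of the protocol. -/
def firstMessage (y : Bits (n₀ + na)) : Bits na := fun i => y (Fin.natAdd n₀ i)

/-- The circuit of the first stage: it runs the forger for the rounds `pre`, and then copies the
qubits at the positions `pos` to the register for the marked query point, and its last part to the
message register. -/
noncomputable def stage₁Circ {work : ℕ} (M : Fin r → Fin (k + 1) × Fin (n₀ + na + 1) → ZMod 2)
    (circ : QCircuit (Fin r ⊕ Fin nc ⊕ Fin m))
    (first : QCircuit (OracleReg nin (n₀ + na) nc nout work))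
    (pre : List (QCircuit (OracleReg nin (n₀ + na) nc nout work)))
    (pos : Fin (n₀ + na) → OracleReg nin (n₀ + na) nc nout work) :
    QCircuit (Stage₁Reg na nin (n₀ + na) nc nout work k r m) :=
  (QCircuit.rename (Function.Embedding.inl.trans .inr) first ++
    (pre.map fun c => (false, c)).flatMap fun p =>
      QCircuit.rename .inr (plainQuery M circ) ++
        QCircuit.rename (Function.Embedding.inl.trans .inr) p.2) ++
  mcxLayer (Finset.univ : Finset (Fin (n₀ + na) ⊕ Fin na))
    (Sum.elim (fun i => .inr (.inr (.inl i))) .inl)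
    (Sum.elim (fun i => {.inr (.inl (pos i))}) fun i => {.inr (.inl (pos (Fin.natAdd n₀ i)))})
    (by rintro (i | i) <;> simp)

/-- The circuit of the second stage: it runs the rounds `post`, in each of which the query is
answered by the hash function or by the hash function reprogrammed to the challenge at the marked
point, and then copies the qubits at the positions `zpos` to the message register. -/
noncomputable def stage₂Circ {work : ℕ} (M : Fin r → Fin (k + 1) × Fin (n₀ + na + 1) → ZMod 2)
    (circ : QCircuit (Fin r ⊕ Fin nc ⊕ Fin m))
    (post : List (Bool × QCircuit (OracleReg nin (n₀ + na) nc nout work)))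
    (zpos : Fin nz → OracleReg nin (n₀ + na) nc nout work) :
    QCircuit (Stage₂Reg nz nin (n₀ + na) nc nout work k r m) :=
  (post.flatMap fun p =>
      (if p.1 then QCircuit.rename markedEmb (markedQuery M circ)
        else QCircuit.rename .inr (plainQuery M circ)) ++
        QCircuit.rename (Function.Embedding.inl.trans .inr) p.2) ++
  mcxLayer (Finset.univ : Finset (Fin nz)) (fun i => .inl (.inr i)) (fun i => {.inr (.inl (zpos i))})
    (by simp)

variable {A : QOracleAlg nin (n₀ + na) nc nout}
  (M : Fin r → Fin (k + 1) × Fin (n₀ + na + 1) → ZMod 2)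
  (circ : QCircuit (Fin r ⊕ Fin nc ⊕ Fin m)) (f : Bits r → Bits nc)

theorem stage₁Circ_mulVec {work : ℕ} (hf : ComputesInto circ f)
    (first : QCircuit (OracleReg nin (n₀ + na) nc nout work))
    (pre : List (QCircuit (OracleReg nin (n₀ + na) nc nout work)))
    (pos : Fin (n₀ + na) → OracleReg nin (n₀ + na) nc nout work)
    (ψ : QState (OracleReg nin (n₀ + na) nc nout work)) :
    (stage₁Circ M circ first pre pos).toOp *ᵥ
        embState (fun b => Sum.elim (fun _ => false) (Sum.elim b (simZero fun _ => false))) ψ =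
      embState (fun b => Sum.elim (firstMessage (b ∘ pos)) (Sum.elim b (simZero (b ∘ pos))))
        (runRounds (fun q => f (linearHash (k + 1) M q)) pre (first.toOp *ᵥ ψ)) := by
  have hg1 : ∀ b : OracleReg nin (n₀ + na) nc nout work → Bool,
      (Sum.elim (fun _ => false) (Sum.elim b (simZero fun _ => false)) :
        Stage₁Reg na nin (n₀ + na) nc nout work k r m → Bool) ∘
        (Function.Embedding.inl.trans .inr : _ ↪ Stage₁Reg na nin (n₀ + na) nc nout work k r m) =
          b := fun b => rfl
  have hg2 : ∀ (b b' : OracleReg nin (n₀ + na) nc nout work → Bool)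
      (i : Stage₁Reg na nin (n₀ + na) nc nout work k r m),
      i ∉ Set.range (Function.Embedding.inl.trans .inr : _ ↪ Stage₁Reg na nin (n₀ + na) nc nout work k r m) →
      (Sum.elim (fun _ => false) (Sum.elim b (simZero fun _ => false)) :
        Stage₁Reg na nin (n₀ + na) nc nout work k r m → Bool) i =
      (Sum.elim (fun _ => false) (Sum.elim b' (simZero fun _ => false)) :
        Stage₁Reg na nin (n₀ + na) nc nout work k r m → Bool) i := by
    rintro b b' (i | i | i) hi
    · rfl
    · exact absurd ⟨i, rfl⟩ hi
    · rfl
  have h0 : bitVal false = 0 := rfl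
  unfold stage₁Circ
  rw [QCircuit.toOp_append, QCircuit.toOp_append, ← Matrix.mulVec_mulVec, ← Matrix.mulVec_mulVec,
    QCircuit.toOp_rename, lift_mulVec_embState _ _ hg1 hg2,
    toOp_simulation _ _ hg1 hg2 (fun _ => QCircuit.rename .inr (plainQuery M circ))
      (fun _ q => f (linearHash (k + 1) M q)), runMixed_map]
  · refine toOp_mulVec_embState (fun b => mcxLayer_maps _ _ _ ?_ _ _ ?_) _
    · rintro (i | i) (j | j) <;> simp
    · rintro (i | i | i | i | i | i)
      · simp [firstMessage, h0]
      · simp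
      · simp [simZero, simBits, h0]
      all_goals simp [simZero, simBits]
  · intro p _ b
    refine QCircuit.Maps.rename _ (plainQuery_maps M circ f hf b _) ?_
    rintro (i | i) hi
    · rfl
    · exact absurd ⟨i, rfl⟩ hi

theorem stage₂Circ_mulVec {work : ℕ} (hf : ComputesInto circ f)
    (post : List (Bool × QCircuit (OracleReg nin (n₀ + na) nc nout work)))
    (zpos : Fin nz → OracleReg nin (n₀ + na) nc nout work) (y : Bits (n₀ + na)) (c : Bits nc)
    (ψ : QState (OracleReg nin (n₀ + na) nc nout work)) :
    (stage₂Circ M circ post zpos).toOp *ᵥ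
        embState (fun b => Sum.elim (Sum.elim c fun _ => false) (Sum.elim b (simZero y))) ψ =
      embState (fun b => Sum.elim (Sum.elim c (b ∘ zpos)) (Sum.elim b (simZero y)))
        (runMixed (fun s => if s then Function.update (fun q => f (linearHash (k + 1) M q)) y c
          else fun q => f (linearHash (k + 1) M q)) post ψ) := by
  have hg1 : ∀ b : OracleReg nin (n₀ + na) nc nout work → Bool,
      (Sum.elim (Sum.elim c fun _ => false) (Sum.elim b (simZero y)) :
        Stage₂Reg nz nin (n₀ + na) nc nout work k r m → Bool) ∘
        (Function.Embedding.inl.trans .inr : _ ↪ Stage₂Reg nz nin (n₀ + na) nc nout work k r m) =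
          b := fun b => rfl
  have hg2 : ∀ (b b' : OracleReg nin (n₀ + na) nc nout work → Bool)
      (i : Stage₂Reg nz nin (n₀ + na) nc nout work k r m),
      i ∉ Set.range (Function.Embedding.inl.trans .inr : _ ↪ Stage₂Reg nz nin (n₀ + na) nc nout work k r m) →
      (Sum.elim (Sum.elim c fun _ => false) (Sum.elim b (simZero y)) :
        Stage₂Reg nz nin (n₀ + na) nc nout work k r m → Bool) i =
      (Sum.elim (Sum.elim c fun _ => false) (Sum.elim b' (simZero y)) :
        Stage₂Reg nz nin (n₀ + na) nc nout work k r m → Bool) i := by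
    rintro b b' (i | i | i) hi
    · rfl
    · exact absurd ⟨i, rfl⟩ hi
    · rfl
  have h0 : bitVal false = 0 := rfl
  unfold stage₂Circ
  rw [QCircuit.toOp_append, ← Matrix.mulVec_mulVec,
    toOp_simulation _ _ hg1 hg2 (fun s => if s then QCircuit.rename markedEmb (markedQuery M circ)
        else QCircuit.rename .inr (plainQuery M circ))
      (fun s => if s then Function.update (fun q => f (linearHash (k + 1) M q)) y c
          else fun q => f (linearHash (k + 1) M q))]
  · refine toOp_mulVec_embState (fun b => mcxLayer_maps _ _ _ ?_ _ _ ?_) _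
    · simp
    · rintro ((i | i) | i | i)
      · simp
      · simp [h0]
      · simp
      · simp
  · rintro ⟨_ | _, c'⟩ _ b
    · refine QCircuit.Maps.rename _ (plainQuery_maps M circ f hf b _) ?_
      rintro (i | i) hi
      · rfl
      · exact absurd ⟨i, rfl⟩ hi
    · refine QCircuit.Maps.rename _ ?_ ?_
      · convert markedQuery_maps M circ f hf c b y using 1
        · funext i; rcases i with i | i <;> rfl
        · funext i; rcases i with i | i <;> rfl
      · rintro ((i | i) | i) hi
        · rfl
        · rfl
        · exact absurd ⟨.inr i, rfl⟩ hi

end Prover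

theorem measureProb_comp_equiv {κ ι κ' : Type} [Fintype κ] [DecidableEq κ] [Fintype ι]
    [DecidableEq ι] (E : κ ≃ ι) (e : κ' → κ) (Φ : QState κ) (P : (κ' → Bool) → Prop) :
    measureProb (fun i => E (e i)) (fun b => Φ (b ∘ E)) P = measureProb e Φ P := by
  classical
  unfold measureProb
  exact sum_comp_equiv E fun b => if P (b ∘ e) then ‖Φ b‖ ^ 2 else 0

theorem measureProb_le_sqNorm {ι κ' : Type} [Fintype ι] [DecidableEq ι] (e : κ' → ι)
    (Φ : QState ι) (P : (κ' → Bool) → Prop) : measureProb e Φ P ≤ sqNorm Φ := by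
  unfold measureProb sqNorm
  refine Finset.sum_le_sum fun b _ => ?_
  split_ifs
  · exact le_rfl
  · positivity

theorem measureProb_nonneg {ι κ' : Type} [Fintype ι] [DecidableEq ι] (e : κ' → ι)
    (Φ : QState ι) (P : (κ' → Bool) → Prop) : 0 ≤ measureProb e Φ P := by
  unfold measureProb
  refine Finset.sum_nonneg fun b _ => ?_
  split_ifs
  · positivity
  · exact le_rfl

theorem SigmaProtocol.acceptProb_nonneg {R : RelFamily} (S : SigmaProtocol R) (η : ℕ)
    (x : Bits (R.nx η)) (A : SigmaAdversary (S.na η) (S.nc η) (S.nz η)) :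
    0 ≤ S.acceptProb η x A :=
  div_nonneg (Finset.sum_nonneg fun _ _ => Finset.sum_nonneg fun _ _ => measureProb_nonneg _ _ _)
    (Nat.cast_nonneg _)

theorem sqNorm_comp_equiv {κ ι : Type} [Fintype κ] [DecidableEq κ] [Fintype ι] [DecidableEq ι]
    (E : κ ≃ ι) (Φ : QState κ) : sqNorm (fun b => Φ (b ∘ E)) = sqNorm Φ :=
  sum_comp_equiv E fun b => ‖Φ b‖ ^ 2

theorem SigmaAdversary.sqNorm_state₁ {na nc nz : ℕ} (A : SigmaAdversary na nc nz) :
    sqNorm A.state₁ = 1 := by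
  unfold SigmaAdversary.state₁
  rw [QCircuit.sqNorm_mulVec]
  have : (fun b : Fin na ⊕ Fin A.work → Bool =>
      if ∀ i, b (.inl i) = false then A.init (fun i => b (.inr i)) else 0) =
      embState (fun b => Sum.elim (fun _ => false) b) A.init := by
    funext b
    rw [embState_sumElim]
    have : (∀ i, b (.inl i) = false) ↔ b ∘ Sum.inl = fun _ => false := by
      simp [funext_iff]
    simp only [this]
    rfl
  rw [this, sqNorm_embState]
  · exact A.init_unit
  · intro b b' h
    funext i
    exact congrFun h (.inr i)

theorem SigmaAdversary.sum_sqNorm_state₂ {na nc nz : ℕ} (A : SigmaAdversary na nc nz) (c : Bits nc) :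
    ∑ a, sqNorm (A.state₂ a c) = 1 := by
  have h : ∀ a, sqNorm (A.state₂ a c) = ∑ w, ‖A.state₁ (Sum.elim a w)‖ ^ 2 := by
    intro a
    unfold SigmaAdversary.state₂
    rw [QCircuit.sqNorm_mulVec]
    have : (fun b : (Fin nc ⊕ Fin nz) ⊕ Fin A.work → Bool =>
        if (∀ i, b (.inl (.inl i)) = c i) ∧ (∀ i, b (.inl (.inr i)) = false) then
          A.state₁ (Sum.elim a (fun i => b (.inr i))) else 0) =
        embState (fun b => Sum.elim (Sum.elim c fun _ => false) b)
          (fun w => A.state₁ (Sum.elim a w)) := by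
      funext b
      rw [embState_sumElim]
      have : ((∀ i, b (.inl (.inl i)) = c i) ∧ (∀ i, b (.inl (.inr i)) = false)) ↔
          b ∘ Sum.inl = Sum.elim c fun _ => false := by
        simp [funext_iff]
      simp only [this]
      rfl
    rw [this, sqNorm_embState]
    · rfl
    · intro b b' h
      funext i
      exact congrFun h (.inr i)
  simp only [h]
  rw [← A.sqNorm_state₁, ← Fintype.sum_prod_type']
  exact Equiv.sum_comp (Equiv.sumArrowEquivProdArrow (Fin na) (Fin A.work) Bool).symm
    fun b => ‖A.state₁ b‖ ^ 2

theorem SigmaProtocol.acceptProb_le_one {R : RelFamily} (S : SigmaProtocol R) (η : ℕ)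
    (x : Bits (R.nx η)) (A : SigmaAdversary (S.na η) (S.nc η) (S.nz η)) :
    S.acceptProb η x A ≤ 1 := by
  unfold SigmaProtocol.acceptProb uniformAvg
  refine div_le_one_of_le₀ ?_ (Nat.cast_nonneg _)
  have h : ∀ c : {c // c ∈ S.chal η}, ∑ a, measureProb (fun i => .inl (.inr i)) (A.state₂ a c)
      (fun z => S.verify η x a c z) ≤ 1 := fun c =>
    (Finset.sum_le_sum fun a _ => measureProb_le_sqNorm _ _ _).trans (A.sum_sqNorm_state₂ c).le
  refine (Finset.sum_le_sum fun c _ => h c).trans ?_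
  simp

theorem QOracleAlg.start_eq_embState {nin nq ny nout : ℕ} (A : QOracleAlg nin nq ny nout)
    (x : Bits nin) :
    A.start x = embState (fun w => Sum.elim x (Sum.elim (fun _ => false)
      (Sum.elim (fun _ => false) (Sum.elim (fun _ => false) w)))) A.init := by
  funext b
  rw [embState_apply, QOracleAlg.start]
  have hb : ∀ w, b = Sum.elim x (Sum.elim (fun _ => false)
      (Sum.elim (fun _ => false) (Sum.elim (fun _ => false) w))) ↔
      ((∀ i, b (.inl i) = x i) ∧ (∀ i, b (.inr (.inl i)) = false) ∧
      (∀ i, b (.inr (.inr (.inl i))) = false) ∧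
      (∀ i, b (.inr (.inr (.inr (.inl i)))) = false)) ∧
      (fun i => b (.inr (.inr (.inr (.inr i))))) = w := by
    intro w
    simp [funext_iff, and_assoc]
  simp only [hb, ite_and]
  split_ifs <;> simp

theorem QOracleAlg.sqNorm_start {nin nq ny nout : ℕ} (A : QOracleAlg nin nq ny nout) (x : Bits nin) :
    sqNorm (A.start x) = 1 := by
  rw [A.start_eq_embState, sqNorm_embState]
  · exact A.init_unit
  · intro b b' h
    funext i
    exact congrFun h (.inr (.inr (.inr (.inr i))))

section Reindex

variable {κ W : Type} [Fintype κ] [DecidableEq κ] [Fintype W] [DecidableEq W] {na nc nz N : ℕ}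
  (E : W ≃ Fin N)

theorem embState_zero_register (g : (κ → Bool) → (W → Bool)) (ψ : QState κ) :
    (fun b : Fin na ⊕ Fin N → Bool =>
      if ∀ i, b (.inl i) = false then embState g ψ ((fun i => b (.inr i)) ∘ E) else 0) =
    fun b => embState (fun b' => Sum.elim (fun _ => false) (g b')) ψ
      (b ∘ (Equiv.refl (Fin na)).sumCongr E) := by
  funext b
  simp only [embState_apply]
  have h2 : ∀ b', b ∘ (Equiv.refl (Fin na)).sumCongr E = Sum.elim (fun _ => false) (g b') ↔
      (∀ i, b (.inl i) = false) ∧ (fun i => b (.inr i)) ∘ E = g b' := by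
    intro b'
    constructor
    · intro h
      exact ⟨fun i => congrFun h (.inl i), funext fun i => congrFun h (.inr i)⟩
    · rintro ⟨h, h'⟩
      funext i
      rcases i with i | i
      · exact h i
      · exact congrFun h' i
  simp only [h2, ite_and]
  by_cases h : ∀ i, b (.inl i) = false
  · simp only [if_pos h]
  · simp only [if_neg h, Finset.sum_const_zero]

theorem embState_measured_register {Y : Type} [Fintype Y] [DecidableEq Y]
    (g : Y → (κ → Bool) → (W → Bool)) (p : (κ → Bool) → Y) (fm : Y → Bits na) (a : Bits na)
    (c : Bits nc) (ψ : QState κ) :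
    (fun b : (Fin nc ⊕ Fin nz) ⊕ Fin N → Bool =>
      if (∀ i, b (.inl (.inl i)) = c i) ∧ (∀ i, b (.inl (.inr i)) = false) then
        embState (fun b' => Sum.elim (fm (p b')) (g (p b') b')) ψ
          ((Sum.elim a fun i => b (.inr i)) ∘ (Equiv.refl (Fin na)).sumCongr E) else 0) =
    fun b => (∑ y, embState (fun b' => Sum.elim (Sum.elim c fun _ => false) (g y b'))
      (restrictTo (fun b' => p b' = y ∧ fm y = a) ψ))
        (b ∘ (Equiv.refl (Fin nc ⊕ Fin nz)).sumCongr E) := by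
  funext b
  simp only [Finset.sum_apply, embState_apply]
  have h1 : ∀ y b', b ∘ (Equiv.refl (Fin nc ⊕ Fin nz)).sumCongr E =
      Sum.elim (Sum.elim c fun _ => false) (g y b') ↔
      ((∀ i, b (.inl (.inl i)) = c i) ∧ ∀ i, b (.inl (.inr i)) = false) ∧
      (fun i => b (.inr i)) ∘ E = g y b' := by
    intro y b'
    constructor
    · intro h
      exact ⟨⟨fun i => congrFun h (.inl (.inl i)), fun i => congrFun h (.inl (.inr i))⟩,
        funext fun i => congrFun h (.inr i)⟩
    · rintro ⟨⟨h, h'⟩, h''⟩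
      funext i
      rcases i with (i | i) | i
      · exact h i
      · exact h' i
      · exact congrFun h'' i
  have h2 : ∀ b', (Sum.elim a fun i => b (.inr i)) ∘ (Equiv.refl (Fin na)).sumCongr E =
      Sum.elim (fm (p b')) (g (p b') b') ↔ fm (p b') = a ∧
      (fun i => b (.inr i)) ∘ E = g (p b') b' := by
    intro b'
    constructor
    · intro h
      exact ⟨funext fun i => (congrFun h (.inl i)).symm, funext fun i => congrFun h (.inr i)⟩
    · rintro ⟨h, h'⟩
      funext i
      rcases i with i | i
      · exact (congrFun h i).symm
      · exact congrFun h' i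
  by_cases hc : (∀ i, b (.inl (.inl i)) = c i) ∧ ∀ i, b (.inl (.inr i)) = false
  · rw [if_pos hc]
    simp only [h1, h2, hc, implies_true, and_self, true_and, restrictTo]
    rw [Finset.sum_comm]
    refine Finset.sum_congr rfl fun b' _ => ?_
    rw [Finset.sum_eq_single (p b')]
    · by_cases h3 : fm (p b') = a
      · simp [h3]
      · simp [h3]
    · intro y _ hy
      simp [hy.symm]
    · simp
  · rw [if_neg hc]
    simp only [h1, hc, false_and, if_false, Finset.sum_const_zero]

end Reindex

section Prover

variable {nin n₀ na nc nz nout k r m : ℕ} (A : QOracleAlg nin (n₀ + na) nc nout)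
  (M : Fin r → Fin (k + 1) × Fin (n₀ + na + 1) → ZMod 2)
  (circ : QCircuit (Fin r ⊕ Fin nc ⊕ Fin m)) (f : Bits r → Bits nc)
  (pre : List (QCircuit (OracleReg nin (n₀ + na) nc nout A.work)))
  (post : List (Bool × QCircuit (OracleReg nin (n₀ + na) nc nout A.work)))
  (pos : Fin (n₀ + na) → OracleReg nin (n₀ + na) nc nout A.work)
  (zpos : Fin nz → OracleReg nin (n₀ + na) nc nout A.work) (x : Bits nin)

/-- The dishonest prover that runs the forger `A` with the hash function given by `M` as its oracle.
It runs the rounds `pre`, measures the qubits at the positions `pos` to obtain a query point, the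
last part of which is its first message, runs the rounds `post` with the hash function reprogrammed
to the challenge at this point, and responds with the qubits at the positions `zpos`. -/
noncomputable def forgerProver : SigmaAdversary na nc nz where
  work := Fintype.card (SimSys nin (n₀ + na) nc nout A.work k r m)
  init b := embState (fun b => Sum.elim b (simZero fun _ => false)) (A.start x)
    (b ∘ Fintype.equivFin (SimSys nin (n₀ + na) nc nout A.work k r m))
  init_unit := by
    have h := sqNorm_comp_equiv (Fintype.equivFin (SimSys nin (n₀ + na) nc nout A.work k r m))
      (embState (fun b => Sum.elim b (simZero fun _ => false)) (A.start x))
    rw [sqNorm_embState, A.sqNorm_start] at h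
    · exact h
    · intro b b' h
      funext i
      exact congrFun h (.inl i)
  stage₁ := QCircuit.rename ((Equiv.refl _).sumCongr (Fintype.equivFin _)).toEmbedding
    (stage₁Circ M circ A.first pre pos)
  stage₂ := QCircuit.rename ((Equiv.refl _).sumCongr (Fintype.equivFin _)).toEmbedding
    (stage₂Circ M circ post zpos)

theorem forgerProver_state₁ (hf : ComputesInto circ f) :
    (forgerProver A M circ pre post pos zpos x).state₁ = fun b =>
      embState (fun b => Sum.elim (firstMessage (b ∘ pos)) (Sum.elim b (simZero (b ∘ pos))))
        (runRounds (fun q => f (linearHash (k + 1) M q)) pre (A.first.toOp *ᵥ A.start x))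
        (b ∘ (Equiv.refl _).sumCongr (Fintype.equivFin _)) := by
  rw [← stage₁Circ_mulVec M circ f hf, ← toOp_rename_equiv]
  exact congrArg (fun Φ => QCircuit.toOp _ *ᵥ Φ) (embState_zero_register
    (Fintype.equivFin (SimSys nin (n₀ + na) nc nout A.work k r m)) _ _)

theorem forgerProver_state₂ (hf : ComputesInto circ f) (a : Bits na) (c : Bits nc) :
    (forgerProver A M circ pre post pos zpos x).state₂ a c = fun b =>
      (∑ y : Bits (n₀ + na),
        embState (fun b => Sum.elim (Sum.elim c (b ∘ zpos)) (Sum.elim b (simZero y)))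
          (runMixed (fun s => if s then Function.update (fun q => f (linearHash (k + 1) M q)) y c
            else fun q => f (linearHash (k + 1) M q)) post
            (restrictTo (fun b => b ∘ pos = y ∧ firstMessage y = a)
              (runRounds (fun q => f (linearHash (k + 1) M q)) pre (A.first.toOp *ᵥ A.start x)))))
        (b ∘ (Equiv.refl _).sumCongr (Fintype.equivFin _)) := by
  simp only [← stage₂Circ_mulVec M circ f hf]
  rw [← Matrix.mulVec_sum, ← toOp_rename_equiv]
  unfold SigmaAdversary.state₂
  rw [forgerProver_state₁ A M circ f pre post pos zpos x hf]
  exact congrArg (fun Φ => QCircuit.toOp _ *ᵥ Φ) (embState_measured_register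
    (Fintype.equivFin (SimSys nin (n₀ + na) nc nout A.work k r m))
    (fun y b => Sum.elim b (simZero y)) (fun b => b ∘ pos) firstMessage a c _)

open Classical in
/-- The acceptance probability of `forgerProver`, summed over the first messages. -/
theorem forgerProver_measureProb (hf : ComputesInto circ f) (c : Bits nc)
    (P : Bits na → Bits nz → Prop) :
    ∑ a, measureProb (fun i => .inl (.inr i))
        ((forgerProver A M circ pre post pos zpos x).state₂ a c) (P a) =
      ∑ y : Bits (n₀ + na), ∑ b, if P (firstMessage y) (b ∘ zpos) then
        ‖runMixed (fun s => if s then Function.update (fun q => f (linearHash (k + 1) M q)) y c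
            else fun q => f (linearHash (k + 1) M q)) post
            (restrictTo (fun b => b ∘ pos = y)
              (runRounds (fun q => f (linearHash (k + 1) M q)) pre (A.first.toOp *ᵥ A.start x))) b‖ ^ 2
        else 0 := by
  have h1 : ∀ a, measureProb (fun i => .inl (.inr i))
        ((forgerProver A M circ pre post pos zpos x).state₂ a c) (P a) =
      ∑ y : Bits (n₀ + na), ∑ b, if P a (b ∘ zpos) then
        ‖runMixed (fun s => if s then Function.update (fun q => f (linearHash (k + 1) M q)) y c
            else fun q => f (linearHash (k + 1) M q)) post
            (restrictTo (fun b => b ∘ pos = y ∧ firstMessage y = a)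
              (runRounds (fun q => f (linearHash (k + 1) M q)) pre (A.first.toOp *ᵥ A.start x))) b‖ ^ 2
        else 0 := by
    intro a
    rw [forgerProver_state₂ A M circ f pre post pos zpos x hf]
    refine (measureProb_comp_equiv ((Equiv.refl (Fin nc ⊕ Fin nz)).sumCongr
      (Fintype.equivFin (SimSys nin (n₀ + na) nc nout A.work k r m)))
      (fun i : Fin nz => Sum.inl (Sum.inr i)) _ (P a)).trans ?_
    rw [measureProb_sum_embState]
    · rfl
    · intro y b y' b' h
      exact ⟨funext fun i => congrFun h (.inr (.inr (.inl i))),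
        funext fun i => congrFun h (.inr (.inl i))⟩
  simp only [h1]
  rw [Finset.sum_comm]
  refine Finset.sum_congr rfl fun y _ => ?_
  rw [Finset.sum_comm]
  refine Finset.sum_congr rfl fun b _ => ?_
  rw [Finset.sum_eq_single (firstMessage y)]
  · simp only [and_true]
  · intro a _ ha
    have : (restrictTo (fun b => b ∘ pos = y ∧ firstMessage y = a)
        (runRounds (fun q => f (linearHash (k + 1) M q)) pre (A.first.toOp *ᵥ A.start x))) = 0 := by
      funext b
      simp [restrictTo, ha.symm]
    rw [this, runMixed_zero]
    simp
  · simp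

end Prover

/-! ### From forgers to dishonest provers -/

section Uniform

theorem uniformAvg_mono {α : Type*} [Fintype α] {F G : α → ℝ} (h : ∀ a, F a ≤ G a) :
    uniformAvg F ≤ uniformAvg G :=
  div_le_div_of_nonneg_right (Finset.sum_le_sum fun a _ => h a) (Nat.cast_nonneg _)

theorem uniformAvg_const_mul {α : Type*} [Fintype α] (c : ℝ) (F : α → ℝ) :
    uniformAvg (fun a => c * F a) = c * uniformAvg F := by
  simp only [uniformAvg, ← Finset.mul_sum, mul_div_assoc]

theorem exists_uniformAvg_le {α : Type*} [Fintype α] [Nonempty α] (F : α → ℝ) :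
    ∃ a, uniformAvg F ≤ F a := by
  obtain ⟨a, _, ha⟩ := Finset.exists_max_image Finset.univ F Finset.univ_nonempty
  refine ⟨a, ?_⟩
  have hc : (0 : ℝ) < Fintype.card α := by exact_mod_cast Fintype.card_pos
  unfold uniformAvg
  rw [div_le_iff₀ hc]
  refine (Finset.sum_le_card_nsmul Finset.univ F (F a) fun b _ => ha b (Finset.mem_univ b)).trans ?_
  rw [nsmul_eq_mul, mul_comm, Finset.card_univ]

open Classical in
/-- The probability weights of the uniform distribution on a finite set. -/
noncomputable def uniformLaw {V : Type*} (s : Finset V) (v : V) : ℝ :=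
  if v ∈ s then ((s.card : ℝ))⁻¹ else 0

theorem uniformLaw_nonneg {V : Type*} (s : Finset V) (v : V) : 0 ≤ uniformLaw s v := by
  unfold uniformLaw; split_ifs <;> positivity

theorem sum_uniformLaw_mul {V : Type*} [Fintype V] (s : Finset V) (F : V → ℝ) :
    ∑ v, uniformLaw s v * F v = uniformAvg fun v : {v // v ∈ s} => F v := by
  classical
  simp only [uniformLaw, ite_mul, zero_mul, uniformAvg, Fintype.card_coe]
  rw [Finset.sum_ite_mem, Finset.univ_inter, ← Finset.mul_sum, ← Finset.sum_coe_sort s F, mul_comm,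
    div_eq_mul_inv]

theorem sum_uniformLaw_mul_sum {V J : Type*} [Fintype V] [Fintype J] (s : Finset V) (K : ℝ)
    (F : J → V → ℝ) :
    ∑ v, uniformLaw s v * (K * ∑ j, F j v) = K * ∑ j, uniformAvg fun v : {v // v ∈ s} => F j v := by
  simp only [← sum_uniformLaw_mul]
  rw [Finset.sum_comm, Finset.mul_sum]
  refine Finset.sum_congr rfl fun v _ => ?_
  rw [← Finset.mul_sum]
  ring

theorem sum_uniformLaw {V : Type*} [Fintype V] (s : Finset V) (hs : s.Nonempty) :
    ∑ v, uniformLaw s v = 1 := by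
  have := sum_uniformLaw_mul s fun _ => 1
  simp only [mul_one] at this
  rw [this]
  have : (s.card : ℝ) ≠ 0 := by exact_mod_cast hs.card_pos.ne'
  simp [uniformAvg, this]

theorem uniformAvg_eq_prodExp {Y V : Type*} [Fintype Y] [DecidableEq Y] [Fintype V] [DecidableEq V]
    (s : Finset V) (F : (Y → V) → ℝ) :
    uniformAvg (fun H : Y → {v // v ∈ s} => F fun u => H u) = prodExp (uniformLaw s) F := by
  have h1 : pushLaw (fun v : {v // v ∈ s} => (v : V)) (fun _ => ((s.card : ℝ))⁻¹) = uniformLaw s := by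
    funext v
    unfold pushLaw uniformLaw
    by_cases hv : v ∈ s
    · rw [if_pos hv, Finset.sum_eq_single ⟨v, hv⟩]
      · simp
      · rintro ⟨w, hw⟩ _ hne
        rw [if_neg]
        rintro rfl
        exact hne rfl
      · simp
    · rw [if_neg hv]
      refine Finset.sum_eq_zero fun w _ => if_neg ?_
      rintro rfl
      exact hv w.2
  rw [← h1, ← prodExp_map]
  unfold uniformAvg prodExp
  rw [← Finset.mul_sum, Finset.prod_const, div_eq_inv_mul, Fintype.card_fun, Fintype.card_coe,
    Finset.card_univ]
  push_cast
  rw [inv_pow]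

/-- The law of the image under `f` of a uniform random element. -/
noncomputable def samplerLaw {Ω V : Type*} [Fintype Ω] [DecidableEq V] (f : Ω → V) (v : V) : ℝ :=
  uniformAvg fun u => if f u = v then 1 else 0

theorem samplerLaw_nonneg {Ω V : Type*} [Fintype Ω] [DecidableEq V] (f : Ω → V) (v : V) :
    0 ≤ samplerLaw f v :=
  div_nonneg (Finset.sum_nonneg fun _ _ => by split_ifs <;> simp) (Nat.cast_nonneg _)

theorem sum_samplerLaw {Ω V : Type*} [Fintype Ω] [Nonempty Ω] [Fintype V] [DecidableEq V]
    (f : Ω → V) : ∑ v, samplerLaw f v = 1 := by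
  unfold samplerLaw uniformAvg
  rw [← Finset.sum_div, Finset.sum_comm]
  have : (Fintype.card Ω : ℝ) ≠ 0 := by exact_mod_cast Fintype.card_ne_zero
  simp [this]

end Uniform

section Reduction

variable {nin nm na nc nz k r m : ℕ} (A : QOracleAlg nin (nin + nm + na) nc (nm + (na + nz)))
  (M : Fin r → Fin (k + 1) × Fin (nin + nm + na + 1) → ZMod 2)
  (circ : QCircuit (Fin r ⊕ Fin nc ⊕ Fin m)) (f : Bits r → Bits nc) (x : Bits nin)

/-- The position of an output bit of an oracle algorithm. -/
abbrev outPos {nin nq ny nout work : ℕ} (i : Fin nout) : OracleReg nin nq ny nout work :=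
  .inr (.inr (.inr (.inl i)))

/-- The positions of the response in the output of a forger. -/
def responsePos {nq ny work : ℕ} (i : Fin nz) : OracleReg nin nq ny (nm + (na + nz)) work :=
  outPos (Fin.natAdd nm (Fin.natAdd na i))

/-- The positions of the query point in the registers of a forger after its last round: the public
key is found in the input register. -/
def pointPos {nq ny work : ℕ} : Fin (nin + nm + na) → OracleReg nin nq ny (nm + (na + nz)) work :=
  Fin.append (Fin.append .inl fun i => outPos (Fin.castAdd _ i))
    fun i => outPos (Fin.natAdd nm (Fin.castAdd nz i))

/-- The query point that the validity of the output of a forger with public key `x` depends on. -/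
def outPoint {nq ny work : ℕ} (x : Bits nin)
    (b : OracleReg nin nq ny (nm + (na + nz)) work → Bool) : Bits (nin + nm + na) :=
  Fin.append (Fin.append x fun i => b (outPos (Fin.castAdd _ i)))
    fun i => b (outPos (Fin.natAdd nm (Fin.castAdd nz i)))

theorem firstMessage_outPoint {nq ny work : ℕ} (x : Bits nin)
    (b : OracleReg nin nq ny (nm + (na + nz)) work → Bool) :
    firstMessage (n₀ := nin + nm) (outPoint x b) = firstMessage (n₀ := nin + nm) (b ∘ pointPos) := by
  funext i
  simp [firstMessage, outPoint, pointPos]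

/-- The dishonest provers obtained from a forger. For `none`, the forger is run to its end and the
query point is read off from its output. For `some (i, s)`, the query number `i` is measured; it is
answered by the reprogrammed hash function if `s` is true. -/
noncomputable def reprogramProver (j : Option (Fin A.rounds.length × Bool)) :
    SigmaAdversary na nc nz :=
  match j with
  | none => forgerProver (n₀ := nin + nm) A M circ A.rounds [] pointPos responsePos x
  | some (i, s) => forgerProver (n₀ := nin + nm) A M circ (A.rounds.take i)
      ((s, A.rounds.get i) :: (A.rounds.drop (i + 1)).map fun c => (true, c))
      (fun k => .inr (.inl k)) responsePos x

open Classical in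
/-- Measure and reprogram: the success probability of a forger whose oracle is reprogrammed, at the
query point of its output, to the challenge `c`, is bounded by the success probabilities of the
dishonest provers with challenge `c`. -/
theorem sum_reprogrammed_le (hf : ComputesInto circ f) (c : Bits nc)
    (P : Bits na → Bits nz → Prop) :
    (∑ b, if P (firstMessage (n₀ := nin + nm) (outPoint x b)) (b ∘ responsePos) then
        ‖runRounds (Function.update (fun q => f (linearHash (k + 1) M q)) (outPoint x b) c) A.rounds
          (A.first.toOp *ᵥ A.start x) b‖ ^ 2 else 0) ≤
      (2 * A.rounds.length + 1) * ∑ j, ∑ a, measureProb (fun i => .inl (.inr i))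
        ((reprogramProver A M circ x j).state₂ a c) (P a) := by
  set h : Bits (nin + nm + na) → Bits nc := fun q => f (linearHash (k + 1) M q) with hh
  set ψ := A.first.toOp *ᵥ A.start x with hψ
  let p : Bits (nin + nm + na) →
      (OracleReg nin (nin + nm + na) nc (nm + (na + nz)) A.work → Bool) → Prop := fun y b =>
    outPoint x b = y ∧ P (firstMessage (n₀ := nin + nm) (outPoint x b)) (b ∘ responsePos)
  have hpoint : ∀ φ : Bits (nin + nm + na) →
      QState (OracleReg nin (nin + nm + na) nc (nm + (na + nz)) A.work),
      (∑ b, if P (firstMessage (n₀ := nin + nm) (outPoint x b)) (b ∘ responsePos) then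
        ‖φ (outPoint x b) b‖ ^ 2 else 0) = ∑ y, sqNorm (restrictTo (p y) (φ y)) := by
    intro φ
    simp only [sqNorm_restrictTo]
    rw [Finset.sum_comm]
    refine Finset.sum_congr rfl fun b _ => ?_
    rw [Finset.sum_eq_single (outPoint x b)]
    · simp [p]
    · intro y _ hy
      exact if_neg fun h => hy h.1.symm
    · simp
  rw [hpoint fun y => runRounds (Function.update h y c) A.rounds ψ]
  refine (Finset.sum_le_sum fun y _ => sqNorm_restrictTo_runRounds_le h (Function.update h y c) y
    (fun u hu => Function.update_of_ne hu _ _) A.rounds ψ (p y)).trans ?_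
  rw [← Finset.mul_sum, Finset.sum_add_distrib, Fintype.sum_option, Fintype.sum_prod_type]
  refine mul_le_mul_of_nonneg_left (add_le_add ?_ ?_) (by positivity)
  · rw [← hpoint fun _ => runRounds h A.rounds ψ]
    refine le_of_eq ?_
    have := forgerProver_measureProb (n₀ := nin + nm) A M circ f A.rounds [] pointPos responsePos x hf c P
    refine Eq.trans ?_ this.symm
    rw [Finset.sum_comm]
    refine Finset.sum_congr rfl fun b _ => ?_
    rw [Finset.sum_eq_single (b ∘ pointPos)]
    · rw [firstMessage_outPoint]
      have : restrictTo (fun b' => b' ∘ pointPos = b ∘ pointPos) (runRounds h A.rounds ψ) b =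
          runRounds h A.rounds ψ b := if_pos rfl
      simp only [runMixed, List.foldl_nil]
      rw [this]
    · intro y _ hy
      have : restrictTo (fun b' => b' ∘ pointPos = y) (runRounds h A.rounds ψ) b = 0 :=
        if_neg hy.symm
      simp only [runMixed, List.foldl_nil]
      rw [this]
      simp
    · simp
  · rw [Finset.sum_comm]
    refine Finset.sum_le_sum fun i _ => ?_
    rw [Finset.sum_comm]
    refine Finset.sum_le_sum fun s _ => ?_
    have := forgerProver_measureProb (n₀ := nin + nm) A M circ f (A.rounds.take i)
      ((s, A.rounds.get i) :: (A.rounds.drop (i + 1)).map fun c => (true, c))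
      (fun k => .inr (.inl k)) responsePos x hf c P
    refine le_of_le_of_eq ?_ this.symm
    refine Finset.sum_le_sum fun y _ => ?_
    rw [sqNorm_restrictTo]
    refine Finset.sum_le_sum fun b _ => ?_
    have hrun : runFrom (if s then Function.update h y c else h) (Function.update h y c) A.rounds i
        (restrictTo (fun b => queryPart b = y) (stateBefore h A.rounds ψ i)) =
        runMixed (fun s => if s then Function.update h y c else h)
          ((s, A.rounds.get i) :: (A.rounds.drop (i + 1)).map fun c => (true, c))
          (restrictTo (fun b => (b ∘ fun k => .inr (.inl k)) = y)
            (runRounds h (A.rounds.take i) ψ)) := by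
      refine Eq.trans ?_ (runMixed_map (fun s => if s then Function.update h y c else h) true _ _).symm
      rfl
    rw [hrun]
    by_cases hb : p y b
    · have hb' : P (firstMessage (n₀ := nin + nm) y) (b ∘ responsePos) := hb.1 ▸ hb.2
      rw [if_pos hb, if_pos hb']
    · rw [if_neg hb]
      split_ifs
      · positivity
      · exact le_rfl

end Reduction

section Advantage

variable {nin nm na nc nz r m : ℕ} (A : QOracleAlg nin (nin + nm + na) nc (nm + (na + nz)))
  (circ : QCircuit (Fin r ⊕ Fin nc ⊕ Fin m)) (f : Bits r → Bits nc)
  (chal : Finset (Bits nc)) (x : Bits nin)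

open Classical in
theorem sum_uniformLaw_reprogrammed_le {k : ℕ}
    (M : Fin r → Fin (k + 1) × Fin (nin + nm + na + 1) → ZMod 2) (hf : ComputesInto circ f)
    (V : Bits na → Bits nc → Bits nz → Prop) :
    ∑ c, uniformLaw chal c * ∑ b,
      (if V (firstMessage (n₀ := nin + nm) (outPoint x b)) c (b ∘ responsePos) then
        ‖runRounds (Function.update (fun q => f (linearHash (k + 1) M q)) (outPoint x b) c) A.rounds
          (A.first.toOp *ᵥ A.start x) b‖ ^ 2 else 0) ≤
      (2 * A.rounds.length + 1) * ∑ j, uniformAvg fun c : {c // c ∈ chal} =>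
        ∑ a, measureProb (fun i => .inl (.inr i)) ((reprogramProver A M circ x j).state₂ a c)
          fun z => V a c z := by
  have h := sum_uniformLaw_mul_sum chal (2 * A.rounds.length + 1) fun j c =>
    ∑ a, measureProb (fun i => .inl (.inr i)) ((reprogramProver A M circ x j).state₂ a c)
      fun z => V a c z
  rw [← h]
  exact Finset.sum_le_sum fun c _ => mul_le_mul_of_nonneg_left
    (sum_reprogrammed_le A M circ f x hf c fun a z => V a c z) (uniformLaw_nonneg _ _)

open Classical in
/-- The success probability of a forger against a random oracle is bounded by the acceptance
probabilities of the dishonest provers, averaged over the hash functions. -/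
theorem forger_success_le (hf : ComputesInto circ f) (hchal : chal.Nonempty)
    (V : Bits na → Bits nc → Bits nz → Prop) :
    uniformAvg (fun H : Bits (nin + nm + na) → {c // c ∈ chal} =>
      ∑ b, if V (firstMessage (n₀ := nin + nm) (outPoint x b)) (H (outPoint x b)) (b ∘ responsePos)
        then ‖A.final (fun q => H q) x b‖ ^ 2 else 0) ≤
      4 * (2 * A.queries + 1) * uniformAvg (fun M : Fin r → Fin (2 * A.queries + 1) ×
        Fin (nin + nm + na + 1) → ZMod 2 => ∑ j, uniformAvg fun c : {c // c ∈ chal} =>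
          ∑ a, measureProb (fun i => .inl (.inr i)) ((reprogramProver A M circ x j).state₂ a c)
            fun z => V a c z) +
      (1 + 12 * (A.queries : ℝ) ^ 2) * ∑ v, |samplerLaw f v - uniformLaw chal v| := by
  set ψ := A.first.toOp *ᵥ A.start x with hψ
  have hψ1 : sqNorm ψ = 1 := by rw [hψ, QCircuit.sqNorm_mulVec, A.sqNorm_start]
  let Ψ : (Bits (nin + nm + na) → Bits nc) → ℝ := fun H => ∑ c, uniformLaw chal c * ∑ b,
    if V (firstMessage (n₀ := nin + nm) (outPoint x b)) c (b ∘ responsePos) then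
      ‖runRounds (Function.update H (outPoint x b) c) A.rounds ψ b‖ ^ 2 else 0
  have h1 := uniformAvg_eq_prodExp chal fun H : Bits (nin + nm + na) → Bits nc =>
    ∑ b, if V (firstMessage (n₀ := nin + nm) (outPoint x b)) (H (outPoint x b)) (b ∘ responsePos)
        then ‖A.final H x b‖ ^ 2 else 0
  have h2 := prodExp_success_le A.rounds ψ hψ1 (outPoint x)
    (fun b c => V (firstMessage (n₀ := nin + nm) (outPoint x b)) c (b ∘ responsePos))
    (samplerLaw f) (uniformLaw chal) (samplerLaw_nonneg f) (uniformLaw_nonneg chal)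
    (sum_samplerLaw f) (sum_uniformLaw chal hchal)
  have hdeg : (fun H => ((Ψ H : ℝ) : ℂ)) ∈
      degreeLE (Bits (nin + nm + na)) (Bits nc) (2 * A.rounds.length) := by
    have : (fun H => ((Ψ H : ℝ) : ℂ)) = ∑ c, ((uniformLaw chal c : ℝ) : ℂ) • ∑ b,
        if V (firstMessage (n₀ := nin + nm) (outPoint x b)) c (b ∘ responsePos) then
          (fun H => ((‖runRounds (Function.update H (outPoint x b) c) A.rounds ψ b‖ ^ 2 : ℝ) : ℂ))
        else 0 := by
      funext H
      simp only [Ψ, Complex.ofReal_sum, Complex.ofReal_mul, Finset.sum_apply, Pi.smul_apply,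
        smul_eq_mul]
      refine Finset.sum_congr rfl fun c _ => congrArg _ (Finset.sum_congr rfl fun b _ => ?_)
      split_ifs <;> simp
    rw [this]
    refine Submodule.sum_mem _ fun c _ => Submodule.smul_mem _ _ (Submodule.sum_mem _ fun b _ => ?_)
    split_ifs
    · exact norm_sq_runRounds_mem_degreeLE A.rounds ψ _ _ _
    · exact Submodule.zero_mem _
  -- By the bound on the degree, `2 q`-wise independence of the hash function suffices.
  have h3 : prodExp (samplerLaw f) Ψ = uniformAvg fun M : Fin r → Fin (2 * A.queries + 1) ×
        Fin (nin + nm + na + 1) → ZMod 2 => Ψ fun q => f (linearHash (2 * A.queries + 1) M q) := by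
    have := sum_mul_eq_of_mem_degreeLE
      (fun H : Bits (nin + nm + na) → Bits nc => ∏ u, samplerLaw f (H u)) (fun H => H)
      (fun _ : Fin r → Fin (2 * A.queries + 1) × Fin (nin + nm + na + 1) → ZMod 2 =>
        ((Fintype.card (Fin r → Fin (2 * A.queries + 1) × Fin (nin + nm + na + 1) → ZMod 2) : ℝ))⁻¹)
      (fun M q => f (linearHash (2 * A.queries + 1) M q)) (2 * A.rounds.length) ?_ hdeg
    · rw [prodExp, this, uniformAvg, ← Finset.mul_sum, div_eq_inv_mul]
    · intro T hT g
      refine (prodExp_indicator (sum_samplerLaw f) T g).trans ?_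
      rw [← Finset.mul_sum, ← div_eq_inv_mul]
      exact (linearHash_independent (2 * A.queries + 1) f T (hT.trans (Nat.le_succ _)) g).symm
  have h4 : ∀ M : Fin r → Fin (2 * A.queries + 1) × Fin (nin + nm + na + 1) → ZMod 2,
      Ψ (fun q => f (linearHash (2 * A.queries + 1) M q)) ≤ (2 * A.queries + 1) *
        ∑ j, uniformAvg fun c : {c // c ∈ chal} =>
          ∑ a, measureProb (fun i => .inl (.inr i)) ((reprogramProver A M circ x j).state₂ a c)
            fun z => V a c z := fun M =>
    sum_uniformLaw_reprogrammed_le A circ f chal x M hf V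
  have h5 := uniformAvg_mono h4
  rw [uniformAvg_const_mul, ← h3] at h5
  rw [h1]
  refine h2.trans ?_
  have hq : (A.rounds.length : ℝ) = A.queries := rfl
  rw [hq]
  have h6 : prodExp (samplerLaw f) Ψ = prodExp (samplerLaw f) fun H => ∑ c, uniformLaw chal c * ∑ b,
    if V (firstMessage (n₀ := nin + nm) (outPoint x b)) c (b ∘ responsePos) then
      ‖runRounds (Function.update H (outPoint x b) c) A.rounds ψ b‖ ^ 2 else 0 := rfl
  rw [← h6]
  linarith

end Advantage

/-! ### The best dishonest prover and its size -/

section Best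

/-- Averaging: a bound by an average over `M` of sums over `j`, for weights `wt`, yields a bound by
the best choice of `M` and `j`, which does not depend on `x`. -/
theorem exists_sum_le_of_uniformAvg {X I J : Type*} [Fintype X] [Fintype I] [Nonempty I] [Fintype J]
    [Nonempty J] (wt : X → ℝ) (hwt : ∀ x, 0 ≤ wt x) (hsum : ∑ x, wt x = 1) (K D : ℝ) (hK : 0 ≤ K)
    (s : X → ℝ) (F : I → J → X → ℝ)
    (h : ∀ x, s x ≤ K * (uniformAvg fun M => ∑ j, F M j x) + D) :
    ∃ M j, ∑ x, wt x * s x ≤ K * Fintype.card J * (∑ x, wt x * F M j x) + D := by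
  have h1 : ∑ x, wt x * s x ≤
      K * (uniformAvg fun M => ∑ j, ∑ x, wt x * F M j x) + D := by
    refine (Finset.sum_le_sum fun x _ => mul_le_mul_of_nonneg_left (h x) (hwt x)).trans
      (le_of_eq ?_)
    simp only [mul_add, Finset.sum_add_distrib, ← Finset.sum_mul, hsum, one_mul]
    congr 1
    simp only [uniformAvg, mul_left_comm (wt _), ← Finset.mul_sum]
    congr 1
    simp only [← mul_div_assoc, ← Finset.sum_div, Finset.mul_sum]
    congr 1
    rw [Finset.sum_comm]
    exact Finset.sum_congr rfl fun M _ => Finset.sum_comm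
  obtain ⟨M, hM⟩ := exists_uniformAvg_le fun M => ∑ j, ∑ x, wt x * F M j x
  obtain ⟨j, _, hj⟩ := Finset.exists_max_image Finset.univ (fun j => ∑ x, wt x * F M j x)
    Finset.univ_nonempty
  refine ⟨M, j, h1.trans ?_⟩
  have h2 : ∑ j, ∑ x, wt x * F M j x ≤ Fintype.card J * ∑ x, wt x * F M j x := by
    refine (Finset.sum_le_card_nsmul Finset.univ _ _ fun b _ => hj b (Finset.mem_univ b)).trans ?_
    rw [nsmul_eq_mul, Finset.card_univ]
  rw [mul_assoc]
  have := mul_le_mul_of_nonneg_left (hM.trans h2) hK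
  linarith

end Best

section Size

variable {nin nm na nc nz n₀ n nout work k r m : ℕ}

theorem cost_flatMap {α ι : Type} (F : α → QCircuit ι) (l : List α) :
    QCircuit.cost (l.flatMap F) = (l.map fun a => (F a).cost).sum := by
  induction l with
  | nil => rfl
  | cons a l ih => rw [List.flatMap_cons, QCircuit.cost_append, ih]; rfl

theorem cost_plainQuery_le (M : Fin r → Fin (k + 1) × Fin (n + 1) → ZMod 2)
    (circ : QCircuit (Fin r ⊕ Fin nc ⊕ Fin m)) :
    (plainQuery (nin := nin) (nout := nout) (work := work) M circ).cost ≤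
      2 * (computeCirc M circ).cost + nc * 9 := by
  have := cost_mcxLayer_le (ι := SimSys nin n nc nout work k r m) (Finset.univ : Finset (Fin nc))
    (fun j => .inl (ansPos j)) (fun j => {.inr (valPos j)}) (by simp) 1 (by simp)
  rw [Finset.card_univ, Fintype.card_fin] at this
  unfold plainQuery
  rw [QCircuit.cost_append, QCircuit.cost_append, QCircuit.cost_inverse, QCircuit.cost_rename]
  omega

theorem cost_markedQuery_le (M : Fin r → Fin (k + 1) × Fin (n + 1) → ZMod 2)
    (circ : QCircuit (Fin r ⊕ Fin nc ⊕ Fin m)) :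
    (markedQuery (nin := nin) (nout := nout) (work := work) M circ).cost ≤
      2 * (computeCirc M circ).cost + nc * 9 := by
  unfold markedQuery
  rw [QCircuit.cost_append, QCircuit.cost_append, QCircuit.cost_inverse, QCircuit.cost_rename]
  refine (Nat.add_le_add_right (Nat.add_le_add_left (cost_mcxLayer_le _ _ _ _ 2 ?_) _) _).trans ?_
  · rintro ⟨a, _ | _ | _⟩
    · simp
    · exact Finset.card_le_two
    · exact Finset.card_le_two
  · rw [Finset.card_univ, Fintype.card_prod, Fintype.card_fin, Fintype.card_option,
      Fintype.card_bool]
    omega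

theorem cost_stage₁Circ_le (M : Fin r → Fin (k + 1) × Fin (n₀ + na + 1) → ZMod 2)
    (circ : QCircuit (Fin r ⊕ Fin nc ⊕ Fin m))
    (first : QCircuit (OracleReg nin (n₀ + na) nc nout work))
    (pre : List (QCircuit (OracleReg nin (n₀ + na) nc nout work)))
    (pos : Fin (n₀ + na) → OracleReg nin (n₀ + na) nc nout work) :
    (stage₁Circ M circ first pre pos).cost ≤ first.cost + (pre.map QCircuit.cost).sum +
      pre.length * (2 * (computeCirc M circ).cost + nc * 9) + (n₀ + na + na) * 2 := by
  unfold stage₁Circ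
  have h1 := cost_mcxLayer_le (ι := Stage₁Reg na nin (n₀ + na) nc nout work k r m)
    (Finset.univ : Finset (Fin (n₀ + na) ⊕ Fin na))
    (Sum.elim (fun i => .inr (.inr (.inl i))) .inl)
    (Sum.elim (fun i => {.inr (.inl (pos i))}) fun i => {.inr (.inl (pos (Fin.natAdd n₀ i)))})
    (by rintro (i | i) <;> simp) 1 (by rintro (i | i) <;> simp)
  rw [Finset.card_univ, Fintype.card_sum, Fintype.card_fin, Fintype.card_fin] at h1
  have h2 : (pre.map fun c => (plainQuery (nin := nin) (nout := nout) (work := work) M circ).cost +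
      c.cost).sum ≤ (pre.map QCircuit.cost).sum +
        pre.length * (2 * (computeCirc M circ).cost + nc * 9) := by
    have hq := cost_plainQuery_le (nin := nin) (nout := nout) (work := work) M circ
    induction pre with
    | nil => simp
    | cons c pre ih =>
      simp only [List.map_cons, List.sum_cons, List.length_cons, Nat.add_mul]
      omega
  rw [QCircuit.cost_append, QCircuit.cost_append, QCircuit.cost_rename, cost_flatMap,
    List.map_map]
  simp only [Function.comp_def, QCircuit.cost_append, QCircuit.cost_rename]
  omega

theorem cost_stage₂Circ_le (M : Fin r → Fin (k + 1) × Fin (n₀ + na + 1) → ZMod 2)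
    (circ : QCircuit (Fin r ⊕ Fin nc ⊕ Fin m))
    (post : List (Bool × QCircuit (OracleReg nin (n₀ + na) nc nout work)))
    (zpos : Fin nz → OracleReg nin (n₀ + na) nc nout work) :
    (stage₂Circ M circ post zpos).cost ≤ (post.map fun p => p.2.cost).sum +
      post.length * (2 * (computeCirc M circ).cost + nc * 9) + nz * 2 := by
  unfold stage₂Circ
  have h1 := cost_mcxLayer_le (ι := Stage₂Reg nz nin (n₀ + na) nc nout work k r m)
    (Finset.univ : Finset (Fin nz)) (fun i => .inl (.inr i)) (fun i => {.inr (.inl (zpos i))})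
    (by simp) 1 (by simp)
  rw [Finset.card_univ, Fintype.card_fin] at h1
  have h2 : (post.map fun p => QCircuit.cost
      (if p.1 then QCircuit.rename (markedEmb (nz := nz)) (markedQuery M circ)
        else QCircuit.rename .inr (plainQuery (nin := nin) (nout := nout) (work := work) M circ)) +
      p.2.cost).sum ≤ (post.map fun p => p.2.cost).sum +
        post.length * (2 * (computeCirc M circ).cost + nc * 9) := by
    have hq := cost_plainQuery_le (nin := nin) (nout := nout) (work := work) M circ
    have hq' := cost_markedQuery_le (nin := nin) (nout := nout) (work := work) M circ
    induction post with
    | nil => simp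
    | cons p post ih =>
      simp only [List.map_cons, List.sum_cons, List.length_cons, Nat.add_mul]
      have : QCircuit.cost
          (if p.1 then QCircuit.rename (markedEmb (nz := nz)) (markedQuery M circ)
          else QCircuit.rename .inr (plainQuery (nin := nin) (nout := nout) (work := work) M circ)) ≤
          2 * (computeCirc M circ).cost + nc * 9 := by
        split_ifs
        · rwa [QCircuit.cost_rename]
        · rwa [QCircuit.cost_rename]
      omega
  rw [QCircuit.cost_append, cost_flatMap]
  simp only [QCircuit.cost_append, QCircuit.cost_rename]
  omega

/-- A bound, in terms of the lengths of the registers and the size `s` of the forger and the cost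
`c` of the sampling circuit, for the size of the dishonest provers. -/
def proverBound (nin nm na nc nz r m s c : ℕ) : ℕ :=
  (nin + (nin + nm + na) + nc + (nm + (na + nz)) + s + (nin + nm + na) + (nin + nm + na) + 1 +
      (2 * s + 1) * (nin + nm + na + 1) + (r + nc + m)) +
    (2 * s + 2 * s * (2 * (6 * (nin + nm + na) + (1 + (nin + nm + na)) + (nin + nm + na + 1) +
      2 * s * ((nin + nm + na + 1) * ((nin + nm + na) * (nin + nm + na + 1)) * 3) +
      r * ((2 * s + 1) * (nin + nm + na + 1)) * 2 + c) + nc * 9) +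
      (nin + nm + na + na) * 2 + nz * 2)

theorem sum_map_sublist_le {α : Type*} (F : α → ℕ) {l l' : List α} (h : l.Sublist l') :
    (l.map F).sum ≤ (l'.map F).sum :=
  (h.map F).sum_le_sum fun _ _ => Nat.zero_le _

theorem size_reprogramProver_le (A : QOracleAlg nin (nin + nm + na) nc (nm + (na + nz)))
    (M : Fin r → Fin (2 * A.queries + 1) × Fin (nin + nm + na + 1) → ZMod 2)
    (circ : QCircuit (Fin r ⊕ Fin nc ⊕ Fin m)) (x : Bits nin)
    (j : Option (Fin A.rounds.length × Bool)) :
    (reprogramProver A M circ x j).size ≤ proverBound nin nm na nc nz r m A.size circ.cost := by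
  have key : ∀ (pre : List (QCircuit (OracleReg nin (nin + nm + na) nc (nm + (na + nz)) A.work)))
      (post : List (Bool × QCircuit (OracleReg nin (nin + nm + na) nc (nm + (na + nz)) A.work)))
      (pos : Fin (nin + nm + na) → OracleReg nin (nin + nm + na) nc (nm + (na + nz)) A.work)
      (zpos : Fin nz → OracleReg nin (nin + nm + na) nc (nm + (na + nz)) A.work),
      (pre.map QCircuit.cost).sum ≤ (A.rounds.map QCircuit.cost).sum →
      (post.map fun p => p.2.cost).sum ≤ (A.rounds.map QCircuit.cost).sum →
      pre.length ≤ A.queries → post.length ≤ A.queries →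
      (forgerProver (n₀ := nin + nm) A M circ pre post pos zpos x).size ≤
        proverBound nin nm na nc nz r m A.size circ.cost := by
    intro pre post pos zpos h1 h2 h3 h4
    have hs : A.work + A.queries + A.first.cost + (A.rounds.map QCircuit.cost).sum = A.size := rfl
    have c1 := cost_stage₁Circ_le (n₀ := nin + nm) M circ A.first pre pos
    have c2 := cost_stage₂Circ_le (n₀ := nin + nm) M circ post zpos
    have c3 := cost_computeCirc_le (n := nin + nm + na) M circ
    have hq : A.queries ≤ A.size := by omega
    set C := (computeCirc (n := nin + nm + na) M circ).cost with hC
    have c4 : C ≤ (6 * (nin + nm + na) + (1 + (nin + nm + na)) + (nin + nm + na + 1) +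
      2 * A.size * ((nin + nm + na + 1) * ((nin + nm + na) * (nin + nm + na + 1)) * 3) +
      r * ((2 * A.size + 1) * (nin + nm + na + 1)) * 2 + circ.cost) :=
      c3.trans (by gcongr)
    have hsz : (forgerProver (n₀ := nin + nm) A M circ pre post pos zpos x).size =
        Fintype.card (SimSys nin (nin + nm + na) nc (nm + (na + nz)) A.work (2 * A.queries) r m) +
        (stage₁Circ M circ A.first pre pos).cost + (stage₂Circ M circ post zpos).cost := by
      simp only [SigmaAdversary.size, forgerProver, QCircuit.cost_rename]
    have hcard : Fintype.card (SimSys nin (nin + nm + na) nc (nm + (na + nz)) A.work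
        (2 * A.queries) r m) ≤ nin + (nin + nm + na) + nc + (nm + (na + nz)) + A.size +
        (nin + nm + na) + (nin + nm + na) + 1 +
        (2 * A.size + 1) * (nin + nm + na + 1) + (r + nc + m) := by
      simp only [Fintype.card_sum, Fintype.card_fin, Fintype.card_prod, Fintype.card_unit]
      have : (2 * A.queries + 1) * (nin + nm + na + 1) ≤ (2 * A.size + 1) * (nin + nm + na + 1) := by
        gcongr
      omega
    have c5 : pre.length * (2 * C + nc * 9) ≤ A.size * (2 * (6 * (nin + nm + na) +
      (1 + (nin + nm + na)) + (nin + nm + na + 1) +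
      2 * A.size * ((nin + nm + na + 1) * ((nin + nm + na) * (nin + nm + na + 1)) * 3) +
      r * ((2 * A.size + 1) * (nin + nm + na + 1)) * 2 + circ.cost) + nc * 9) :=
      Nat.mul_le_mul (h3.trans hq) (by omega)
    have c6 : post.length * (2 * C + nc * 9) ≤ A.size * (2 * (6 * (nin + nm + na) +
      (1 + (nin + nm + na)) + (nin + nm + na + 1) +
      2 * A.size * ((nin + nm + na + 1) * ((nin + nm + na) * (nin + nm + na + 1)) * 3) +
      r * ((2 * A.size + 1) * (nin + nm + na + 1)) * 2 + circ.cost) + nc * 9) :=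
      Nat.mul_le_mul (h4.trans hq) (by omega)
    rw [hsz]
    unfold proverBound
    rw [Nat.mul_assoc 2 A.size]
    generalize A.size * (2 * (_ : ℕ) + _) = Z at c5 c6 ⊢
    omega
  rcases j with _ | ⟨i, s⟩
  · exact key _ _ _ _ le_rfl (by simp) le_rfl (by simp)
  · refine key _ _ _ _ (sum_map_sublist_le _ (List.take_sublist _ _)) ?_ ?_ ?_
    · simp only [List.map_cons, List.map_map, Function.comp_def, List.sum_cons]
      have : A.rounds.drop i = A.rounds.get i :: A.rounds.drop (i + 1) := by simp
      have h := sum_map_sublist_le QCircuit.cost (List.drop_sublist i A.rounds)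
      rw [this, List.map_cons, List.sum_cons] at h
      exact h
    · rw [List.length_take]; exact min_le_right _ _
    · have := i.2
      simp only [List.length_cons, List.length_map, List.length_drop]
      unfold QOracleAlg.queries
      omega

theorem PolyBounded.const (c : ℕ) : PolyBounded fun _ => c :=
  ⟨Polynomial.C c, fun η => by simp⟩

theorem PolyBounded.mul {f g : ℕ → ℕ} (hf : PolyBounded f) (hg : PolyBounded g) :
    PolyBounded fun η => f η * g η := by
  obtain ⟨p, hp⟩ := hf
  obtain ⟨q, hq⟩ := hg
  exact ⟨p * q, fun η => by rw [Polynomial.eval_mul]; exact Nat.mul_le_mul (hp η) (hq η)⟩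

theorem PolyBounded.mono {f g : ℕ → ℕ} (hg : PolyBounded g) (h : ∀ η, f η ≤ g η) :
    PolyBounded f := by
  obtain ⟨p, hp⟩ := hg
  exact ⟨p, fun η => (h η).trans (hp η)⟩

theorem PolyBounded.proverBound {nin nm na nc nz r m s c : ℕ → ℕ} (h1 : PolyBounded nin)
    (h2 : PolyBounded nm) (h3 : PolyBounded na) (h4 : PolyBounded nc) (h5 : PolyBounded nz)
    (h6 : PolyBounded r) (h7 : PolyBounded m) (h8 : PolyBounded s) (h9 : PolyBounded c) :
    PolyBounded fun η => proverBound (nin η) (nm η) (na η) (nc η) (nz η) (r η) (m η) (s η) (c η) := by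
  unfold _root_.proverBound
  repeat' first | assumption | apply PolyBounded.const | apply PolyBounded.add |
    apply PolyBounded.mul

end Size

/-! ### Running an extractor on a prover given by circuits -/

section Compile

variable {nx nw m na nc nz N : ℕ}

/-- The joint system of an extractor and a prover with `N` private qubits. -/
abbrev JointReg (nx nw m na nc nz N : ℕ) : Type := (OwnReg nx nw m ⊕ MsgReg na nc nz) ⊕ Fin N

/-- The positions that the first stage of the prover acts on. -/
def callEmb₁ : (Fin na ⊕ Fin N) ↪ JointReg nx nw m na nc nz N where
  toFun := Sum.map (fun i => .inr (.inl i)) id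
  inj' := by rintro (i | i) (j | j) h <;> simp_all

/-- The positions that the second stage of the prover acts on. -/
def callEmb₂ : ((Fin nc ⊕ Fin nz) ⊕ Fin N) ↪ JointReg nx nw m na nc nz N where
  toFun := Sum.map (fun i => .inr (.inr i)) id
  inj' := by rintro (i | i) (j | j) h <;> simp_all

/-- A circuit for a call of the unitary of the circuit `C` or of its inverse, possibly
controlled. -/
def callCirc {ι own : Type} [DecidableEq ι] (C : QCircuit ι) (pos : own → ι) (inv : Bool)
    (ctrl : Option own) : QCircuit ι :=
  let C' := if inv then QCircuit.inverse C else C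
  match ctrl with
  | none => C'
  | some t => QCircuit.control (pos t) C'

theorem toOp_callCirc {ι own : Type} [DecidableEq ι] [Fintype ι] (C : QCircuit ι) (pos : own → ι)
    (h : ∀ g ∈ C, ∀ t, g.target ≠ pos t) (inv : Bool) (ctrl : Option own) :
    (callCirc C pos inv ctrl).toOp = BBInstr.callOp C.toOp pos inv ctrl := by
  have h1 : (if inv then QCircuit.inverse C else C).toOp = if inv then (C.toOp)ᴴ else C.toOp := by
    split_ifs
    · exact QCircuit.toOp_inverse C
    · rfl
  rcases ctrl with _ | t
  · exact h1
  · unfold callCirc BBInstr.callOp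
    dsimp only
    rw [QCircuit.toOp_control, h1]
    intro g hg
    split_ifs at hg
    · obtain ⟨g', hg', rfl⟩ := List.mem_map.1 (List.mem_reverse.1 hg)
      exact h g' hg' t
    · exact h g hg t

theorem cost_callCirc_le {ι own : Type} [DecidableEq ι] (C : QCircuit ι) (pos : own → ι)
    (inv : Bool) (ctrl : Option own) : (callCirc C pos inv ctrl).cost ≤ 2 * C.cost := by
  have h1 : (if inv then QCircuit.inverse C else C).cost = C.cost := by
    split_ifs
    · exact QCircuit.cost_inverse C
    · rfl
  rcases ctrl with _ | t
  · change (if inv then QCircuit.inverse C else C).cost ≤ _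
    omega
  · refine (QCircuit.cost_control_le (pos t) (if inv then QCircuit.inverse C else C)).trans ?_
    rw [h1]

variable (U₁ : QCircuit (Fin na ⊕ Fin N)) (U₂ : QCircuit ((Fin nc ⊕ Fin nz) ⊕ Fin N))

/-- The circuit of an instruction of an extractor, run on a prover with circuits `U₁` and `U₂`. -/
def BBInstr.compile : BBInstr nx nw m na nc nz → QCircuit (JointReg nx nw m na nc nz N)
  | .gate g => [g.rename .inl]
  | .call₁ inv ctrl => callCirc (QCircuit.rename callEmb₁ U₁) (fun t => .inl (.inl t)) inv ctrl
  | .call₂ inv ctrl => callCirc (QCircuit.rename callEmb₂ U₂) (fun t => .inl (.inl t)) inv ctrl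

theorem BBInstr.toOp_compile (t : BBInstr nx nw m na nc nz) :
    (t.compile U₁ U₂).toOp = t.toOp U₁.toOp U₂.toOp := by
  rcases t with g | ⟨inv, ctrl⟩ | ⟨inv, ctrl⟩
  · change 1 * (g.rename .inl).toOp = _
    rw [one_mul, QGate.toOp_rename]
    rfl
  · refine (toOp_callCirc _ _ ?_ inv ctrl).trans ?_
    · intro g hg t
      obtain ⟨g', _, rfl⟩ := List.mem_map.1 hg
      change callEmb₁ g'.target ≠ _
      rcases g'.target with i | i
      · exact fun h => Sum.inr_ne_inl (Sum.inl_injective h)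
      · exact Sum.inr_ne_inl
    · rw [QCircuit.toOp_rename]
      rfl
  · refine (toOp_callCirc _ _ ?_ inv ctrl).trans ?_
    · intro g hg t
      obtain ⟨g', _, rfl⟩ := List.mem_map.1 hg
      change callEmb₂ g'.target ≠ _
      rcases g'.target with i | i
      · exact fun h => Sum.inr_ne_inl (Sum.inl_injective h)
      · exact Sum.inr_ne_inl
    · rw [QCircuit.toOp_rename]
      rfl

theorem BBInstr.cost_compile_le (t : BBInstr nx nw m na nc nz) :
    (t.compile U₁ U₂).cost ≤ t.cost * (1 + 2 * (U₁.cost + U₂.cost)) := by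
  rcases t with g | ⟨inv, ctrl⟩ | ⟨inv, ctrl⟩
  · have : (BBInstr.compile U₁ U₂ (nx := nx) (nw := nw) (m := m) (.gate g)).cost = g.cost := by
      simp [BBInstr.compile, QCircuit.cost, QGate.cost, QGate.rename]
    rw [this]
    exact Nat.le_mul_of_pos_right _ (by omega)
  · refine (cost_callCirc_le _ _ _ _).trans ?_
    rw [QCircuit.cost_rename]
    simp only [BBInstr.cost]
    omega
  · refine (cost_callCirc_le _ _ _ _).trans ?_
    rw [QCircuit.cost_rename]
    simp only [BBInstr.cost]
    omega

theorem toOp_flatMap_compile (prog : List (BBInstr nx nw m na nc nz))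
    (ψ : QState (JointReg nx nw m na nc nz N)) :
    QCircuit.toOp (prog.flatMap (BBInstr.compile U₁ U₂)) *ᵥ ψ =
      prog.foldl (fun ψ t => t.toOp U₁.toOp U₂.toOp *ᵥ ψ) ψ := by
  induction prog generalizing ψ with
  | nil => exact Matrix.one_mulVec _
  | cons t prog ih =>
    rw [List.flatMap_cons, QCircuit.toOp_append, ← Matrix.mulVec_mulVec, BBInstr.toOp_compile, ih]
    rfl

end Compile

section Loaded

/-- A family of dishonest provers, indexed by the instances, that have the same circuits and the
same advice, and in which the instance is found in the private qubits at the positions `pos`. The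
map `load x` says how the basis states of the advice register are extended to basis states of the
private register. -/
structure LoadedProver (nx na nc nz : ℕ) where
  work : ℕ
  seed : ℕ
  advice : QState (Fin seed)
  advice_unit : IsUnitState advice
  load : Bits nx → Bits seed → Bits work
  load_injective : ∀ x, Function.Injective (load x)
  pos : Fin nx ↪ Fin work
  load_pos : ∀ x w i, load x w (pos i) = x i
  load_of_notMem : ∀ x x' w i, i ∉ Set.range pos → load x w i = load x' w i
  stage₁ : QCircuit (Fin na ⊕ Fin work)
  stage₂ : QCircuit ((Fin nc ⊕ Fin nz) ⊕ Fin work)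

variable {nx nw na nc nz : ℕ}

/-- The member of the family for the instance `x`. -/
noncomputable def LoadedProver.prover (L : LoadedProver nx na nc nz) (x : Bits nx) :
    SigmaAdversary na nc nz where
  work := L.work
  init := embState (L.load x) L.advice
  init_unit := (sqNorm_embState _ (L.load_injective x) _).trans L.advice_unit
  stage₁ := L.stage₁
  stage₂ := L.stage₂

/-- The registers of an extractor, of its messages and of the prover, arranged as the registers of
an algorithm. -/
noncomputable def jointEquiv (nx nw m na nc nz N : ℕ) : JointReg nx nw m na nc nz N ≃
    Fin nx ⊕ Fin nw ⊕ Fin (Fintype.card (Fin m ⊕ MsgReg na nc nz ⊕ Fin N)) :=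
  (Equiv.sumAssoc _ _ _).trans <| (Equiv.sumAssoc _ _ _).trans <|
    (Equiv.refl _).sumCongr <| (Equiv.sumAssoc _ _ _).trans <|
      (Equiv.refl _).sumCongr <| Fintype.equivFin _

/-- Gates that copy the instance from the input register to the private register of the prover. -/
noncomputable def loadCirc {m : ℕ} (L : LoadedProver nx na nc nz) :
    QCircuit (JointReg nx nw m na nc nz L.work) :=
  mcxLayer (Finset.univ : Finset (Fin nx)) (fun i => .inr (L.pos i)) (fun i => {.inl (.inl (.inl i))})
    (by simp)

/-- The witness finder that runs an extractor on a member of a family of provers. -/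
noncomputable def BBExtractor.finder (K : BBExtractor nx nw na nc nz) (L : LoadedProver nx na nc nz) :
    QAlg nx nw where
  work := Fintype.card (Fin K.work ⊕ MsgReg na nc nz ⊕ Fin L.work)
  init b := embState (fun w => Sum.elim (fun _ => false) (Sum.elim (fun _ => false)
    (L.load (fun _ => false) w))) L.advice
      (b ∘ Fintype.equivFin (Fin K.work ⊕ MsgReg na nc nz ⊕ Fin L.work))
  init_unit := by
    refine (sqNorm_comp_equiv (Fintype.equivFin (Fin K.work ⊕ MsgReg na nc nz ⊕ Fin L.work))
      (embState (fun w => Sum.elim (fun _ => false) (Sum.elim (fun _ => false)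
        (L.load (fun _ => false) w))) L.advice)).trans
      ((sqNorm_embState _ ?_ _).trans L.advice_unit)
    intro w w' h
    exact L.load_injective (fun _ => false) (funext fun i => congrFun h (.inr (.inr i)))
  circ := QCircuit.rename (jointEquiv nx nw K.work na nc nz L.work).toEmbedding
    (loadCirc L ++ K.prog.flatMap (BBInstr.compile L.stage₁ L.stage₂))

theorem BBExtractor.finder_start (K : BBExtractor nx nw na nc nz) (L : LoadedProver nx na nc nz)
    (x : Bits nx) : (K.finder L).start x = fun b =>
      embState (fun w => Sum.elim (Sum.elim (Sum.elim x fun _ => false) fun _ => false)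
        (L.load (fun _ => false) w)) L.advice (b ∘ jointEquiv nx nw K.work na nc nz L.work) := by
  have key : ∀ b : Fin nx ⊕ Fin nw ⊕
      Fin (Fintype.card (Fin K.work ⊕ MsgReg na nc nz ⊕ Fin L.work)) → Bool,
      (if (∀ i, b (.inl i) = x i) ∧ (∀ i, b (.inr (.inl i)) = false) then
        embState (fun w => Sum.elim (fun _ => false) (Sum.elim (fun _ => false)
          (L.load (fun _ => false) w))) L.advice ((fun i => b (.inr (.inr i))) ∘
            Fintype.equivFin (Fin K.work ⊕ MsgReg na nc nz ⊕ Fin L.work)) else 0) =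
      embState (fun w => Sum.elim (Sum.elim (Sum.elim x fun _ => false) fun _ => false)
        (L.load (fun _ => false) w)) L.advice (b ∘ jointEquiv nx nw K.work na nc nz L.work) := by
    intro b
    have h : ∀ w : Bits L.seed, b ∘ jointEquiv nx nw K.work na nc nz L.work =
        Sum.elim (Sum.elim (Sum.elim x fun _ => false) fun _ => false)
          (L.load (fun _ => false) w) ↔
        ((∀ i, b (.inl i) = x i) ∧ (∀ i, b (.inr (.inl i)) = false)) ∧
        (fun i => b (.inr (.inr i))) ∘ Fintype.equivFin (Fin K.work ⊕ MsgReg na nc nz ⊕ Fin L.work) =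
          Sum.elim (fun _ => false) (Sum.elim (fun _ => false) (L.load (fun _ => false) w)) := by
      intro w
      constructor
      · intro h
        refine ⟨⟨fun i => congrFun h (.inl (.inl (.inl i))),
          fun i => congrFun h (.inl (.inl (.inr (.inl i))))⟩, funext ?_⟩
        rintro (i | i | i)
        · exact congrFun h (.inl (.inl (.inr (.inr i))))
        · exact congrFun h (.inl (.inr i))
        · exact congrFun h (.inr i)
      · rintro ⟨⟨h, h'⟩, h''⟩
        funext i
        rcases i with ((i | i | i) | i) | i
        · exact h i
        · exact h' i
        · exact congrFun h'' (.inl i)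
        · exact congrFun h'' (.inr (.inl i))
        · exact congrFun h'' (.inr (.inr i))
    simp only [embState_apply, h, ite_and]
    split_ifs <;> simp
  exact funext key

theorem loadCirc_mulVec {m : ℕ} (L : LoadedProver nx na nc nz) (x : Bits nx) :
    (loadCirc (nw := nw) (m := m) L).toOp *ᵥ
      embState (fun w => Sum.elim (Sum.elim (Sum.elim x fun _ => false) fun _ => false)
        (L.load (fun _ => false) w)) L.advice =
      embState (fun w => Sum.elim (Sum.elim (Sum.elim x fun _ => false) fun _ => false)
        (L.load x w)) L.advice := by
  refine toOp_mulVec_embState (fun w => mcxLayer_maps _ _ _ ?_ _ _ ?_) _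
  · simp
  · have h0 : bitVal false = 0 := rfl
    rintro (i | i)
    · simp
    · simp only [Sum.elim_inr, Sum.inr.injEq, Finset.prod_singleton, Sum.elim_inl]
      by_cases hi : i ∈ Set.range L.pos
      · obtain ⟨j, rfl⟩ := hi
        simp [L.load_pos, h0]
      · have : ∀ j, L.pos j ≠ i := fun j hj => hi ⟨j, hj⟩
        rw [L.load_of_notMem x (fun _ => false) w i hi]
        simp [this]

/-- The witness finder does on input `x` what the extractor does with the prover for `x`. -/
theorem BBExtractor.finder_prob (K : BBExtractor nx nw na nc nz) (L : LoadedProver nx na nc nz)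
    (x : Bits nx) (P : Bits nw → Prop) : (K.finder L).prob x P = K.prob (L.prover x) x P := by
  have hstart : (embState (fun w => Sum.elim (Sum.elim (Sum.elim x fun _ => false) fun _ => false)
        (L.load x w)) L.advice : QState (JointReg nx nw K.work na nc nz L.work)) = fun b =>
      if (∀ i, b (.inl (.inl (.inl i))) = x i) ∧ (∀ i, b (.inl (.inl (.inr i))) = false) ∧
        (∀ i, b (.inl (.inr i)) = false) then
      (L.prover x).init (fun i => b (.inr i)) else 0 := by
    funext b
    have h : ∀ w : Bits L.seed, b = Sum.elim (Sum.elim (Sum.elim x fun _ => false) fun _ => false)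
        (L.load x w) ↔ ((∀ i, b (.inl (.inl (.inl i))) = x i) ∧
        (∀ i, b (.inl (.inl (.inr i))) = false) ∧ (∀ i, b (.inl (.inr i)) = false)) ∧
        (fun i => b (.inr i)) = L.load x w := by
      intro w
      simp only [funext_iff, Sum.forall, Sum.elim_inl, Sum.elim_inr, and_assoc]
    simp only [LoadedProver.prover, embState_apply, h, ite_and]
    split_ifs <;> simp
  have hfinal : (K.finder L).circ.toOp *ᵥ (K.finder L).start x = fun b =>
      K.final (L.prover x) x (b ∘ jointEquiv nx nw K.work na nc nz L.work) := by
    rw [BBExtractor.finder_start]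
    refine (toOp_rename_equiv _ _ _).trans ?_
    rw [QCircuit.toOp_append, ← Matrix.mulVec_mulVec, loadCirc_mulVec, toOp_flatMap_compile, hstart]
    rfl
  unfold QAlg.prob BBExtractor.prob
  rw [hfinal]
  exact measureProb_comp_equiv (jointEquiv nx nw K.work na nc nz L.work)
    (fun i => .inl (.inl (.inr (.inl i)))) _ P

theorem BBExtractor.size_finder_le (K : BBExtractor nx nw na nc nz) (L : LoadedProver nx na nc nz)
    (x : Bits nx) : (K.finder L).size ≤
      (K.size + (na + (nc + nz)) + (L.prover x).size) + nx * 2 +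
        K.size * (1 + 2 * (L.prover x).size) := by
  have hL : (L.prover x).size = L.work + L.stage₁.cost + L.stage₂.cost := rfl
  have hK : K.size = K.work + (K.prog.map BBInstr.cost).sum := rfl
  have h1 : QCircuit.cost (K.prog.flatMap (BBInstr.compile L.stage₁ L.stage₂)) ≤
      K.size * (1 + 2 * (L.prover x).size) := by
    rw [cost_flatMap]
    refine (List.sum_le_sum fun t _ => BBInstr.cost_compile_le L.stage₁ L.stage₂ t).trans ?_
    rw [List.sum_map_mul_right]
    refine Nat.mul_le_mul (by omega) (by omega)
  have h2 := cost_mcxLayer_le (ι := JointReg nx nw K.work na nc nz L.work)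
    (Finset.univ : Finset (Fin nx)) (fun i => .inr (L.pos i)) (fun i => {.inl (.inl (.inl i))})
    (by simp) 1 (by simp)
  rw [Finset.card_univ, Fintype.card_fin] at h2
  have h3 : (K.finder L).size = Fintype.card (Fin K.work ⊕ MsgReg na nc nz ⊕ Fin L.work) +
      (QCircuit.cost (loadCirc (nw := nw) (m := K.work) L) +
        QCircuit.cost (K.prog.flatMap (BBInstr.compile L.stage₁ L.stage₂))) := by
    rw [← QCircuit.cost_append]
    simp only [QAlg.size, finder, QCircuit.cost_rename]
  rw [h3]
  simp only [Fintype.card_sum, Fintype.card_fin]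
  have h4 : QCircuit.cost (loadCirc (nw := nw) (m := K.work) L) ≤ nx * 2 := h2
  omega

end Loaded

section ForgerProver

theorem embState_embState {κ₁ κ₂ κ₃ : Type} [Fintype κ₁] [DecidableEq κ₁] [Fintype κ₂]
    [DecidableEq κ₂] [Fintype κ₃] [DecidableEq κ₃] (g : (κ₂ → Bool) → (κ₃ → Bool))
    (h : (κ₁ → Bool) → (κ₂ → Bool)) (ψ : QState κ₁) :
    embState g (embState h ψ) = embState (fun b => g (h b)) ψ := by
  funext c
  simp only [embState_apply]
  have : ∀ b, (if c = g b then ∑ b', if b = h b' then ψ b' else 0 else 0) =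
      ∑ b', if b = h b' then (if c = g b then ψ b' else 0) else 0 := by
    intro b
    split_ifs
    · rfl
    · simp
  simp only [this]
  rw [Finset.sum_comm]
  simp

theorem embState_comp_equiv {κ ι ι' : Type} [Fintype κ] [DecidableEq κ] [Fintype ι] [DecidableEq ι]
    [Fintype ι'] [DecidableEq ι'] (E : ι ≃ ι') (g : (κ → Bool) → (ι → Bool)) (ψ : QState κ) :
    (fun b => embState g ψ (b ∘ E)) = embState (fun b => g b ∘ E.symm) ψ := by
  funext b
  simp only [embState_apply, Equiv.eq_comp_symm]

variable {nin n₀ na nc nz nout k r m : ℕ} (A : QOracleAlg nin (n₀ + na) nc nout)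
  (M : Fin r → Fin (k + 1) × Fin (n₀ + na + 1) → ZMod 2)
  (circ : QCircuit (Fin r ⊕ Fin nc ⊕ Fin m))
  (pre : List (QCircuit (OracleReg nin (n₀ + na) nc nout A.work)))
  (post : List (Bool × QCircuit (OracleReg nin (n₀ + na) nc nout A.work)))
  (pos : Fin (n₀ + na) → OracleReg nin (n₀ + na) nc nout A.work)
  (zpos : Fin nz → OracleReg nin (n₀ + na) nc nout A.work)

/-- The provers obtained from a forger run the same circuits for all public keys. -/
theorem exists_loadedProver_forgerProver :
    ∃ L : LoadedProver nin na nc nz, ∀ x, L.prover x = forgerProver A M circ pre post pos zpos x := by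
  let E := Fintype.equivFin (SimSys nin (n₀ + na) nc nout A.work k r m)
  refine ⟨{ work := _
            seed := A.work
            advice := A.init
            advice_unit := A.init_unit
            load := fun x w => Sum.elim (Sum.elim x (Sum.elim (fun _ => false)
              (Sum.elim (fun _ => false) (Sum.elim (fun _ => false) w))))
                (simZero fun _ => false) ∘ E.symm
            load_injective := ?_
            pos := (Function.Embedding.inl.trans .inl).trans E.toEmbedding
            load_pos := ?_
            load_of_notMem := ?_
            stage₁ := QCircuit.rename ((Equiv.refl _).sumCongr E).toEmbedding
              (stage₁Circ M circ A.first pre pos)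
            stage₂ := QCircuit.rename ((Equiv.refl _).sumCongr E).toEmbedding
              (stage₂Circ M circ post zpos) }, fun x => ?_⟩
  · intro x w w' h
    funext i
    simpa using congrFun h (E (.inl (.inr (.inr (.inr (.inr i))))))
  · intro x w i
    simp
  · intro x x' w i hi
    obtain ⟨i, rfl⟩ := E.surjective i
    rcases i with (i | i) | i
    · exact absurd ⟨i, rfl⟩ hi
    · simp
    · simp
  · unfold LoadedProver.prover forgerProver
    congr 1
    rw [A.start_eq_embState, embState_embState]
    exact (embState_comp_equiv E _ _).symm

theorem exists_loadedProver_reprogramProver {nm : ℕ}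
    (A : QOracleAlg nin (nin + nm + na) nc (nm + (na + nz)))
    (M : Fin r → Fin (k + 1) × Fin (nin + nm + na + 1) → ZMod 2)
    (circ : QCircuit (Fin r ⊕ Fin nc ⊕ Fin m)) (j : Option (Fin A.rounds.length × Bool)) :
    ∃ L : LoadedProver nin na nc nz, ∀ x, L.prover x = reprogramProver A M circ x j := by
  rcases j with _ | ⟨i, s⟩
  · exact exists_loadedProver_forgerProver (n₀ := nin + nm) A M circ _ _ _ _
  · exact exists_loadedProver_forgerProver (n₀ := nin + nm) A M circ _ _ _ _

end ForgerProver

/-! ### Negligible functions -/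

section Asymptotic

theorem Negligible.of_le {f g : ℕ → ℝ} (hg : Negligible g) (h0 : ∀ η, 0 ≤ f η)
    (h : ∀ η, f η ≤ g η) : Negligible f :=
  Asymptotics.SuperpolynomialDecay.trans_abs_le hg fun η => by
    rw [abs_of_nonneg (h0 η)]
    exact (h η).trans (le_abs_self _)

theorem Negligible.polynomial_mul {f : ℕ → ℝ} (hf : Negligible f) (p : Polynomial ℕ) :
    Negligible fun η => ((p.eval η : ℕ) : ℝ) * f η := by
  have := Asymptotics.SuperpolynomialDecay.polynomial_mul hf (p.map (Nat.castRingHom ℝ))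
  refine this.congr fun η => ?_
  rw [Polynomial.eval_natCast_map]
  simp

theorem Negligible.of_pow {f : ℕ → ℝ} {D : ℕ} (hD : D ≠ 0) (h0 : ∀ η, 0 ≤ f η)
    (h : Negligible fun η => f η ^ D) : Negligible f := by
  intro k
  have h1 := (h (k * D)).rpow_const (p := (D : ℝ)⁻¹) (Or.inr (by positivity))
  rw [Real.zero_rpow (by positivity)] at h1
  refine h1.congr fun η => ?_
  rw [pow_mul, ← mul_pow]
  exact Real.pow_rpow_inv_natCast (mul_nonneg (by positivity) (h0 η)) hD

end Asymptotic

/-! ### From dishonest provers to witnesses -/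

section Extraction

theorem PMF.sum_toReal {α : Type*} [Fintype α] (μ : PMF α) : ∑ a, (μ a).toReal = 1 := by
  have : ∑ a, μ a = 1 := by rw [← μ.tsum_coe, tsum_fintype]
  rw [← ENNReal.toReal_sum fun a _ => μ.apply_ne_top a, this, ENNReal.toReal_one]

theorem PMF.sum_map_toReal_mul {α β : Type*} [Fintype α] [Fintype β] (μ : PMF α) (f : α → β)
    (g : β → ℝ) : ∑ b, ((μ.map f) b).toReal * g b = ∑ a, (μ a).toReal * g (f a) := by
  classical
  have h : ∀ b, ((μ.map f) b).toReal = ∑ a, if b = f a then (μ a).toReal else 0 := by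
    intro b
    rw [PMF.map_apply, tsum_fintype, ENNReal.toReal_sum]
    · refine Finset.sum_congr rfl fun a _ => ?_
      split_ifs <;> simp_all
    · intro a _
      split_ifs
      · exact μ.apply_ne_top a
      · simp
  simp only [h, Finset.sum_mul, ite_mul, zero_mul]
  rw [Finset.sum_comm]
  simp

variable {R : RelFamily} {G : InstanceGen R} {S : SigmaProtocol R}

/-- For a proof of knowledge for a hard relation, a family of dishonest provers that are efficient
and differ only in the instance that they are given is accepted with negligible probability. -/
theorem negligible_acceptProb (hR : IsHard R G) (hPoK : S.IsProofOfKnowledge)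
    (L : ∀ η, LoadedProver (R.nx η) (S.na η) (S.nc η) (S.nz η)) {b : ℕ → ℕ} (hb : PolyBounded b)
    (hL : ∀ η x, ((L η).prover x).size ≤ b η) :
    Negligible fun η =>
      ∑ xw, (G.gen η xw).toReal * S.acceptProb η xw.1 ((L η).prover xw.1) := by
  obtain ⟨K, p, d, hK, hp, hd, hext⟩ := hPoK
  -- The knowledge error is uniform in the instance, but belongs to a family with one prover for each
  -- security parameter. The member of `L η` for the instance with the largest extraction deficit is
  -- chosen; the error for it then bounds the deficits of the other members on their own instances.
  let deficit : ∀ η, Bits (R.nx η) → ℝ := fun η x =>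
    1 / ((p.eval η : ℕ) : ℝ) * (S.acceptProb η x ((L η).prover x)) ^ d -
      (K η).prob ((L η).prover x) x fun w => R.rel η x w
  have hworst : ∀ η, ∃ x ∈ R.inst η, ∀ x' ∈ R.inst η, deficit η x' ≤ deficit η x := by
    intro η
    obtain ⟨xw, hxw⟩ := (G.gen η).support_nonempty
    exact Set.exists_max_image _ (deficit η) (Set.toFinite _)
      ⟨xw.1, R.rel_inst η _ _ (G.gen_rel η xw hxw)⟩
  choose x₀ hx₀ hmax using hworst
  obtain ⟨κ, hκ, hext⟩ := hext (fun η => (L η).prover (x₀ η)) (hb.mono fun η => hL η _)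
  have hνB : PolyBounded fun η => ((K η).finder (L η)).size := by
    refine PolyBounded.mono (g := fun η => ((K η).size + (S.na η + (S.nc η + S.nz η)) + b η) +
      R.nx η * 2 + (K η).size * (1 + 2 * b η)) ?_ fun η => ?_
    · have h1 := S.na_poly
      have h2 := S.nc_poly
      have h3 := S.nz_poly
      have h4 := R.nx_poly
      repeat' first | assumption | apply PolyBounded.const | apply PolyBounded.add |
        apply PolyBounded.mul
    · have := hL η (x₀ η)
      refine ((K η).size_finder_le (L η) (x₀ η)).trans ?_
      gcongr
  have hν := hR (fun η => (K η).finder (L η)) hνB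
  set ν : ℕ → ℝ := fun η => ∑ xw, (G.gen η xw).toReal *
    ((K η).finder (L η)).prob xw.1 (fun w' => R.rel η xw.1 w') with hνdef
  have hD : max 1 ⌈d⌉₊ ≠ 0 := by have := le_max_left 1 ⌈d⌉₊; omega
  have hα0 : ∀ η, 0 ≤ ∑ xw, (G.gen η xw).toReal * S.acceptProb η xw.1 ((L η).prover xw.1) :=
    fun η => Finset.sum_nonneg fun xw _ =>
      mul_nonneg ENNReal.toReal_nonneg (S.acceptProb_nonneg η _ _)
  refine Negligible.of_pow hD hα0 ?_
  refine (Negligible.polynomial_mul (hν.add hκ) p).of_le (fun η => pow_nonneg (hα0 η) _) fun η => ?_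
  -- Jensen's inequality, for the exponent `max 1 ⌈d⌉₊`, an integer that is positive and at least `d`.
  refine (Real.pow_arith_mean_le_arith_mean_pow Finset.univ _ _
    (fun xw _ => ENNReal.toReal_nonneg) (PMF.sum_toReal _)
    (fun xw _ => S.acceptProb_nonneg η _ _) _).trans ?_
  have hpη : (0 : ℝ) < ((p.eval η : ℕ) : ℝ) := by exact_mod_cast hp η
  have hpt : ∀ xw ∈ (Finset.univ : Finset (Bits (R.nx η) × Bits (R.nw η))),
      (G.gen η xw).toReal * S.acceptProb η xw.1 ((L η).prover xw.1) ^ (max 1 ⌈d⌉₊) ≤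
      (G.gen η xw).toReal * (((p.eval η : ℕ) : ℝ) *
        (((K η).finder (L η)).prob xw.1 (fun w' => R.rel η xw.1 w') + κ η)) := by
    intro xw _
    by_cases hxw : xw ∈ (G.gen η).support
    · refine mul_le_mul_of_nonneg_left ?_ ENNReal.toReal_nonneg
      have hinst := R.rel_inst η _ _ (G.gen_rel η xw hxw)
      have h1 := hmax η xw.1 hinst
      have h2 := hext η (x₀ η) (hx₀ η)
      have h3 : S.acceptProb η xw.1 ((L η).prover xw.1) ^ (max 1 ⌈d⌉₊) ≤
          S.acceptProb η xw.1 ((L η).prover xw.1) ^ d := by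
        rw [← Real.rpow_natCast]
        refine Real.rpow_le_rpow_of_exponent_ge' (S.acceptProb_nonneg η _ _)
          (S.acceptProb_le_one η _ _) hd ((Nat.le_ceil d).trans ?_)
        exact_mod_cast le_max_right _ _
      refine h3.trans ?_
      rw [BBExtractor.finder_prob]
      rw [← div_le_iff₀' hpη, div_eq_inv_mul, ← one_div]
      simp only [deficit] at h1
      linarith
    · have : G.gen η xw = 0 := by
        rwa [PMF.mem_support_iff, not_not] at hxw
      simp [this]
  refine (Finset.sum_le_sum hpt).trans (le_of_eq ?_)
  simp only [mul_left_comm _ ((p.eval η : ℕ) : ℝ), ← Finset.mul_sum, mul_add,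
    Finset.sum_add_distrib, ← Finset.sum_mul, PMF.sum_toReal, one_mul, hνdef, Pi.add_apply]

end Extraction

/-! ### Unforgeability -/

section Unforgeability

variable {R : RelFamily} (G : InstanceGen R) (S : SigmaProtocol R)
    (nm : ℕ → ℕ) (hm : PolyBounded nm) (reps : ℕ → ℕ) (η : ℕ)

theorem QOracleAlg.queries_le_size {nin nq ny nout : ℕ} (A : QOracleAlg nin nq ny nout) :
    A.queries ≤ A.size := by
  unfold QOracleAlg.size
  omega

theorem signature_verify_iff {work : ℕ}
    (H : Bits (R.nx η + nm η + S.na η) → {c // c ∈ S.chal η}) (x : Bits (R.nx η))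
    (b : OracleReg (R.nx η) (R.nx η + nm η + S.na η) (S.nc η) (nm η + (S.na η + S.nz η)) work →
      Bool) :
    (S.signature G nm hm reps).verify η H x (fun i => b (outPos (Fin.castAdd _ i)))
        (fun i => b (outPos (Fin.natAdd _ i))) ↔
      S.verify η x (firstMessage (n₀ := R.nx η + nm η) (outPoint x b)) (H (outPoint x b))
        (b ∘ responsePos) := by
  have h1 : (fun i => Fin.append x (fun i : Fin (nm η) => b (outPos (Fin.castAdd _ i)))
      (Fin.castAdd (nm η) i)) = x := funext fun i => by simp
  have h2 : firstMessage (n₀ := R.nx η + nm η) (outPoint x b) =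
      fun i => b (outPos (Fin.natAdd (nm η) (Fin.castAdd (S.nz η) i))) := funext fun i => by
    simp [firstMessage, outPoint]
  rw [h2]
  exact iff_of_eq (congrArg (fun y => S.verify η y
    (fun i => b (outPos (Fin.natAdd (nm η) (Fin.castAdd (S.nz η) i)))) (H (outPoint x b))
    (b ∘ responsePos)) h1)

/-- The advantage of a forger is bounded by the acceptance probability of a family of dishonest
provers that run the same circuits for all public keys. -/
theorem exists_advNMA_le
    (A : QOracleAlg (R.nx η) (R.nx η + nm η + S.na η) (S.nc η) (nm η + (S.na η + S.nz η)))
    {r m : ℕ} (f : Bits r → Bits (S.nc η)) (circ : QCircuit (Fin r ⊕ Fin (S.nc η) ⊕ Fin m))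
    (hf : ComputesInto circ f) :
    ∃ L : LoadedProver (R.nx η) (S.na η) (S.nc η) (S.nz η),
      (∀ x, (L.prover x).size ≤
        proverBound (R.nx η) (nm η) (S.na η) (S.nc η) (S.nz η) r m A.size circ.cost) ∧
      (S.signature G nm hm reps).advNMA η A ≤ 4 * (2 * A.queries + 1) * (2 * A.queries + 1) *
        (∑ xw, (G.gen η xw).toReal * S.acceptProb η xw.1 (L.prover xw.1)) +
        (1 + 12 * (A.queries : ℝ) ^ 2) * ∑ v, |samplerLaw f v - uniformLaw (S.chal η) v| := by
  classical
  let wt : Bits (R.nx η) → ℝ := fun x =>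
    (((S.signature G nm hm reps).gen η).map Prod.fst x).toReal
  have hwt : ∀ g : Bits (R.nx η) → ℝ, ∑ x, wt x * g x = ∑ xw, (G.gen η xw).toReal * g xw.1 := by
    intro g
    have : ((S.signature G nm hm reps).gen η).map Prod.fst = (G.gen η).map Prod.fst := by
      change ((G.gen η).map fun xw => (xw.1, xw)).map Prod.fst = _
      rw [PMF.map_comp]
      rfl
    simp only [wt, this]
    exact PMF.sum_map_toReal_mul _ _ _
  obtain ⟨M, j, hMj⟩ := exists_sum_le_of_uniformAvg wt (fun _ => ENNReal.toReal_nonneg)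
    (PMF.sum_toReal _) (4 * (2 * A.queries + 1))
    ((1 + 12 * (A.queries : ℝ) ^ 2) * ∑ v, |samplerLaw f v - uniformLaw (S.chal η) v|)
    (by positivity) _ _
    fun x => forger_success_le A circ f (S.chal η) x hf (S.chal_nonempty η) (S.verify η x)
  obtain ⟨L, hL⟩ := exists_loadedProver_reprogramProver A M circ j
  refine ⟨L, fun x => ?_, ?_⟩
  · rw [hL]
    exact size_reprogramProver_le A M circ x j
  · have hcard : (Fintype.card (Option (Fin A.rounds.length × Bool)) : ℝ) = 2 * A.queries + 1 := by
      simp [QOracleAlg.queries, mul_comm]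
    rw [hcard] at hMj
    have hacc : ∀ x, S.acceptProb η x (L.prover x) = uniformAvg fun c : {c // c ∈ S.chal η} =>
        ∑ a, measureProb (fun i => .inl (.inr i)) ((reprogramProver A M circ x j).state₂ a c)
          fun z => S.verify η x a c z := by
      intro x
      rw [hL]
      rfl
    rw [← hwt fun x => S.acceptProb η x (L.prover x)]
    simp only [hacc]
    refine le_of_eq_of_le ?_ hMj
    unfold ROSignature.advNMA
    refine Finset.sum_congr rfl fun x _ => congrArg _ (congrArg uniformAvg (funext fun H => ?_))
    unfold QOracleAlg.prob measureProb
    refine Finset.sum_congr rfl fun b _ => ?_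
    refine if_congr (iff_of_eq ?_) rfl rfl
    exact propext (signature_verify_iff G S nm hm reps η H x b)

end Unforgeability

/-- A Σ-protocol for a hard relation that is a proof of knowledge, with a superpolynomially large
(efficiently samplable) challenge space, yields a Fiat–Shamir signature scheme that is EUF-NMA
secure against quantum adversaries in the quantum random-oracle model. -/
theorem theorem3 (R : RelFamily) (G : InstanceGen R) (hR : IsHard R G)
    (S : SigmaProtocol R) (hchal : S.SuperpolyChallenges) (hsample : S.EfficientChallenges)
    (hPoK : S.IsProofOfKnowledge)
    (nm : ℕ → ℕ) (hm : PolyBounded nm) (reps : ℕ → ℕ) :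
    (S.signature G nm hm reps).EUFNMA := by
  intro A hA
  obtain ⟨r, m, f, circ, hr, hm', hcirc, hf, hΔ⟩ := hsample
  choose L hsize hadv using fun η => exists_advNMA_le G S nm hm reps η (A η) (f η) (circ η) (hf η)
  have hα := negligible_acceptProb hR hPoK L
    (PolyBounded.proverBound R.nx_poly hm S.na_poly S.nc_poly S.nz_poly hr hm' hA hcirc) hsize
  obtain ⟨P, hP⟩ := hA
  have hbound := (Negligible.polynomial_mul hα (4 * (2 * P + 1) * (2 * P + 1))).add
    (Negligible.polynomial_mul hΔ (1 + 12 * P ^ 2))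
  refine Negligible.of_le hbound (fun η => Finset.sum_nonneg fun x _ =>
    mul_nonneg ENNReal.toReal_nonneg (div_nonneg (Finset.sum_nonneg fun H _ =>
      measureProb_nonneg _ _ _) (Nat.cast_nonneg _))) fun η => (hadv η).trans ?_
  have hq : QOracleAlg.queries (A η) ≤ P.eval η := (QOracleAlg.queries_le_size _).trans (hP η)
  simp only [Pi.add_apply, Polynomial.eval_mul, Polynomial.eval_add, Polynomial.eval_pow,
    Polynomial.eval_ofNat, Polynomial.eval_one, Nat.cast_mul, Nat.cast_add, Nat.cast_pow,
    Nat.cast_ofNat, Nat.cast_one]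
  refine add_le_add (mul_le_mul_of_nonneg_right ?_ ?_) ?_
  · gcongr <;> exact hq
  · exact Finset.sum_nonneg fun xw _ =>
      mul_nonneg ENNReal.toReal_nonneg (S.acceptProb_nonneg η _ _)
  · refine mul_le_mul ?_ (le_of_eq ?_) (Finset.sum_nonneg fun _ _ => abs_nonneg _) (by positivity)
    · gcongr; exact hq
    · refine Finset.sum_congr rfl fun v _ => ?_
      unfold samplerLaw uniformLaw uniformAvg
      congr!
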